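/- Let $\mathbb K$ be an algebraically closed field, let $p\ge 1$ be an odd integer and let $q\in\mathbb K^*$ be not a root of unity. Fix a fourth root $t$ of $q$ and write $q^{k/4}=t^k$ for $k\in\mathbb Z$. Let $A$ be the quantum torus over $\mathbb K$ with generators $z_1^{\pm1},\dots,z_p^{\pm1}$ and relations $z_iz_j=q_{ij}z_jz_i$ for $1\le j<i\le p$, where $q_{ij}=q^{-1}$ if $i$ is even and $j$ is odd, and $q_{ij}=1$ otherwise. Let $\alpha$ be the $\mathbb K$-automorphism of $A$ with $\alpha(z_i)=z_i$ for $i$ even and $\alpha(z_i)=q^{-1}z_i$ for $i$ odd. Put $u=q^{\frac{p-1}{2}}z_p^{-1}+qz_p$ and $v=u-\alpha(u)=(1-q)(q^{\frac{p-1}{2}}z_p^{-1}-z_p)$, which are central in $A$. Let $R=R(A,\alpha,v,1)$ be the ambiskew polynomial algebra generated over $A$ by $x$ and $y$ subject to $ya=\alpha(a)y$ and $xa=\alpha^{-1}(a)x$ for $a\in A$, and $xy=yx+v$; the element $z=xy-u$ is central in $R$. For $\lambda\in\mathbb K$, identify $R/(z-\lambda)R$ with the generalized Weyl algebra $W=W(A,\alpha,u+\lambda)$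 generated over $A$ by $X,Y$ (the images of $x,y$) subject to $YX=\alpha(u+\lambda)$, $XY=u+\lambda$, $Ya=\alpha(a)Y$, $Xa=\alpha^{-1}(a)X$ for $a\in A$, and let $\pi:R\to W$ be the canonical epimorphism. For an integer $m\geq 1$ and an ideal $I$ of $A$ containing $u+\lambda$ and $\alpha^m(u+\lambda)$, let $J(I)=\bigoplus_{i\ge 0}I_iY^i\oplus\bigoplus_{i\ge 1}I_{-i}X^i$, where $I_i=\bigcap_{\ell=0}^{m-1-i}\alpha^{-\ell}(I)$ and $I_{-i}=\bigcap_{\ell=i}^{m-1}\alpha^{-\ell}(I)$ for $0\le i\le m-1$, and $I_i=I_{-i}=A$ for $i\ge m$; it is an ideal of $W$. For each integer $m\ge1$ and each $\varepsilon\in\{1,-1\}$, let $\lambda=-\varepsilon q^{\frac{p-2m+1}{4}}(q^m+1)$ and $$F_{m,\varepsilon}=\pi^{-1}\bigl(J((z_p-\varepsilon q^{\frac{p+2m-3}{4}})A)\bigr).$$ Then, for every integer $m\ge 1$, $F_{m,1}$ and $F_{m,-1}$ are prime ideals of $R$ of height two, they are distinct if $\mathbb K$ does not have characteristic $2$, and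 each of the rings $R/F_{m,1}$ and $R/F_{m,-1}$ has right Goldie rank $m$ (that is, $m$ is the largest $k$ such that the ring contains a direct sum of $k$ nonzero right ideals). -/

import Mathlib

/-! ### Prime two-sided ideals and right Goldie rank -/

/-- A two-sided ideal `P` of a ring is prime if it is proper and `a S b ⊆ P` implies
`a ∈ P` or `b ∈ P`. -/
def IsPrimeTwoSided {S : Type*} [Ring S] (P : TwoSidedIdeal S) : Prop :=
  P ≠ ⊤ ∧ ∀ a b : S, (∀ s : S, a * s * b ∈ P) → a ∈ P ∨ b ∈ P

/-- The prime spectrum of a (noncommutative) ring, ordered by inclusion.  The height of a prime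
ideal is `Order.height` in this partially ordered set. -/
abbrev PrimeSpec (S : Type*) [Ring S] : Type _ :=
  {P : TwoSidedIdeal S // IsPrimeTwoSided P}

/-- The right Goldie rank (right uniform dimension) of a ring `S`: the supremum in `ℕ∞` of the
natural numbers `k` such that `S` contains a direct sum of `k` nonzero right ideals.  A right
ideal of `S` is a `Sᵐᵒᵖ`-submodule of `S`. -/
noncomputable def rightGoldieRank (S : Type*) [Ring S] : ℕ∞ :=
  ⨆ (k : ℕ) (_ : ∃ U : Fin k → Submodule Sᵐᵒᵖ S, iSupIndep U ∧ ∀ i, U i ≠ ⊥), (k : ℕ∞)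

/-! ### Ambiskew polynomial algebras and generalized Weyl algebras -/

/-- The free generators used to present a `K`-algebra that is generated by (the image of) `A`
together with two further elements. -/
inductive TwoGen (A : Type*) : Type _
  | coef (a : A) : TwoGen A
  | x : TwoGen A
  | y : TwoGen A

namespace TwoGen

variable {K : Type*} [Field K] {A : Type*} [Ring A] [Algebra K A]

/-- The relations saying that `a ↦ coef a` is a homomorphism of `K`-algebras. -/
inductive CoefRel (K : Type*) [Field K] (A : Type*) [Ring A] [Algebra K A] :
    FreeAlgebra K (TwoGen A) → FreeAlgebra K (TwoGen A) → Prop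
  | add (a b : A) : CoefRel K A (FreeAlgebra.ι K (coef (a + b)))
      (FreeAlgebra.ι K (coef a) + FreeAlgebra.ι K (coef b))
  | mul (a b : A) : CoefRel K A (FreeAlgebra.ι K (coef (a * b)))
      (FreeAlgebra.ι K (coef a) * FreeAlgebra.ι K (coef b))
  | scalar (c : K) : CoefRel K A (FreeAlgebra.ι K (coef (algebraMap K A c)))
      (algebraMap K (FreeAlgebra K (TwoGen A)) c)

/-- The defining relations of the ambiskew polynomial algebra `R(A, α, v, ρ)`:
`y a = α(a) y`, `x a = α⁻¹(a) x` for `a ∈ A`, and `x y = ρ y x + v`. -/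
inductive AmbiskewRel (α : A ≃ₐ[K] A) (v : A) (ρ : Kˣ) :
    FreeAlgebra K (TwoGen A) → FreeAlgebra K (TwoGen A) → Prop
  | coef {f g : FreeAlgebra K (TwoGen A)} (h : CoefRel K A f g) : AmbiskewRel α v ρ f g
  | y_coef (a : A) : AmbiskewRel α v ρ
      (FreeAlgebra.ι K y * FreeAlgebra.ι K (coef a))
      (FreeAlgebra.ι K (coef (α a)) * FreeAlgebra.ι K y)
  | x_coef (a : A) : AmbiskewRel α v ρ
      (FreeAlgebra.ι K x * FreeAlgebra.ι K (coef a))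
      (FreeAlgebra.ι K (coef (α.symm a)) * FreeAlgebra.ι K x)
  | x_y : AmbiskewRel α v ρ
      (FreeAlgebra.ι K x * FreeAlgebra.ι K y)
      ((ρ : K) • (FreeAlgebra.ι K y * FreeAlgebra.ι K x) + FreeAlgebra.ι K (coef v))

/-- The defining relations of the generalized Weyl algebra `W(A, α, u)`:
`Y X = α(u)`, `X Y = u`, and `Y a = α(a) Y`, `X a = α⁻¹(a) X` for `a ∈ A`. -/
inductive GWARel (α : A ≃ₐ[K] A) (u : A) :
    FreeAlgebra K (TwoGen A) → FreeAlgebra K (TwoGen A) → Prop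
  | coef {f g : FreeAlgebra K (TwoGen A)} (h : CoefRel K A f g) : GWARel α u f g
  | y_coef (a : A) : GWARel α u
      (FreeAlgebra.ι K y * FreeAlgebra.ι K (coef a))
      (FreeAlgebra.ι K (coef (α a)) * FreeAlgebra.ι K y)
  | x_coef (a : A) : GWARel α u
      (FreeAlgebra.ι K x * FreeAlgebra.ι K (coef a))
      (FreeAlgebra.ι K (coef (α.symm a)) * FreeAlgebra.ι K x)
  | y_x : GWARel α u (FreeAlgebra.ι K y * FreeAlgebra.ι K x) (FreeAlgebra.ι K (coef (α u)))
  | x_y : GWARel α u (FreeAlgebra.ι K x * FreeAlgebra.ι K y) (FreeAlgebra.ι K (coef u))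

end TwoGen

/-- The ambiskew polynomial algebra `R(A, α, v, ρ)`, for `v` central in `A`: the algebra generated
over `A` by `x` and `y` subject to `y a = α(a) y`, `x a = α⁻¹(a) x` (`a ∈ A`) and
`x y = ρ y x + v`.  This is the standard presentation of the iterated skew polynomial algebra
`A[y; α][x; β, δ]` with `β = α⁻¹` on `A`, `β(y) = ρ y`, `δ(A) = 0` and `δ(y) = v`. -/
def Ambiskew {K : Type*} [Field K] {A : Type*} [Ring A] [Algebra K A]
    (α : A ≃ₐ[K] A) (v : A) (ρ : Kˣ) : Type _ :=
  RingQuot (TwoGen.AmbiskewRel α v ρ)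

/-- The generalized Weyl algebra `W(A, α, u)`, for `u` central in `A`: the algebra generated over
`A` by `X` and `Y` subject to `Y X = α(u)`, `X Y = u`, `Y a = α(a) Y` and `X a = α⁻¹(a) X`
(`a ∈ A`). -/
def GWA {K : Type*} [Field K] {A : Type*} [Ring A] [Algebra K A]
    (α : A ≃ₐ[K] A) (u : A) : Type _ :=
  RingQuot (TwoGen.GWARel α u)

namespace Ambiskew

variable {K : Type*} [Field K] {A : Type*} [Ring A] [Algebra K A]
  (α : A ≃ₐ[K] A) (v : A) (ρ : Kˣ)

noncomputable instance : Ring (Ambiskew α v ρ) :=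
  inferInstanceAs (Ring (RingQuot (TwoGen.AmbiskewRel α v ρ)))

noncomputable instance : Algebra K (Ambiskew α v ρ) :=
  inferInstanceAs (Algebra K (RingQuot (TwoGen.AmbiskewRel α v ρ)))

end Ambiskew

namespace GWA

variable {K : Type*} [Field K] {A : Type*} [Ring A] [Algebra K A] (α : A ≃ₐ[K] A) (u : A)

noncomputable instance : Ring (GWA α u) :=
  inferInstanceAs (Ring (RingQuot (TwoGen.GWARel α u)))

noncomputable instance : Algebra K (GWA α u) :=
  inferInstanceAs (Algebra K (RingQuot (TwoGen.GWARel α u)))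

/-- The canonical map from the free algebra. -/
noncomputable def mk : FreeAlgebra K (TwoGen A) →ₐ[K] GWA α u :=
  RingQuot.mkAlgHom K (TwoGen.GWARel α u)

/-- The image of `a ∈ A` in `W(A, α, u)`. -/
noncomputable def coef (a : A) : GWA α u := mk α u (FreeAlgebra.ι K (TwoGen.coef a))

/-- The generator `X` of `W(A, α, u)`. -/
noncomputable def X : GWA α u := mk α u (FreeAlgebra.ι K TwoGen.x)

/-- The generator `Y` of `W(A, α, u)`. -/
noncomputable def Y : GWA α u := mk α u (FreeAlgebra.ι K TwoGen.y)

theorem mk_rel {f g : FreeAlgebra K (TwoGen A)} (h : TwoGen.GWARel α u f g) :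
    mk α u f = mk α u g :=
  RingQuot.mkAlgHom_rel K h

/-- The ideal `J(I)` of `W = W(A, α, u)` attached to an ideal `I` of `A` and an integer `m ≥ 1`.
For `i ≥ 0` put `I_i = ⋂ α^{-ℓ}(I)` over `0 ≤ ℓ ≤ m - 1 - i` and `I_{-i} = ⋂ α^{-ℓ}(I)` over
`i ≤ ℓ ≤ m - 1` (empty intersections, which occur for `i ≥ m`, are `A`).  Then `J(I)` is the
two-sided ideal generated by all `I_i Y^i` and `I_{-i} X^i`; when `u` is central and
`u A + α^m(u) A ⊆ I`, the sum of these subgroups is already an ideal. -/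
noncomputable def J (m : ℕ) (I : TwoSidedIdeal A) : TwoSidedIdeal (GWA α u) :=
  TwoSidedIdeal.span
    ({w | ∃ (i : ℕ) (a : A), (∀ ℓ : ℕ, ℓ + i < m → (α ^ ℓ) a ∈ I) ∧ w = coef α u a * Y α u ^ i} ∪
     {w | ∃ (i : ℕ) (a : A), (∀ ℓ : ℕ, i ≤ ℓ → ℓ < m → (α ^ ℓ) a ∈ I) ∧
        w = coef α u a * X α u ^ i})

end GWA

/-- For the conformal ambiskew polynomial algebra `R = R(A, α, v, 1)`, `v = u - α(u)`, with Casimir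
element `z = x y - u`, and for `lam ∈ K`: the canonical epimorphism from `R` onto
`R/(z - lam)R = W(A, α, u + lam)`, sending `x` to `X`, `y` to `Y` and `a ∈ A` to `a`. -/
noncomputable def Ambiskew.toGWA {K : Type*} [Field K] {A : Type*} [Ring A] [Algebra K A]
    (α : A ≃ₐ[K] A) (u v : A) (hv : v = u - α u) (lam : K) :
    Ambiskew α v 1 →ₐ[K] GWA α (u + algebraMap K A lam) :=
  RingQuot.liftAlgHom K (s := TwoGen.AmbiskewRel α v 1)
    ⟨GWA.mk α (u + algebraMap K A lam), by
      intro f g h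
      cases h with
      | coef h => exact GWA.mk_rel _ _ (.coef h)
      | y_coef a => exact GWA.mk_rel _ _ (.y_coef a)
      | x_coef a => exact GWA.mk_rel _ _ (.x_coef a)
      | x_y =>
        subst hv
        have h1 := GWA.mk_rel α (u + algebraMap K A lam) .x_y
        have h2 := GWA.mk_rel α (u + algebraMap K A lam) .y_x
        have h3 := GWA.mk_rel α (u + algebraMap K A lam)
          (.coef (.add (α (u + algebraMap K A lam)) (u - α u)))
        have e : α (u + algebraMap K A lam) + (u - α u) = u + algebraMap K A lam := by
          rw [map_add, AlgEquiv.commutes]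
          abel
        rw [e, map_add] at h3
        rw [h1, map_add, Units.val_one, one_smul, h2, h3]⟩

/-! ### Quantum tori -/

/-- The defining relations of a quantum torus with generators `z_i` (`Sum.inl i`) and `z_i⁻¹`
(`Sum.inr i`): `z_i z_j = Q_{ij} z_j z_i` for `j < i`. -/
inductive QuantumTorusRel {K : Type*} [Field K] {n : ℕ} (Q : Fin n → Fin n → Kˣ) :
    FreeAlgebra K (Fin n ⊕ Fin n) → FreeAlgebra K (Fin n ⊕ Fin n) → Prop
  | mul_inv (i : Fin n) : QuantumTorusRel Q
      (FreeAlgebra.ι K (Sum.inl i) * FreeAlgebra.ι K (Sum.inr i)) 1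
  | inv_mul (i : Fin n) : QuantumTorusRel Q
      (FreeAlgebra.ι K (Sum.inr i) * FreeAlgebra.ι K (Sum.inl i)) 1
  | comm (i j : Fin n) (h : j < i) : QuantumTorusRel Q
      (FreeAlgebra.ι K (Sum.inl i) * FreeAlgebra.ι K (Sum.inl j))
      ((Q i j : K) • (FreeAlgebra.ι K (Sum.inl j) * FreeAlgebra.ι K (Sum.inl i)))

/-- The quantum torus with generators `z_i^{±1}` and relations `z_i z_j = Q_{ij} z_j z_i` for
`j < i`. -/
def QuantumTorus {K : Type*} [Field K] {n : ℕ} (Q : Fin n → Fin n → Kˣ) : Type _ :=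
  RingQuot (QuantumTorusRel Q)

namespace QuantumTorus

variable {K : Type*} [Field K] {n : ℕ} (Q : Fin n → Fin n → Kˣ)

noncomputable instance : Ring (QuantumTorus Q) :=
  inferInstanceAs (Ring (RingQuot (QuantumTorusRel Q)))

noncomputable instance : Algebra K (QuantumTorus Q) :=
  inferInstanceAs (Algebra K (RingQuot (QuantumTorusRel Q)))

/-- The canonical map from the free algebra. -/
noncomputable def mk : FreeAlgebra K (Fin n ⊕ Fin n) →ₐ[K] QuantumTorus Q :=
  RingQuot.mkAlgHom K (QuantumTorusRel Q)

theorem mk_rel {f g : FreeAlgebra K (Fin n ⊕ Fin n)} (h : QuantumTorusRel Q f g) :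
    mk Q f = mk Q g :=
  RingQuot.mkAlgHom_rel K h

/-- The generator `z_i`. -/
noncomputable def z (i : Fin n) : QuantumTorus Q := mk Q (FreeAlgebra.ι K (Sum.inl i))

/-- The generator `z_i⁻¹`. -/
noncomputable def zInv (i : Fin n) : QuantumTorus Q := mk Q (FreeAlgebra.ι K (Sum.inr i))

/-- The `K`-algebra endomorphism with `z_i ↦ c_i z_i` and `z_i⁻¹ ↦ c_i⁻¹ z_i⁻¹`. -/
noncomputable def scaleHom (c : Fin n → Kˣ) : QuantumTorus Q →ₐ[K] QuantumTorus Q :=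
  RingQuot.liftAlgHom K (s := QuantumTorusRel Q)
    ⟨FreeAlgebra.lift K (Sum.elim (fun i => (c i : K) • z Q i)
        (fun i => ((c i)⁻¹ : K) • zInv Q i)), by
      intro f g h
      cases h with
      | mul_inv i =>
        have h1 := mk_rel Q (.mul_inv i)
        rw [map_mul, map_one] at h1
        simpa [z, zInv, smul_smul] using h1
      | inv_mul i =>
        have h1 := mk_rel Q (.inv_mul i)
        rw [map_mul, map_one] at h1
        simpa [z, zInv, smul_smul] using h1
      | comm i j h =>
        have h1 := mk_rel Q (.comm i j h)
        rw [map_mul, map_smul, map_mul] at h1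
        simp only [map_mul, map_smul, FreeAlgebra.lift_ι_apply, Sum.elim_inl, z,
          smul_mul_smul_comm, h1, smul_smul]
        congr 1
        ring⟩

theorem scaleHom_z (c : Fin n → Kˣ) (i : Fin n) : scaleHom Q c (z Q i) = (c i : K) • z Q i := by
  refine (RingQuot.liftAlgHom_mkAlgHom_apply K _ _ _).trans ?_
  simp

theorem scaleHom_zInv (c : Fin n → Kˣ) (i : Fin n) :
    scaleHom Q c (zInv Q i) = ((c i)⁻¹ : K) • zInv Q i := by
  refine (RingQuot.liftAlgHom_mkAlgHom_apply K _ _ _).trans ?_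
  simp

theorem hom_ext {B : Type*} [Ring B] [Algebra K B] {f g : QuantumTorus Q →ₐ[K] B}
    (h : ∀ i, f (z Q i) = g (z Q i)) (h' : ∀ i, f (zInv Q i) = g (zInv Q i)) : f = g := by
  refine RingQuot.ringQuot_ext' K f g (FreeAlgebra.hom_ext ?_)
  funext s
  rcases s with i | i
  · exact h i
  · exact h' i

theorem scaleHom_comp (c d : Fin n → Kˣ) (h : ∀ i, c i * d i = 1) :
    (scaleHom Q c).comp (scaleHom Q d) = AlgHom.id K _ := by
  have hk : ∀ i, (d i : K) * (c i : K) = 1 := fun i => by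
    rw [← Units.val_mul, mul_comm, h i, Units.val_one]
  refine hom_ext Q (fun i => ?_) (fun i => ?_)
  · simp [scaleHom_z, smul_smul, hk i]
  · have h2 : (d i : K)⁻¹ * (c i : K)⁻¹ = 1 := by rw [← mul_inv, hk i, inv_one]
    simp [scaleHom_zInv, smul_smul, h2]

/-- The `K`-algebra automorphism with `z_i ↦ c_i z_i`. -/
noncomputable def scale (c : Fin n → Kˣ) : QuantumTorus Q ≃ₐ[K] QuantumTorus Q :=
  AlgEquiv.ofAlgHom (scaleHom Q c) (scaleHom Q fun i => (c i)⁻¹)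
    (scaleHom_comp Q _ _ fun i => mul_inv_cancel (c i))
    (scaleHom_comp Q _ _ fun i => inv_mul_cancel (c i))

end QuantumTorus

/-! ### The ambiskew polynomial algebra over the quantum torus in `p` generators, `p` odd

The generators `z_1, …, z_p` are indexed by `Fin p`; the element `i : Fin p` stands for the
index `i + 1`. -/

namespace TorusExample

variable {K : Type*} [Field K] (p : ℕ) (hp : Odd p) (q : Kˣ)

/-- For `i > j`, the scalar `q_{ij}` is `q⁻¹` if `i` is even and `j` is odd (as indices running from
`1` to `p`), and `1` otherwise. -/
def Q : Fin p → Fin p → Kˣ := fun i j =>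
  if Even ((i : ℕ) + 1) ∧ Odd ((j : ℕ) + 1) then q⁻¹ else 1

/-- The coordinate ring `A` of the quantum torus. -/
abbrev A : Type _ := QuantumTorus (Q p q)

/-- The automorphism `α` of `A`: `z_i ↦ z_i` for `i` even and `z_i ↦ q⁻¹ z_i` for `i` odd (as
indices running from `1` to `p`). -/
noncomputable def alpha : A p q ≃ₐ[K] A p q :=
  QuantumTorus.scale (Q p q) fun i => if Odd ((i : ℕ) + 1) then q⁻¹ else 1

/-- The last generator `z_p`. -/
noncomputable def zp : A p q := QuantumTorus.z (Q p q) ⟨p - 1, Nat.sub_lt hp.pos Nat.one_pos⟩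

/-- The inverse of `z_p`. -/
noncomputable def zpInv : A p q := QuantumTorus.zInv (Q p q) ⟨p - 1, Nat.sub_lt hp.pos Nat.one_pos⟩

/-- The splitting element `u = q^{(p-1)/2} z_p⁻¹ + q z_p`. -/
noncomputable def u : A p q := ((q : K) ^ ((p - 1) / 2)) • zpInv p hp q + (q : K) • zp p hp q

/-- The central element `v = (1 - q)(q^{(p-1)/2} z_p⁻¹ - z_p)`. -/
noncomputable def v : A p q :=
  (1 - (q : K)) • (((q : K) ^ ((p - 1) / 2)) • zpInv p hp q - zp p hp q)

theorem v_eq : v p hp q = u p hp q - alpha p q (u p hp q) := by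
  have h1 : p - 1 + 1 = p := Nat.sub_add_cancel hp.pos
  have hz : alpha p q (zp p hp q) = (q : K)⁻¹ • zp p hp q := by
    refine (QuantumTorus.scaleHom_z (Q p q) _ _).trans ?_
    simp [h1, hp, zp]
  have hz' : alpha p q (zpInv p hp q) = (q : K) • zpInv p hp q := by
    refine (QuantumTorus.scaleHom_zInv (Q p q) _ _).trans ?_
    simp [h1, hp, zpInv]
  simp only [u, v, map_add, map_smul, hz, hz', smul_smul, mul_inv_cancel₀ q.ne_zero]
  module

/-- The algebra `R = R(A, α, v, 1)`. -/
abbrev R : Type _ := Ambiskew (alpha p q) (v p hp q) (1 : Kˣ)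

/-- The ideal `F_{m,ε} = π⁻¹(J((z_p - ε q^{(p+2m-3)/4})A))` of `R`, for `ε = ±1`.  Here `t` is a fixed
fourth root of `q`, so that `q^{k/4} = t^k`; the scalar is
`lam = -ε q^{(p-2m+1)/4}(q^m + 1)`; and `π : R → R/(z - lam)R = W(A, α, u + lam)` is the canonical
epimorphism. -/
noncomputable def F (t : Kˣ) (m : ℕ) (ε : ℤˣ) : TwoSidedIdeal (R p hp q) :=
  let lam : K := -(((ε : ℤ) : K) * ((t ^ ((p : ℤ) - 2 * m + 1) : Kˣ) : K) * ((q : K) ^ m + 1))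
  let mu : K := ((ε : ℤ) : K) * ((t ^ ((p : ℤ) + 2 * m - 3) : Kˣ) : K)
  TwoSidedIdeal.comap (Ambiskew.toGWA (alpha p q) (u p hp q) (v p hp q) (v_eq p hp q) lam)
    (GWA.J (alpha p q) (u p hp q + algebraMap K (A p q) lam) m
      (TwoSidedIdeal.span {zp p hp q - algebraMap K (A p q) mu}))

end TorusExample

/-! Write p = 2r + 1, let w be the Casimir element (called z in the statement), write z for z_p, and
put ρ_ℓ = q^(-ℓ) μ, where μ is the value of z_p attached to F_{m,ε}. The choice of μ and of the
scalar λ says exactly that q^r = q ρ_0 ρ_m and λ = -q(ρ_0 + ρ_m). Hence u + λ = q z⁻¹ (z - ρ_0)(z -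
ρ_m), and α^ℓ(z) takes the value ρ_ℓ at z = μ. The weights of u + λ along this orbit vanish at ℓ = 0
and ℓ = m and nowhere between.

Therefore y can act as the upper shift and x as a weighted lower shift on m copies of the quantum
torus T of rank 2r obtained from A by setting z = μ. This is a surjection from R to the m × m
matrices over the domain T (`matrixHom_surjective`), and its kernel is F_{m,ε} (`mem_jIdeal_iff`).
Primeness follows, and so does the rank: diagonal matrix units give m independent right ideals, and
a dimension count over growing boxes of monomials excludes more (`rightGoldieRank_matrix`).

Kernels are compared without a basis theorem for R. Every element of R is a sum of terms f(w, z) o^a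
e^b y^n, with y^n read as x^(-n) for negative n (`normalForm_surjective`). Multiplication by the
units z, o_j, e_k on the two sides scales these terms by characters that separate the indices,
because q is not a root of unity. So a vanishing sum has vanishing terms in every image of R
(`coefHom_mul_yPow_eq_zero`), and inclusions of kernels reduce to annihilators of powers of x and y
among the coefficients. If w = λ and y^m = 0, these annihilators are at least as large as in the
matrix representation (`qRootProd_mem_annIdeal_y`, `qRootProd_mem_annIdeal_x`), so its kernel lies
in every ideal containing w - λ and y^m.

For the height, R maps to a quantum torus of rank 2r + 2 with w sent to an indeterminate or to λ.
The first map is injective, so 0 is prime. The second has as kernel the smallest ideal containing w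
- λ, which is thus prime. A nonzero prime contains some w - a (`exists_sub_mem_of_ne_bot`); below
F_{m,ε} necessarily a = λ. If such a prime is larger than the second kernel it contains a power of
y, then y^m itself by `pow_y_eq_zero_of_pow_y_eq_zero`, and so all of F_{m,ε}. The primes contained
in F_{m,ε} are thus exactly the members of a chain of length two. Finally, the two ideals have
different Casimir values unless 2 = 0. -/

open Polynomial
open scoped LaurentPolynomial

/-! ### Separation of joint eigenvectors -/

section Separation

variable {K ι Γ V : Type*} [Field K] [AddCommGroup V] [Module K V]

/-- The diagonal operator on finitely supported families with scalars `d i`. -/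
noncomputable def diagScale (V : Type*) [AddCommGroup V] [Module K V] (d : ι → K) :
    (ι →₀ V) →ₗ[K] (ι →₀ V) :=
  Finsupp.mapRange.linearMap LinearMap.id ∘ₗ Finsupp.lsum K fun i => d i • Finsupp.lsingle i

@[simp]
theorem diagScale_single (d : ι → K) (i : ι) (v : V) :
    diagScale V d (Finsupp.single i v) = Finsupp.single i (d i • v) := by
  simp [diagScale]

@[simp]
theorem diagScale_apply (d : ι → K) (f : ι →₀ V) (i : ι) : diagScale V d f i = d i • f i := by
  classical
  induction f using Finsupp.induction_linear with
  | zero => simp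
  | add f g hf hg => simp [hf, hg]
  | single j v =>
    by_cases h : j = i
    · subst h; simp
    · simp [h]

/-- A submodule of families stable under diagonal operators separating the index set contains the
components of each of its members. -/
theorem single_mem_of_diagScale_mem (Q : Submodule K (ι →₀ V)) (χ : Γ → ι → K)
    (hχ : ∀ i j, (∀ γ, χ γ i = χ γ j) → i = j)
    (hQ : ∀ γ, ∀ f ∈ Q, diagScale V (χ γ) f ∈ Q) {f : ι →₀ V} (hf : f ∈ Q) (i : ι) :
    Finsupp.single i (f i) ∈ Q := by
  classical
  -- An interpolation argument: a polynomial in the given diagonal operators kills any prescribed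
  -- finite set of indices but not i. It suffices to kill the other indices in the support of f.
  have key : ∀ t : Finset ι, i ∉ t → ∃ d : ι → K, d i ≠ 0 ∧ (∀ j ∈ t, d j = 0) ∧
      ∀ f ∈ Q, diagScale V d f ∈ Q := by
    intro t
    induction t using Finset.induction_on with
    | empty =>
      intro _
      refine ⟨fun _ => 1, one_ne_zero, by simp, fun f hf => ?_⟩
      have : diagScale V (fun _ : ι => (1 : K)) f = f := by ext j; simp
      rwa [this]
    | insert j t hj ih =>
      intro hi
      rw [Finset.mem_insert, not_or] at hi
      obtain ⟨d, hd, hd0, hdQ⟩ := ih hi.2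
      have : ∃ γ, χ γ i ≠ χ γ j := by
        by_contra! h
        exact hi.1 (hχ i j h)
      obtain ⟨γ, hγ⟩ := this
      -- The operator of γ minus its eigenvalue at j kills the index j and stays nonzero at i.
      refine ⟨fun k => (χ γ k - χ γ j) * d k, mul_ne_zero (sub_ne_zero.2 hγ) hd, ?_, ?_⟩
      · intro k hk
        rcases Finset.mem_insert.1 hk with rfl | hk
        · simp
        · simp [hd0 k hk]
      · intro f hf
        have h1 := hdQ f hf
        have h2 := Q.sub_mem (hQ γ _ h1) (Q.smul_mem (χ γ j) h1)
        convert h2 using 1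
        ext k
        simp [sub_mul, sub_smul, mul_smul]
  obtain ⟨d, hd, hd0, hdQ⟩ := key (f.support.erase i) (by simp)
  have h := Q.smul_mem (d i)⁻¹ (hdQ f hf)
  convert h using 1
  ext j
  by_cases hj : i = j
  · subst hj; simp [smul_smul, inv_mul_cancel₀ hd]
  · rw [Finsupp.single_eq_of_ne (Ne.symm hj)]
    by_cases hs : f j = 0
    · simp [hs]
    · simp [hd0 j (Finset.mem_erase.2 ⟨Ne.symm hj, Finsupp.mem_support_iff.2 hs⟩)]

end Separation

/-! ### Commutation up to powers of `q` -/

/-- `s t = q ^ n t s`. -/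
def QComm {K : Type*} [Field K] (q : Kˣ) {B : Type*} [Ring B] [Algebra K B] (s t : B) (n : ℤ) :
    Prop :=
  s * t = ((q ^ n : Kˣ) : K) • (t * s)

namespace QComm

variable {K : Type*} [Field K] {q : Kˣ} {B : Type*} [Ring B] [Algebra K B] {s s' t t' : B}
  {n n' : ℤ}

theorem zero_iff : QComm q s t 0 ↔ Commute s t := by
  simp [QComm, Commute, SemiconjBy]

theorem of_commute (h : Commute s t) : QComm q s t 0 := zero_iff.2 h

theorem mul_right (h : QComm q s t n) (h' : QComm q s t' n') : QComm q s (t * t') (n + n') := by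
  unfold QComm at *
  rw [← mul_assoc, h, smul_mul_assoc, mul_assoc, h', mul_smul_comm, smul_smul, zpow_add,
    Units.val_mul, mul_assoc]

theorem symm (h : QComm q s t n) : QComm q t s (-n) := by
  unfold QComm at *
  rw [h, smul_smul, ← Units.val_mul, ← zpow_add]
  simp

theorem inv_right {u : Bˣ} (h : QComm q s u n) : QComm q s ↑u⁻¹ (-n) := by
  have h' := h.symm
  unfold QComm at *
  have := congrArg (fun a => (↑u⁻¹ : B) * a * ↑u⁻¹) h'
  simpa [mul_assoc] using this

theorem inv_left {u : Bˣ} (h : QComm q (u : B) t n) : QComm q ↑u⁻¹ t (-n) := by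
  simpa using h.symm.inv_right.symm

theorem one_right : QComm q s 1 0 := of_commute (Commute.one_right s)

theorem pow_right (h : QComm q s t n) (k : ℕ) : QComm q s (t ^ k) (n * k) := by
  induction k with
  | zero => simpa using one_right
  | succ k ih =>
    rw [pow_succ]
    convert ih.mul_right h using 1
    push_cast; ring

theorem zpow_right {u : Bˣ} (h : QComm q s u n) (k : ℤ) : QComm q s ↑(u ^ k) (n * k) := by
  obtain ⟨k, rfl | rfl⟩ := k.eq_nat_or_neg
  · simpa using h.pow_right k
  · rw [zpow_neg]
    convert QComm.inv_right (u := u ^ (k : ℤ)) (n := n * k) ?_ using 1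
    · ring
    · simpa using h.pow_right k

theorem map {B' : Type*} [Ring B'] [Algebra K B'] (h : QComm q s t n) (f : B →ₐ[K] B') :
    QComm q (f s) (f t) n := by
  unfold QComm at *
  rw [← map_mul, h, map_smul, map_mul]

theorem congr (h : QComm q s t n) (hn : n = n') : QComm q s t n' := hn ▸ h

end QComm

/-! ### Systems of generators -/

/-- Elements of an algebra satisfying the relations between the Casimir element `w`, the generators
`x`, `y`, `z = z_p`, `o j = z_{2j+1}` and `e k = z_{2k+2}` of the ambiskew algebra over the quantum
torus. -/
structure AmbiskewSystem {K : Type*} [Field K] (q : Kˣ) (c : K) (r : ℕ) (B : Type*) [Ring B]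
    [Algebra K B] where
  x : B
  y : B
  w : B
  z : Bˣ
  o : Fin r → Bˣ
  e : Fin r → Bˣ
  x_y : x * y = w + (c • (↑z⁻¹ : B) + (q : K) • (z : B))
  y_x : y * x = w + ((c * q) • (↑z⁻¹ : B) + (z : B))
  w_x : Commute w x
  w_y : Commute w y
  w_z : Commute w z
  w_o : ∀ j, Commute w (o j)
  w_e : ∀ j, Commute w (e j)
  z_o : ∀ j, Commute (z : B) (o j)
  z_e : ∀ j, Commute (z : B) (e j)
  o_o : ∀ i j, Commute (o i) (o j)
  e_e : ∀ i j, Commute (e i) (e j)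
  e_o : ∀ i j, QComm q (e i : B) (o j : B) (if j ≤ i then -1 else 0)
  y_z : QComm q y (z : B) (-1)
  y_o : ∀ j, QComm q y (o j : B) (-1)
  y_e : ∀ j, Commute y (e j)
  x_z : QComm q x (z : B) 1
  x_o : ∀ j, QComm q x (o j : B) 1
  x_e : ∀ j, Commute x (e j)

namespace AmbiskewSystem

variable {K : Type*} [Field K] {q : Kˣ} {c : K} {r : ℕ} {B : Type*} [Ring B] [Algebra K B]
  (S : AmbiskewSystem q c r B)

/-- The image of a system under a homomorphism. -/
def map {B' : Type*} [Ring B'] [Algebra K B'] (f : B →ₐ[K] B') : AmbiskewSystem q c r B' where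
  x := f S.x
  y := f S.y
  w := f S.w
  z := Units.map (f : B →* B') S.z
  o j := Units.map (f : B →* B') (S.o j)
  e j := Units.map (f : B →* B') (S.e j)
  x_y := by
    rw [← map_mul, S.x_y, ← map_inv]
    simp
  y_x := by
    rw [← map_mul, S.y_x, ← map_inv]
    simp
  w_x := S.w_x.map f
  w_y := S.w_y.map f
  w_z := S.w_z.map f
  w_o j := (S.w_o j).map f
  w_e j := (S.w_e j).map f
  z_o j := (S.z_o j).map f
  z_e j := (S.z_e j).map f
  o_o i j := (S.o_o i j).map (Units.map (f : B →* B'))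
  e_e i j := (S.e_e i j).map (Units.map (f : B →* B'))
  e_o i j := (S.e_o i j).map f
  y_z := S.y_z.map f
  y_o j := (S.y_o j).map f
  y_e j := (S.y_e j).map f
  x_z := S.x_z.map f
  x_o j := (S.x_o j).map f
  x_e j := (S.x_e j).map f

end AmbiskewSystem

/-! ### Monomials in commuting units -/

section UnitMonomial

variable {M : Type*} [Group M] {r : ℕ}

theorem pairwise_commute_zpowersHom {g : Fin r → M} (hg : ∀ i j, Commute (g i) (g j)) :
    Pairwise fun i j => ∀ x y : Multiplicative ℤ,
      Commute (zpowersHom M (g i) x) (zpowersHom M (g j) y) := fun i j _ x y => by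
  simpa [zpowersHom_apply] using (hg i j).zpow_zpow x.toAdd y.toAdd

/-- The product of the powers `g i ^ a i` of pairwise commuting elements of a group. -/
noncomputable def zpowProd (g : Fin r → M) (hg : ∀ i j, Commute (g i) (g j)) (a : Fin r → ℤ) : M :=
  MonoidHom.noncommPiCoprod (fun i => zpowersHom M (g i))
    (pairwise_commute_zpowersHom hg)
    (fun i => Multiplicative.ofAdd (a i))

variable (g : Fin r → M) (hg : ∀ i j, Commute (g i) (g j))

theorem zpowProd_add (a b : Fin r → ℤ) :
    zpowProd g hg (a + b) = zpowProd g hg a * zpowProd g hg b := by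
  unfold zpowProd
  rw [← map_mul]
  rfl

theorem zpowProd_zero : zpowProd g hg 0 = 1 := by
  have := zpowProd_add g hg 0 0
  simpa using this

theorem zpowProd_neg (a : Fin r → ℤ) : zpowProd g hg (-a) = (zpowProd g hg a)⁻¹ := by
  rw [eq_inv_iff_mul_eq_one, ← zpowProd_add, neg_add_cancel, zpowProd_zero]

theorem zpowProd_single (i : Fin r) (n : ℤ) : zpowProd g hg (Pi.single i n) = g i ^ n := by
  unfold zpowProd
  have : (fun j => Multiplicative.ofAdd ((Pi.single i n : Fin r → ℤ) j)) =
      Pi.mulSingle i (Multiplicative.ofAdd n) := by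
    funext j
    by_cases h : j = i
    · subst h; simp
    · simp [h]
  rw [this, MonoidHom.noncommPiCoprod_mulSingle]
  simp [zpowersHom_apply]

theorem pi_int_induction {P : (Fin r → ℤ) → Prop} (h0 : P 0)
    (hadd : ∀ a b, P a → P b → P (a + b)) (hneg : ∀ a, P a → P (-a))
    (hs : ∀ i, P (Pi.single i 1)) (a : Fin r → ℤ) : P a := by
  let H : AddSubgroup (Fin r → ℤ) :=
    { carrier := {a | P a}, add_mem' := fun ha hb => hadd _ _ ha hb, zero_mem' := h0,
      neg_mem' := fun ha => hneg _ ha }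
  have : a ∈ H := by
    rw [← Finset.univ_sum_single a]
    refine H.sum_mem fun i _ => ?_
    have h1 : (Pi.single i (a i) : Fin r → ℤ) = a i • Pi.single i 1 := by
      rw [← Pi.single_smul]; simp
    rw [h1]
    exact H.zsmul_mem (hs i) _
  exact this

end UnitMonomial

theorem QComm.zpowProd_right {K : Type*} [Field K] {q : Kˣ} {B : Type*} [Ring B] [Algebra K B]
    {r : ℕ} {g : Fin r → Bˣ} (hg : ∀ i j, Commute (g i) (g j)) {s : B} {n : Fin r → ℤ}
    (h : ∀ i, QComm q s (g i : B) (n i)) (a : Fin r → ℤ) :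
    QComm q s ((zpowProd g hg a : Bˣ) : B) (∑ i, n i * a i) := by
  induction a using pi_int_induction with
  | h0 => simpa [zpowProd_zero] using QComm.one_right
  | hadd a b ha hb =>
    rw [zpowProd_add, Units.val_mul]
    exact (ha.mul_right hb).congr (by simp [mul_add, Finset.sum_add_distrib])
  | hneg a ha =>
    rw [zpowProd_neg]
    exact ha.inv_right.congr (by simp)
  | hs i =>
    rw [zpowProd_single, zpow_one]
    refine (h i).congr ?_
    rw [Finset.sum_eq_single i] <;> simp +contextual

theorem units_zpow_injective {K : Type*} [Field K] {q : Kˣ} (hq : ∀ n : ℕ, 0 < n → q ^ n ≠ 1) :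
    Function.Injective fun n : ℤ => q ^ n := by
  rw [injective_zpow_iff_not_isOfFinOrder, isOfFinOrder_iff_pow_eq_one]
  rintro ⟨n, hn, h⟩
  exact hq n hn h

/-- The system is unitriangular. Conjugation by the e_k only sees partial sums of the exponents of
the o_j, and this recovers the exponents themselves; the companion with reversed order does the same
for the exponents of the e_k. -/
theorem eq_zero_of_sum_le_eq_zero {ι : Type*} [Fintype ι] [LinearOrder ι] (d : ι → ℤ)
    (h : ∀ k, ∑ j, (if j ≤ k then d j else 0) = 0) : d = 0 := by
  funext k
  induction k using WellFoundedLT.induction with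
  | ind k ih =>
    have := h k
    rwa [Finset.sum_eq_single k, if_pos le_rfl] at this
    · intro j _ hj
      split_ifs with hjk
      · exact ih j (lt_of_le_of_ne hjk hj)
      · rfl
    · simp

theorem eq_zero_of_sum_ge_eq_zero {ι : Type*} [Fintype ι] [LinearOrder ι] (d : ι → ℤ)
    (h : ∀ k, ∑ j, (if k ≤ j then d j else 0) = 0) : d = 0 := by
  funext k
  induction k using WellFoundedGT.induction with
  | ind k ih =>
    have := h k
    rwa [Finset.sum_eq_single k, if_pos le_rfl] at this
    · intro j _ hj
      split_ifs with hjk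
      · exact ih j (lt_of_le_of_ne hjk (Ne.symm hj))
      · rfl
    · simp

theorem commute_zpowProd {B : Type*} [Ring B] {r : ℕ} {g : Fin r → Bˣ}
    (hg : ∀ i j, Commute (g i) (g j)) {s : B} (h : ∀ i, Commute s (g i)) (a : Fin r → ℤ) :
    Commute s (zpowProd g hg a : Bˣ) := by
  induction a using pi_int_induction with
  | h0 => simp [zpowProd_zero]
  | hadd a b ha hb => rw [zpowProd_add, Units.val_mul]; exact ha.mul_right hb
  | hneg a ha => rw [zpowProd_neg]; exact ha.units_inv_right
  | hs i => rw [zpowProd_single, zpow_one]; exact h i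

namespace AmbiskewSystem

variable {K : Type*} [Field K] {q : Kˣ} {c : K} {r : ℕ} {B : Type*} [Ring B] [Algebra K B]
  (S : AmbiskewSystem q c r B)

/-! ### The commutative coefficients -/

/-- The evaluation of Laurent polynomials in `z` with coefficients polynomials in `w`. -/
noncomputable def coefHom : K[X][T;T⁻¹] →ₐ[K] B :=
  AddMonoidAlgebra.liftNCAlgHom (aeval S.w) ((Units.coeHom B).comp (zpowersHom Bˣ S.z))
    (fun g n => by
      have h : Commute S.w ((S.z ^ n.toAdd : Bˣ) : B) := by
        have := (QComm.zero_iff (q := q)).1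
          ((QComm.zpow_right (QComm.of_commute (q := q) S.w_z) n.toAdd).congr (zero_mul _))
        exact this
      simp only [MonoidHom.coe_comp, Function.comp_apply, zpowersHom_apply, Units.coeHom_apply]
      induction g using Polynomial.induction_on' with
      | add g g' hg hg' => rw [map_add]; exact hg.add_left hg'
      | monomial k a =>
        rw [aeval_monomial]
        exact (Algebra.commute_algebraMap_left a _).mul_left (h.pow_left k))

theorem coefHom_single (g : K[X]) (n : ℤ) :
    S.coefHom (LaurentPolynomial.C g * LaurentPolynomial.T n) =
      aeval S.w g * ((S.z ^ n : Bˣ) : B) := by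
  rw [← LaurentPolynomial.single_eq_C_mul_T, coefHom, AddMonoidAlgebra.coe_liftNCAlgHom,
    AddMonoidAlgebra.liftNC_single]
  rfl

@[simp]
theorem coefHom_C (g : K[X]) : S.coefHom (LaurentPolynomial.C g) = aeval S.w g := by
  simpa using S.coefHom_single g 0

@[simp]
theorem coefHom_T (n : ℤ) : S.coefHom (LaurentPolynomial.T n) = ((S.z ^ n : Bˣ) : B) := by
  simpa using S.coefHom_single 1 n

theorem map_coefHom {B' : Type*} [Ring B'] [Algebra K B'] (f : B →ₐ[K] B') (g : K[X][T;T⁻¹]) :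
    f (S.coefHom g) = (S.map f).coefHom g := by
  induction g using LaurentPolynomial.induction_on' with
  | add g g' hg hg' => simp only [map_add, hg, hg']
  | C_mul_T n a =>
    rw [coefHom_single, coefHom_single, map_mul, ← aeval_algHom_apply]
    have : ((S.map f).z ^ n) = Units.map (f : B →* B') (S.z ^ n) := by
      rw [map_zpow]; rfl
    rw [this]
    rfl

/-- The twist `z ↦ q ^ k z` of the coefficients. -/
noncomputable def twist (q : Kˣ) (k : ℤ) : K[X][T;T⁻¹] →ₗ[K] K[X][T;T⁻¹] :=
  (AddMonoidAlgebra.coeffLinearEquiv K).symm.toLinearMap ∘ₗ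
    diagScale K[X] (fun i => ((q ^ (k * i) : Kˣ) : K)) ∘ₗ
      (AddMonoidAlgebra.coeffLinearEquiv K).toLinearMap

theorem twist_single (k n : ℤ) (g : K[X]) :
    twist q k (LaurentPolynomial.C g * LaurentPolynomial.T n) =
      ((q ^ (k * n) : Kˣ) : K) • (LaurentPolynomial.C g * LaurentPolynomial.T n) := by
  rw [← LaurentPolynomial.single_eq_C_mul_T]
  change AddMonoidAlgebra.ofCoeff (diagScale K[X] _ (Finsupp.single n g)) = _
  rw [diagScale_single, AddMonoidAlgebra.smul_single]
  rfl

theorem mul_coefHom {s : B} {k : ℤ} (hw : Commute s S.w) (hz : QComm q s (S.z : B) k)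
    (g : K[X][T;T⁻¹]) : s * S.coefHom g = S.coefHom (twist q k g) * s := by
  induction g using LaurentPolynomial.induction_on' with
  | add g g' hg hg' => simp only [map_add, mul_add, add_mul, hg, hg']
  | C_mul_T n a =>
    rw [twist_single, map_smul, coefHom_single]
    have h1 : Commute s (aeval S.w a) := by
      induction a using Polynomial.induction_on' with
      | add g g' hg hg' => rw [map_add]; exact hg.add_right hg'
      | monomial k a =>
        rw [aeval_monomial]
        exact (Algebra.commute_algebraMap_right a _).mul_right (hw.pow_right k)
    have h2 := (QComm.of_commute (q := q) h1).mul_right (hz.zpow_right n)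
    rw [zero_add] at h2
    rw [h2, smul_mul_assoc]

theorem twist_zero (g : K[X][T;T⁻¹]) : twist q 0 g = g := by
  induction g using LaurentPolynomial.induction_on' with
  | add g g' hg hg' => simp only [map_add, hg, hg']
  | C_mul_T n a => rw [twist_single]; simp

theorem commute_coefHom {s : B} (hw : Commute s S.w) (hz : Commute s (S.z : B))
    (g : K[X][T;T⁻¹]) : Commute s (S.coefHom g) := by
  have := S.mul_coefHom (k := 0) hw (QComm.of_commute hz) g
  rwa [twist_zero] at this

/-! ### Monomials -/

/-- The monomial `o ^ a e ^ b`. -/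
noncomputable def mono (a b : Fin r → ℤ) : Bˣ :=
  zpowProd S.o S.o_o a * zpowProd S.e S.e_e b

/-- The power `y ^ n` for `n ≥ 0` and `x ^ (-n)` for `n ≤ 0`. -/
def yPow : ℤ → B
  | Int.ofNat n => S.y ^ n
  | Int.negSucc n => S.x ^ (n + 1)

@[simp] theorem yPow_natCast (n : ℕ) : S.yPow n = S.y ^ n := rfl

@[simp] theorem yPow_zero : S.yPow 0 = 1 := by
  simpa using S.yPow_natCast 0

theorem yPow_neg_natCast (n : ℕ) : S.yPow (-n) = S.x ^ n := by
  cases n with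
  | zero => simp
  | succ n => rfl

/-- The Laurent polynomial with value `x y`. -/
noncomputable def xyCoef (q : Kˣ) (c : K) : K[X][T;T⁻¹] :=
  LaurentPolynomial.C X + (c • LaurentPolynomial.T (-1) + (q : K) • LaurentPolynomial.T 1)

/-- The Laurent polynomial with value `y x`. -/
noncomputable def yxCoef (q : Kˣ) (c : K) : K[X][T;T⁻¹] :=
  LaurentPolynomial.C X + ((c * q) • LaurentPolynomial.T (-1) + LaurentPolynomial.T 1)

theorem coefHom_xyCoef : S.coefHom (xyCoef q c) = S.x * S.y := by
  simp [xyCoef, S.x_y, map_add]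

theorem coefHom_yxCoef : S.coefHom (yxCoef q c) = S.y * S.x := by
  simp [yxCoef, S.y_x, map_add]

/-- Only negative n needs an argument: there y meets a power of x, and the factor y x is itself a
coefficient. -/
theorem y_mul_yPow (n : ℤ) : ∃ g, S.y * S.yPow n = S.coefHom g * S.yPow (n + 1) := by
  obtain ⟨n, rfl | rfl⟩ := n.eq_nat_or_neg
  · exact ⟨1, by rw [map_one, one_mul, ← Nat.cast_succ, yPow_natCast, yPow_natCast, pow_succ']⟩
  · cases n with
    | zero => exact ⟨1, by simpa using (S.yPow_natCast 1).symm⟩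
    | succ n =>
      refine ⟨yxCoef q c, ?_⟩
      rw [coefHom_yxCoef, yPow_neg_natCast, pow_succ', show -((n + 1 : ℕ) : ℤ) + 1 = -(n : ℤ) by
        push_cast; ring, yPow_neg_natCast, mul_assoc]

theorem x_mul_yPow (n : ℤ) : ∃ g, S.x * S.yPow n = S.coefHom g * S.yPow (n - 1) := by
  obtain ⟨n, rfl | rfl⟩ := n.eq_nat_or_neg
  · cases n with
    | zero =>
      refine ⟨1, ?_⟩
      have := S.yPow_neg_natCast 1
      simpa using this.symm
    | succ n =>
      refine ⟨xyCoef q c, ?_⟩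
      rw [coefHom_xyCoef, yPow_natCast, pow_succ', show ((n + 1 : ℕ) : ℤ) - 1 = (n : ℤ) by
        push_cast; ring, yPow_natCast, mul_assoc]
  · refine ⟨1, ?_⟩
    rw [yPow_neg_natCast, show -(n : ℤ) - 1 = -((n + 1 : ℕ) : ℤ) by push_cast; ring,
      yPow_neg_natCast, pow_succ', map_one, one_mul]

/-- The sum of the `f (a, b, n) o ^ a e ^ b y ^ n`. -/
noncomputable def normalForm :
    ((Fin r → ℤ) × (Fin r → ℤ) × ℤ →₀ K[X][T;T⁻¹]) →ₗ[K] B :=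
  Finsupp.lsum K fun i =>
    LinearMap.mulRight K ((S.mono i.1 i.2.1 : B) * S.yPow i.2.2) ∘ₗ S.coefHom.toLinearMap

@[simp]
theorem normalForm_single (i) (g : K[X][T;T⁻¹]) : S.normalForm (Finsupp.single i g) =
    S.coefHom g * ((S.mono i.1 i.2.1 : B) * S.yPow i.2.2) := by
  simp [normalForm, mul_assoc]

theorem map_yPow {B' : Type*} [Ring B'] [Algebra K B'] (f : B →ₐ[K] B') (n : ℤ) :
    f (S.yPow n) = (S.map f).yPow n := by
  cases n <;> simp [yPow] <;> rfl

theorem map_zpowProd {M M' : Type*} [Group M] [Group M'] (f : M →* M') {g : Fin r → M}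
    (hg : ∀ i j, Commute (g i) (g j)) (a : Fin r → ℤ) :
    f (zpowProd g hg a) = zpowProd (fun i => f (g i)) (fun i j => (hg i j).map f) a := by
  induction a using pi_int_induction with
  | h0 => simp [zpowProd_zero]
  | hadd a b ha hb => simp only [zpowProd_add, map_mul, ha, hb]
  | hneg a ha => simp only [zpowProd_neg, map_inv, ha]
  | hs i => simp only [zpowProd_single, map_zpow]

theorem map_mono {B' : Type*} [Ring B'] [Algebra K B'] (f : B →ₐ[K] B') (a b : Fin r → ℤ) :
    f (S.mono a b : B) = ((S.map f).mono a b : B') := by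
  have : Units.map (f : B →* B') (S.mono a b) = (S.map f).mono a b := by
    unfold mono
    rw [map_mul, map_zpowProd, map_zpowProd]
    rfl
  rw [← this]
  rfl

theorem map_normalForm {B' : Type*} [Ring B'] [Algebra K B'] (f : B →ₐ[K] B') (g) :
    f (S.normalForm g) = (S.map f).normalForm g := by
  induction g using Finsupp.induction_linear with
  | zero => simp
  | add g g' hg hg' => simp only [map_add, hg, hg']
  | single i g =>
    rw [normalForm_single, normalForm_single, map_mul, map_mul, map_coefHom, map_mono, map_yPow]

theorem commute_coefHom_mono (g : K[X][T;T⁻¹]) (a b : Fin r → ℤ) :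
    Commute (S.coefHom g) (S.mono a b : B) := by
  refine (S.commute_coefHom (Commute.symm ?_) (Commute.symm ?_) g).symm
  · rw [mono, Units.val_mul]
    exact (commute_zpowProd _ S.w_o a).mul_right (commute_zpowProd _ S.w_e b)
  · rw [mono, Units.val_mul]
    exact (commute_zpowProd _ S.z_o a).mul_right (commute_zpowProd _ S.z_e b)

/-- A set of elements acting on the left on the range of `normalForm` by monomial operators. -/
theorem mul_normalForm_mem {s : B} (hs : ∀ (g : K[X][T;T⁻¹]) a b n, ∃ g' a' b' n',
    s * (S.coefHom g * ((S.mono a b : B) * S.yPow n)) =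
      S.coefHom g' * ((S.mono a' b' : B) * S.yPow n'))
    {t : B} (ht : t ∈ LinearMap.range S.normalForm) : s * t ∈ LinearMap.range S.normalForm := by
  obtain ⟨f, rfl⟩ := ht
  induction f using Finsupp.induction_linear with
  | zero => simp
  | add f f' hf hf' => rw [map_add, mul_add]; exact add_mem hf hf'
  | single i g =>
    obtain ⟨g', a', b', n', h⟩ := hs g i.1 i.2.1 i.2.2
    rw [normalForm_single, h]
    exact ⟨Finsupp.single (a', b', n') g', by simp⟩

theorem o_mul_mono (j : Fin r) (a b : Fin r → ℤ) :
    S.o j * S.mono a b = S.mono (Pi.single j 1 + a) b := by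
  rw [mono, mono, zpowProd_add, zpowProd_single, zpow_one, mul_assoc]

theorem o_inv_mul_mono (j : Fin r) (a b : Fin r → ℤ) :
    (S.o j)⁻¹ * S.mono a b = S.mono (-Pi.single j 1 + a) b := by
  rw [mono, mono, zpowProd_add, zpowProd_neg, zpowProd_single, zpow_one, mul_assoc]

theorem qComm_e_o (k : Fin r) (a : Fin r → ℤ) :
    QComm q (S.e k : B) (zpowProd S.o S.o_o a : Bˣ) (∑ j, (if j ≤ k then -1 else 0) * a j) :=
  QComm.zpowProd_right _ (fun j => S.e_o k j) a

theorem qComm_o_e (j : Fin r) (b : Fin r → ℤ) :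
    QComm q (S.o j : B) (zpowProd S.e S.e_e b : Bˣ) (∑ k, (if j ≤ k then 1 else 0) * b k) :=
  QComm.zpowProd_right _ (fun k => (S.e_o k j).symm.congr (by split_ifs <;> rfl)) b

theorem mul_mono_of_qComm {s : Bˣ} {a b b' : Fin r → ℤ} {n : ℤ}
    (h : QComm q (s : B) (zpowProd S.o S.o_o a : Bˣ) n)
    (hs : s = zpowProd S.e S.e_e b') :
    (s : B) * S.mono a b = ((q ^ n : Kˣ) : K) • (S.mono a (b' + b) : B) := by
  rw [mono, mono, Units.val_mul, ← mul_assoc, h, smul_mul_assoc, mul_assoc, zpowProd_add,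
    Units.val_mul, Units.val_mul, hs]

/-- If the algebra is generated by the system, each of its elements has a normal form. -/
theorem normalForm_surjective (hgen : ∀ N : Subalgebra K B, S.x ∈ N → S.y ∈ N →
    (S.z : B) ∈ N → (↑S.z⁻¹ : B) ∈ N → (∀ j, (S.o j : B) ∈ N) → (∀ j, (↑(S.o j)⁻¹ : B) ∈ N) →
    (∀ j, (S.e j : B) ∈ N) → (∀ j, (↑(S.e j)⁻¹ : B) ∈ N) → N = ⊤) :
    Function.Surjective S.normalForm := by
  let E := LinearMap.range S.normalForm
  -- The elements whose left multiplication preserves the span E of normal forms form a subalgebra.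
  -- Once it contains the generators it is everything, and 1 ∈ E finishes the proof.
  let N : Subalgebra K B :=
    { carrier := {s | ∀ t ∈ E, s * t ∈ E}
      mul_mem' := fun ha hb t ht => by rw [mul_assoc]; exact ha _ (hb _ ht)
      add_mem' := fun ha hb t ht => by rw [add_mul]; exact E.add_mem (ha _ ht) (hb _ ht)
      algebraMap_mem' := fun k t ht => by
        rw [← Algebra.smul_def]; exact E.smul_mem _ ht }
  have hunit : ∀ (s : B), (∃ k, S.coefHom (LaurentPolynomial.T k) = s) → s ∈ N := by
    rintro _ ⟨k, rfl⟩ t ht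
    refine S.mul_normalForm_mem (fun g a b n => ⟨LaurentPolynomial.T k * g, a, b, n, ?_⟩) ht
    rw [map_mul, mul_assoc]
  -- This case serves the o_j, the e_j and their inverses, which commute with the coefficients and
  -- shift monomials up to a scalar.
  have hcomm : ∀ (s : B), Commute s S.w → Commute s S.z → (∀ a b, ∃ a' b' c',
      s * S.mono a b = (c' : K) • (S.mono a' b' : B)) → s ∈ N := by
    intro s hw hz hm t ht
    refine S.mul_normalForm_mem (fun g a b n => ?_) ht
    obtain ⟨a', b', c', h⟩ := hm a b
    refine ⟨c' • g, a', b', n, ?_⟩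
    rw [← mul_assoc, (S.commute_coefHom hw hz g).eq, mul_assoc, ← mul_assoc s, h, map_smul,
      smul_mul_assoc, smul_mul_assoc, mul_smul_comm]
  have hinv : ∀ {s : Bˣ} {t : B}, Commute (s : B) t → Commute (↑s⁻¹ : B) t := fun h =>
    h.units_inv_left
  -- This case serves x (k = 1) and y (k = -1), which twist the coefficients, scale the monomials
  -- and meet the power of y or x.
  have hxy : ∀ (s : B) (k : ℤ), Commute s S.w → QComm q s (S.z : B) k →
      (∀ j, QComm q s (S.o j : B) k) → (∀ j, Commute s (S.e j)) →
      (∀ n, ∃ g n', s * S.yPow n = S.coefHom g * S.yPow n') → s ∈ N := by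
    intro s k hw hz ho he hn t ht
    refine S.mul_normalForm_mem (fun g a b n => ?_) ht
    obtain ⟨g', n', h⟩ := hn n
    have h1 : QComm q s (S.mono a b : B) (∑ j, k * a j) := by
      rw [mono, Units.val_mul]
      refine ((QComm.zpowProd_right S.o_o ho a).mul_right
        (QComm.zpowProd_right S.e_e (fun j => QComm.of_commute (he j)) b)).congr ?_
      simp
    refine ⟨((q ^ (∑ j, k * a j) : Kˣ) : K) • (twist q k g * g'), a, b, n', ?_⟩
    rw [← mul_assoc, S.mul_coefHom hw hz, mul_assoc, ← mul_assoc s, h1, smul_mul_assoc,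
      mul_smul_comm, map_smul, smul_mul_assoc, mul_assoc, h, map_mul, mul_assoc,
      ← mul_assoc (S.mono a b : B), ← (S.commute_coefHom_mono g' a b).eq, mul_assoc]
  have hN : N = ⊤ := by
    refine hgen N ?_ ?_ ?_ ?_ ?_ ?_ ?_ ?_
    · exact hxy _ 1 S.w_x.symm S.x_z S.x_o S.x_e fun n => by
        obtain ⟨g, hg⟩ := S.x_mul_yPow n
        exact ⟨g, _, hg⟩
    · exact hxy _ (-1) S.w_y.symm S.y_z S.y_o S.y_e fun n => by
        obtain ⟨g, hg⟩ := S.y_mul_yPow n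
        exact ⟨g, _, hg⟩
    · exact hunit _ ⟨1, by simp⟩
    · exact hunit _ ⟨-1, by simp⟩
    · exact fun j => hcomm _ (S.w_o j).symm (S.z_o j).symm fun a b =>
        ⟨Pi.single j 1 + a, b, 1, by rw [one_smul, ← o_mul_mono, Units.val_mul]⟩
    · exact fun j => hcomm _ (hinv (S.w_o j).symm) (hinv (S.z_o j).symm) fun a b =>
        ⟨-Pi.single j 1 + a, b, 1, by rw [one_smul, ← o_inv_mul_mono, Units.val_mul]⟩
    · exact fun j => hcomm _ (S.w_e j).symm (S.z_e j).symm fun a b =>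
        ⟨_, _, _, S.mul_mono_of_qComm (b' := Pi.single j 1) (S.qComm_e_o j a)
          (by rw [zpowProd_single, zpow_one])⟩
    · exact fun j => hcomm _ (hinv (S.w_e j).symm) (hinv (S.z_e j).symm) fun a b =>
        ⟨_, _, _, S.mul_mono_of_qComm (b' := -Pi.single j 1) (S.qComm_e_o j a).inv_left
          (by rw [zpowProd_neg, zpowProd_single, zpow_one])⟩
  have h1 : (1 : B) ∈ E := ⟨Finsupp.single (0, 0, 0) 1, by
    simp [mono, zpowProd_zero]⟩
  intro s
  have hs : s ∈ N := hN ▸ Algebra.mem_top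
  have := hs 1 h1
  rwa [mul_one] at this

/-! ### Homogeneous components -/

theorem qComm_yPow {s : B} {k : ℤ} (hy : QComm q s S.y k) (hx : QComm q s S.x (-k)) (n : ℤ) :
    QComm q s (S.yPow n) (k * n) := by
  obtain ⟨n, rfl | rfl⟩ := n.eq_nat_or_neg
  · simpa using hy.pow_right n
  · rw [yPow_neg_natCast]
    exact (hx.pow_right n).congr (by ring)

theorem mul_normalForm_of_qComm {s : B} {χ : (Fin r → ℤ) × (Fin r → ℤ) × ℤ → ℤ}
    (hw : Commute s S.w) (hz : Commute s S.z)
    (hs : ∀ i, QComm q s ((S.mono i.1 i.2.1 : B) * S.yPow i.2.2) (χ i)) (f) :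
    s * S.normalForm f =
      S.normalForm (diagScale _ (fun i => ((q ^ χ i : Kˣ) : K)) f) * s := by
  induction f using Finsupp.induction_linear with
  | zero => simp
  | add f f' hf hf' => simp only [map_add, mul_add, add_mul, hf, hf']
  | single i g =>
    rw [diagScale_single, normalForm_single, normalForm_single, ← mul_assoc,
      (S.commute_coefHom hw hz g).eq, mul_assoc, hs i, map_smul, mul_smul_comm, smul_mul_assoc,
      smul_mul_assoc, mul_assoc (S.coefHom g)]

/-- The components of a vanishing normal form vanish. -/
theorem coefHom_mul_yPow_eq_zero (hq : ∀ n : ℕ, 0 < n → q ^ n ≠ 1)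
    {f : (Fin r → ℤ) × (Fin r → ℤ) × ℤ →₀ K[X][T;T⁻¹]} (hf : S.normalForm f = 0) (i) :
    S.coefHom (f i) * S.yPow i.2.2 = 0 := by
  -- The exponents of q picked up by o^a e^b y^n when moved past z, o_j and e_k respectively: z
  -- detects n, the o_j detect upper partial sums of b shifted by n, and the e_k detect lower
  -- partial sums of a with a sign.
  let χ : Option (Fin r ⊕ Fin r) → (Fin r → ℤ) × (Fin r → ℤ) × ℤ → ℤ
    | none => fun i => i.2.2
    | some (.inl j) => fun i => (∑ k, (if j ≤ k then 1 else 0) * i.2.1 k) + i.2.2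
    | some (.inr k) => fun i => ∑ j, (if j ≤ k then -1 else 0) * i.1 j
  let s : Option (Fin r ⊕ Fin r) → Bˣ
    | none => S.z
    | some (.inl j) => S.o j
    | some (.inr k) => S.e k
  have hsw : ∀ γ, Commute (s γ : B) S.w := by
    rintro (_ | j | k)
    · exact S.w_z.symm
    · exact (S.w_o j).symm
    · exact (S.w_e k).symm
  have hsz : ∀ γ, Commute (s γ : B) S.z := by
    rintro (_ | j | k)
    · exact Commute.refl _
    · exact (S.z_o j).symm
    · exact (S.z_e k).symm
  have hs : ∀ γ i, QComm q (s γ : B) ((S.mono i.1 i.2.1 : B) * S.yPow i.2.2) (χ γ i) := by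
    rintro (_ | j | k) i
    · have h1 : Commute (S.z : B) (S.mono i.1 i.2.1) := by
        have := S.commute_coefHom_mono (LaurentPolynomial.T 1) i.1 i.2.1
        simpa using this
      exact ((QComm.of_commute h1).mul_right
        (S.qComm_yPow (k := 1) (S.y_z.symm.congr (by simp)) S.x_z.symm _)).congr (by simp [χ])
    · rw [mono, Units.val_mul]
      have h1 : Commute (S.o j : B) (zpowProd S.o S.o_o i.1 : Bˣ) :=
        commute_zpowProd _ (fun k => (S.o_o j k).map (Units.coeHom B)) _
      exact (((QComm.of_commute h1).mul_right (S.qComm_o_e j _)).mul_right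
        (S.qComm_yPow (k := 1) ((S.y_o j).symm.congr (by simp)) (S.x_o j).symm _)).congr
        (by simp [χ])
    · rw [mono, Units.val_mul]
      have h1 : Commute (S.e k : B) (zpowProd S.e S.e_e i.2.1 : Bˣ) :=
        commute_zpowProd _ (fun j => (S.e_e k j).map (Units.coeHom B)) _
      exact (((S.qComm_e_o k _).mul_right (QComm.of_commute h1)).mul_right
        (S.qComm_yPow (k := 0) (QComm.of_commute (S.y_e k).symm)
          (QComm.of_commute (S.x_e k).symm) _)).congr (by simp [χ])
  have hχ : ∀ i i', (∀ γ, ((q ^ χ γ i : Kˣ) : K) = ((q ^ χ γ i' : Kˣ) : K)) → i = i' := by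
    intro i i' h
    have h' : ∀ γ, χ γ i = χ γ i' := fun γ => units_zpow_injective hq (Units.ext (h γ))
    obtain ⟨a, b, n⟩ := i
    obtain ⟨a', b', n'⟩ := i'
    have hn : n = n' := h' none
    subst hn
    have hb : b - b' = 0 := by
      refine eq_zero_of_sum_ge_eq_zero (b - b') fun j => ?_
      have := h' (some (.inl j))
      simp only [χ, add_left_inj, ite_mul, one_mul, zero_mul] at this
      have h2 := sub_eq_zero.2 this
      rw [← Finset.sum_sub_distrib] at h2
      refine Eq.trans (Finset.sum_congr rfl fun k _ => ?_) h2
      split_ifs <;> simp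
    have ha : a - a' = 0 := by
      refine eq_zero_of_sum_le_eq_zero (a - a') fun k => ?_
      have := h' (some (.inr k))
      simp only [χ, ite_mul, neg_mul, one_mul, zero_mul] at this
      have h2 := sub_eq_zero.2 this.symm
      rw [← Finset.sum_sub_distrib] at h2
      refine Eq.trans (Finset.sum_congr rfl fun j _ => ?_) h2
      split_ifs
      · simp; ring
      · simp
    rw [sub_eq_zero.1 ha, sub_eq_zero.1 hb]
  -- The kernel is stable under each diagonal operator: the normal form of the scaled family, times
  -- a unit, is that unit times the original one, which vanishes.
  have hmem := single_mem_of_diagScale_mem (LinearMap.ker S.normalForm)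
    (fun γ i => ((q ^ χ γ i : Kˣ) : K)) hχ (fun γ f hf => by
      rw [LinearMap.mem_ker] at hf ⊢
      have := S.mul_normalForm_of_qComm (hsw γ) (hsz γ) (hs γ) f
      rw [hf, mul_zero] at this
      exact (Units.mul_left_eq_zero (s γ)).1 this.symm) (LinearMap.mem_ker.2 hf) i
  rw [LinearMap.mem_ker, normalForm_single, ← mul_assoc, (S.commute_coefHom_mono _ _ _).eq,
    mul_assoc, Units.mul_right_eq_zero] at hmem
  exact hmem

end AmbiskewSystem

/-! ### Images of the system: comparison of kernels and elimination of powers of y. -/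

namespace AmbiskewSystem

variable {K : Type*} [Field K] {q : Kˣ} {c : K} {r : ℕ} {B : Type*} [Ring B] [Algebra K B]
  (S : AmbiskewSystem q c r B)

/-- The members of the system generate the algebra. -/
def Generates : Prop :=
  ∀ N : Subalgebra K B, S.x ∈ N → S.y ∈ N →
    (S.z : B) ∈ N → (↑S.z⁻¹ : B) ∈ N → (∀ j, (S.o j : B) ∈ N) → (∀ j, (↑(S.o j)⁻¹ : B) ∈ N) →
    (∀ j, (S.e j : B) ∈ N) → (∀ j, (↑(S.e j)⁻¹ : B) ∈ N) → N = ⊤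

variable {S}

theorem Generates.commute_w (h : S.Generates) (s : B) : Commute S.w s := by
  have : Subalgebra.centralizer K {S.w} = ⊤ := by
    refine h _ ?_ ?_ ?_ ?_ ?_ ?_ ?_ ?_ <;>
      simp only [Subalgebra.mem_centralizer_iff, Set.mem_singleton_iff, forall_eq]
    · exact S.w_x
    · exact S.w_y
    · exact S.w_z
    · exact S.w_z.units_inv_right
    · exact fun j => S.w_o j
    · exact fun j => (S.w_o j).units_inv_right
    · exact fun j => S.w_e j
    · exact fun j => (S.w_e j).units_inv_right
  have hs : s ∈ Subalgebra.centralizer K {S.w} := this ▸ Algebra.mem_top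
  exact (Subalgebra.mem_centralizer_iff K).1 hs _ rfl

theorem Generates.commute_aeval_w (h : S.Generates) (g : K[X]) (s : B) :
    Commute (aeval S.w g) s := by
  induction g using Polynomial.induction_on' with
  | add g g' hg hg' => rw [map_add]; exact hg.add_left hg'
  | monomial k a =>
    rw [aeval_monomial]
    exact (Algebra.commute_algebraMap_left a _).mul_left ((h.commute_w s).pow_left k)

variable (S)

theorem normalForm_eq_sum (f) :
    S.normalForm f = f.sum fun i g => S.coefHom g * ((S.mono i.1 i.2.1 : B) * S.yPow i.2.2) := by
  simp [normalForm, Finsupp.lsum_apply, Finsupp.sum, mul_assoc]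

theorem normalForm_eq_zero_of_components {f}
    (h : ∀ i : (Fin r → ℤ) × (Fin r → ℤ) × ℤ, S.coefHom (f i) * S.yPow i.2.2 = 0) :
    S.normalForm f = 0 := by
  rw [normalForm_eq_sum]
  refine Finset.sum_eq_zero fun i _ => ?_
  dsimp only
  rw [← mul_assoc, (S.commute_coefHom_mono _ _ _).eq, mul_assoc, h i, mul_zero]

theorem coefHom_eq_sum (f : K[X][T;T⁻¹]) :
    S.coefHom f = f.coeff.sum fun i g => aeval S.w g * ((S.z ^ i : Bˣ) : B) := by
  induction f using LaurentPolynomial.induction_on' with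
  | add f f' hf hf' =>
    rw [map_add, hf, hf', AddMonoidAlgebra.coeff_add, Finsupp.sum_add_index']
    · simp
    · intros; rw [map_add, add_mul]
  | C_mul_T n a =>
    rw [coefHom_single, ← LaurentPolynomial.single_eq_C_mul_T, AddMonoidAlgebra.coeff_single,
      Finsupp.sum_single_index]
    simp

theorem coefHom_eq_zero_of_coeff {f : K[X][T;T⁻¹]} (h : ∀ i, aeval S.w (f.coeff i) = 0) :
    S.coefHom f = 0 := by
  rw [coefHom_eq_sum]
  exact Finset.sum_eq_zero fun i _ => by dsimp only; rw [h i, zero_mul]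

/-- The powers of `z` are linearly independent over the polynomials in `w`. -/
def ZIndependent : Prop :=
  ∀ f : K[X][T;T⁻¹], S.coefHom f = 0 → ∀ i, aeval S.w (f.coeff i) = 0

/-- An element killed by a homomorphism to a domain in which the powers of `z` are independent is
killed by each homomorphism satisfying the same polynomial relations for `w`. -/
theorem eq_zero_of_map_eq_zero (hq : ∀ n : ℕ, 0 < n → q ^ n ≠ 1)
    (hS : Function.Surjective S.normalForm) {D B' : Type*} [Ring D] [Algebra K D]
    [NoZeroDivisors D] [Ring B'] [Algebra K B'] (φ : B →ₐ[K] D) (π : B →ₐ[K] B')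
    (hx : φ S.x ≠ 0) (hy : φ S.y ≠ 0) (hz : (S.map φ).ZIndependent)
    (hw : ∀ g : K[X], aeval (φ S.w) g = 0 → aeval (π S.w) g = 0) {s : B} (hs : φ s = 0) :
    π s = 0 := by
  obtain ⟨f, rfl⟩ := hS s
  rw [map_normalForm] at hs ⊢
  have : Nontrivial D := ⟨_, _, hx⟩
  refine normalForm_eq_zero_of_components _ fun i => ?_
  have h := coefHom_mul_yPow_eq_zero _ hq hs i
  have hyp : (S.map φ).yPow i.2.2 ≠ 0 := by
    rcases i.2.2 with n | n
    · exact pow_ne_zero n hy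
    · exact pow_ne_zero (n + 1) hx
  have h1 := hz _ ((mul_eq_zero.1 h).resolve_right hyp)
  rw [coefHom_eq_zero_of_coeff _ fun j => hw _ (h1 j), zero_mul]

/-! ### Powers of `y` annihilating coefficients -/

/-- Multiplying f(w, z) y^n = 0 by y on the left replaces z by q⁻¹ z in f and raises the exponent by
one. The Laurent polynomials killed by some power of y are thus stable under this twist, whose
eigenvalues separate the powers of z. The exponent may grow, which is why the conclusion only
asserts some N. -/
theorem exists_aeval_mul_pow_eq_zero (hq : ∀ n : ℕ, 0 < n → q ^ n ≠ 1) {f : K[X][T;T⁻¹]} {n : ℕ}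
    (hf : S.coefHom f * S.y ^ n = 0) (i : ℤ) :
    ∃ N, aeval S.w (f.coeff i) * S.y ^ N = 0 := by
  let Q : Submodule K (ℤ →₀ K[X]) :=
    { carrier := {g | ∃ N, S.coefHom (.ofCoeff g) * S.y ^ N = 0}
      zero_mem' := ⟨0, by
        change S.coefHom 0 * _ = 0
        simp⟩
      add_mem' := by
        rintro g g' ⟨N, hN⟩ ⟨N', hN'⟩
        refine ⟨N + N', ?_⟩
        change S.coefHom (AddMonoidAlgebra.ofCoeff g + AddMonoidAlgebra.ofCoeff g') * _ = 0
        rw [map_add, add_mul, pow_add, ← mul_assoc, hN, zero_mul, zero_add, ← pow_add, add_comm,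
          pow_add, ← mul_assoc, hN', zero_mul]
      smul_mem' := by
        rintro a g ⟨N, hN⟩
        refine ⟨N, ?_⟩
        change S.coefHom (a • AddMonoidAlgebra.ofCoeff g) * _ = 0
        rw [map_smul, smul_mul_assoc, hN, smul_zero] }
  obtain ⟨N, hN⟩ := single_mem_of_diagScale_mem (Γ := Unit) Q
    (fun _ i => ((q ^ (-1 * i) : Kˣ) : K))
    (fun i j h => by
      have := units_zpow_injective hq (Units.ext (h ()))
      simpa using this)
    (by
      rintro - g ⟨N, hN⟩
      refine ⟨N + 1, ?_⟩
      have h := S.mul_coefHom S.w_y.symm S.y_z (AddMonoidAlgebra.ofCoeff g)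
      rw [pow_succ', ← mul_assoc]
      change S.coefHom (twist q (-1) (AddMonoidAlgebra.ofCoeff g)) * S.y * _ = 0
      rw [← h, mul_assoc, hN, mul_zero])
    (show f.coeff ∈ Q from ⟨n, hf⟩) i
  refine ⟨N, ?_⟩
  change S.coefHom (AddMonoidAlgebra.single i (f.coeff i)) * _ = 0 at hN
  rw [LaurentPolynomial.single_eq_C_mul_T, mul_comm, map_mul, coefHom_T, coefHom_C, mul_assoc,
    Units.mul_right_eq_zero] at hN
  exact hN

theorem exists_pow_mul_pow (k : ℕ) : ∃ g, S.x ^ k * S.y ^ k = S.coefHom g := by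
  induction k with
  | zero => exact ⟨1, by simp⟩
  | succ k ih =>
    obtain ⟨g, hg⟩ := ih
    refine ⟨twist q 1 g * xyCoef q c, ?_⟩
    rw [map_mul, coefHom_xyCoef, ← mul_assoc, ← S.mul_coefHom S.w_x.symm S.x_z, ← hg, pow_succ',
      pow_succ]
    simp only [mul_assoc]

/-- An element killed by `π` but not by a homomorphism to a domain yields a polynomial in `w` killed
by a power of `y`. -/
theorem exists_aeval_mul_pow_of_map_ne_zero (hq : ∀ n : ℕ, 0 < n → q ^ n ≠ 1)
    (hS : Function.Surjective S.normalForm) {D B' : Type*} [Ring D] [Algebra K D]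
    [NoZeroDivisors D] [Ring B'] [Algebra K B'] (φ : B →ₐ[K] D) (π : B →ₐ[K] B')
    (hx : φ S.x ≠ 0) (hy : φ S.y ≠ 0) {s : B} (hs : φ s ≠ 0) (hπ : π s = 0) :
    ∃ (g : K[X]) (N : ℕ), aeval (φ S.w) g ≠ 0 ∧ aeval (π S.w) g * π S.y ^ N = 0 := by
  have : Nontrivial D := ⟨_, _, hx⟩
  have key : ∀ (f : K[X][T;T⁻¹]) (n : ℕ), (S.map φ).coefHom f ≠ 0 →
      (S.map π).coefHom f * (S.map π).y ^ n = 0 →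
      ∃ (g : K[X]) (N : ℕ), aeval (φ S.w) g ≠ 0 ∧ aeval (π S.w) g * π S.y ^ N = 0 := by
    intro f n h1 h2
    have : ∃ i, aeval (φ S.w) (f.coeff i) ≠ 0 := by
      by_contra! h
      exact h1 (coefHom_eq_zero_of_coeff _ h)
    obtain ⟨i, hi⟩ := this
    obtain ⟨N, hN⟩ := (S.map π).exists_aeval_mul_pow_eq_zero hq h2 i
    exact ⟨_, N, hi, hN⟩
  obtain ⟨f, rfl⟩ := hS s
  rw [map_normalForm] at hs hπ
  have : ∃ i, (S.map φ).coefHom (f i) ≠ 0 := by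
    by_contra! h
    exact hs (normalForm_eq_zero_of_components _ fun i => by rw [h i, zero_mul])
  obtain ⟨i, hi⟩ := this
  have hi' := coefHom_mul_yPow_eq_zero _ hq hπ i
  obtain ⟨n, hn | hn⟩ := i.2.2.eq_nat_or_neg
  · rw [hn, yPow_natCast] at hi'
    exact key _ n hi hi'
  -- For a power of x, multiplication by y^n on the right turns x^n y^n into a coefficient, which
  -- stays nonzero in the domain since the images of x and y do.
  · rw [hn, yPow_neg_natCast] at hi'
    obtain ⟨g, hg⟩ := S.exists_pow_mul_pow n
    refine key (f i * g) 0 ?_ ?_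
    · rw [map_mul, ← map_coefHom, ← map_coefHom, ← hg, map_mul, map_pow, map_pow, map_coefHom]
      exact mul_ne_zero hi (mul_ne_zero (pow_ne_zero _ hx) (pow_ne_zero _ hy))
    · rw [pow_zero, mul_one, map_mul, ← map_coefHom _ _ g, ← hg, map_mul, map_pow, map_pow,
        ← mul_assoc]
      exact mul_eq_zero_of_left hi' _

theorem coefHom_mul_pow_left {n : ℕ} (h : S.y ^ (n + 1) = 0) :
    S.coefHom (xyCoef q c) * S.y ^ n = 0 := by
  rw [coefHom_xyCoef, mul_assoc, ← pow_succ', h, mul_zero]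

theorem y_pow_mul_coefHom (n : ℕ) (g : K[X][T;T⁻¹]) :
    S.y ^ n * S.coefHom g = S.coefHom (twist q (-n) g) * S.y ^ n :=
  S.mul_coefHom (S.w_y.symm.pow_left n)
    ((S.y_z.symm.pow_right n).symm.congr (by ring)) g

theorem twist_yxCoef (n : ℕ) : twist q (-n) (yxCoef q c) =
    LaurentPolynomial.C X + ((c * (q : K) ^ (n + 1)) • LaurentPolynomial.T (-1) +
      ((q : K) ^ n)⁻¹ • LaurentPolynomial.T 1) := by
  have h0 := twist_single (q := q) (-n) 0 (X : K[X])
  have h1 := twist_single (q := q) (-n) (-1) (1 : K[X])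
  have h2 := twist_single (q := q) (-n) 1 (1 : K[X])
  simp only [map_one, one_mul, mul_zero, zpow_zero, LaurentPolynomial.T_zero, mul_one,
    Units.val_one, one_smul] at h0 h1 h2
  rw [yxCoef, map_add, map_add, map_smul, h0, h1, h2, smul_smul, mul_assoc]
  simp [pow_succ']

/-- If `y ^ (n + 1) = 0`, then some `w² - κ` annihilates `y ^ n`. -/
theorem exists_sq_sub_mul_pow_eq_zero (hq : ∀ n : ℕ, 0 < n → q ^ n ≠ 1) (n : ℕ) :
    ∃ κ : K, ∀ {B : Type*} [Ring B] [Algebra K B] (S : AmbiskewSystem q c r B),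
      S.y ^ (n + 1) = 0 → aeval S.w (X ^ 2 - Polynomial.C κ) * S.y ^ n = 0 := by
  have hq0 : (q : K) ≠ 0 := q.ne_zero
  have hd : (1 - (q : K) ^ (n + 1)) ≠ 0 := by
    intro h
    exact hq (n + 1) n.succ_pos (Units.ext (by simpa using (sub_eq_zero.1 h).symm))
  set Q : K := (q : K) ^ n with hQ
  have hQ0 : Q ≠ 0 := pow_ne_zero _ hq0
  rw [pow_succ, ← hQ] at hd
  -- With Q = q^n, both w + c z⁻¹ + q z and w + c Q q z⁻¹ + Q⁻¹ z annihilate y^n, because x y^(n+1)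
  -- = 0 and y^(n+1) x = 0. Subtracting and cancelling 1 - q^(n+1) gives z² = c Q, hence w = -(Q⁻¹ +
  -- q) z and w² = (Q⁻¹ + q)² c Q, which is this constant.
  refine ⟨(Q⁻¹ + q) * (1 + Q * q) * c, fun S h => ?_⟩
  have h1 := S.coefHom_mul_pow_left h
  have h2 : S.coefHom (twist q (-n) (yxCoef q c)) * S.y ^ n = 0 := by
    rw [← y_pow_mul_coefHom, coefHom_yxCoef, ← mul_assoc, ← pow_succ, h, zero_mul]
  rw [twist_yxCoef, pow_succ, ← hQ] at h2
  -- The elimination of z, as an explicit ideal membership in the commutative coefficient ring.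
  have key : ∃ A₁ A₂ : K[X][T;T⁻¹], LaurentPolynomial.C (X ^ 2 -
      Polynomial.C ((Q⁻¹ + q) * (1 + Q * q) * c)) =
      A₁ * xyCoef q c + A₂ * (LaurentPolynomial.C X + ((c * (Q * q)) • LaurentPolynomial.T (-1) +
      Q⁻¹ • LaurentPolynomial.T 1)) := by
    set t : K[X][T;T⁻¹] := LaurentPolynomial.T 1
    set t' : K[X][T;T⁻¹] := LaurentPolynomial.T (-1)
    have ht : t * t' = 1 := by rw [← LaurentPolynomial.T_add]; simp
    let a : K →+* K[X][T;T⁻¹] := algebraMap K _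
    have hC : ∀ k, LaurentPolynomial.C (Polynomial.C k) = a k := fun _ => rfl
    simp only [xyCoef, Algebra.smul_def, map_sub, map_pow, hC]
    change ∃ A₁ A₂, _ ^ 2 - a _ = A₁ * (_ + (a c * t' + a q * t)) +
      A₂ * (_ + (a _ * t' + a _ * t))
    set Z : K[X][T;T⁻¹] := LaurentPolynomial.C X
    have e1 : a Q⁻¹ * a Q = 1 := by rw [← map_mul, inv_mul_cancel₀ hQ0, map_one]
    have e2 : a (1 - Q * q)⁻¹ * (1 - a Q * a q) = 1 := by
      rw [← map_one a, ← map_mul a, ← map_sub a, ← map_mul a, inv_mul_cancel₀ hd]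
    -- `D` is the difference of the two generators divided by `1 - q ^ (n + 1)`.
    let D := a (1 - Q * q)⁻¹ *
      ((1 + a Q * a q) * a c * t' - (a Q * a q) * (a Q⁻¹ + a q) * t - (a Q * a q) *
        (a c * t' - a Q⁻¹ * t))
    refine ⟨Z - (a c * t' + a q * t) + D, -D, ?_⟩
    simp only [map_mul, map_add, map_one]
    have e3 : a (1 - Q * q)⁻¹ * ((a c * t' + a q * t) - (a c * a Q * a q * t' + a Q⁻¹ * t)) =
        a c * t' - a Q⁻¹ * t := by
      have : (a c * t' + a q * t) - (a c * a Q * a q * t' + a Q⁻¹ * t) =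
          (1 - a Q * a q) * (a c * t' - a Q⁻¹ * t) := by
        linear_combination (-(a q * t)) * e1
      rw [this, ← mul_assoc, e2, one_mul]
    simp only [D]
    linear_combination (-((1 + a Q * a q) * a c * t' - (a Q * a q) * (a Q⁻¹ + a q) * t -
      (a Q * a q) * (a c * t' - a Q⁻¹ * t))) * e3
      + ((a Q⁻¹ + a q) * (1 + a Q * a q) * a c) * ht - (a q * a c * t * t' + a q ^ 2 * t ^ 2) * e1
  obtain ⟨A₁, A₂, hA⟩ := key
  rw [← coefHom_C, hA, map_add S.coefHom, map_mul S.coefHom, map_mul S.coefHom,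
    add_mul (S.coefHom A₁ * _), mul_assoc, h1, mul_assoc, h2]
  simp

end AmbiskewSystem

/-! ### Polynomials with roots in geometric progression. -/

section Roots

variable {K : Type*} [Field K] (q : Kˣ) (μ : K)

/-- The root `q ^ (-ℓ) μ`. -/
def qRoot (ℓ : ℤ) : K := ((q ^ (-ℓ) : Kˣ) : K) * μ

/-- The product of the linear factors with roots `q ^ (-ℓ) μ`, `a ≤ ℓ < a + k`. -/
noncomputable def qRootProd (a : ℤ) (k : ℕ) : K[X] :=
  ∏ i ∈ Finset.range k, (X - C (qRoot q μ (a + i)))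

variable {q μ}

theorem qRoot_injective (hq : ∀ n : ℕ, 0 < n → q ^ n ≠ 1) (hμ : μ ≠ 0) :
    Function.Injective (qRoot q μ) := fun a b h => by
  have := units_zpow_injective hq (Units.ext (mul_right_cancel₀ hμ h))
  exact neg_injective this

theorem zpow_mul_qRoot (k ℓ : ℤ) : ((q ^ k : Kˣ) : K) * qRoot q μ (ℓ + k) = qRoot q μ ℓ := by
  rw [qRoot, ← mul_assoc, ← Units.val_mul, ← zpow_add, qRoot]
  congr 3
  ring

theorem X_sub_C_qRoot_comp (k ℓ : ℤ) : (X - C (qRoot q μ ℓ)).comp (C ((q ^ k : Kˣ) : K) * X) =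
    C ((q ^ k : Kˣ) : K) * (X - C (qRoot q μ (ℓ + k))) := by
  rw [mul_sub, ← C_mul, zpow_mul_qRoot]
  simp

theorem qRootProd_zero (a : ℤ) : qRootProd q μ a 0 = 1 := by simp [qRootProd]

theorem qRootProd_succ (a : ℤ) (k : ℕ) :
    qRootProd q μ a (k + 1) = qRootProd q μ a k * (X - C (qRoot q μ (a + k))) := by
  simp [qRootProd, Finset.prod_range_succ]

theorem qRootProd_succ' (a : ℤ) (k : ℕ) :
    qRootProd q μ a (k + 1) = (X - C (qRoot q μ a)) * qRootProd q μ (a + 1) k := by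
  rw [qRootProd, Finset.prod_range_succ', mul_comm]
  simp [qRootProd, add_assoc, add_comm (1 : ℤ)]

theorem qRootProd_comp (a : ℤ) (k : ℕ) : (qRootProd q μ a k).comp (C (q : K) * X) =
    C ((q : K) ^ k) * qRootProd q μ (a + 1) k := by
  have h := fun ℓ => X_sub_C_qRoot_comp (q := q) (μ := μ) 1 ℓ
  simp only [zpow_one] at h
  rw [qRootProd, prod_comp]
  simp_rw [h]
  rw [Finset.prod_mul_distrib, Finset.prod_const, Finset.card_range, ← C_pow, qRootProd]
  congr 1
  refine Finset.prod_congr rfl fun i _ => ?_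
  rw [add_right_comm]

/-- The roots are distinct because q is not a root of unity, so the linear factors are pairwise
coprime. -/
theorem qRootProd_dvd (hq : ∀ n : ℕ, 0 < n → q ^ n ≠ 1) (hμ : μ ≠ 0) {a : ℤ} {k : ℕ} {f : K[X]}
    (h : ∀ i < k, f.eval (qRoot q μ (a + i)) = 0) : qRootProd q μ a k ∣ f := by
  refine Finset.prod_dvd_of_coprime ?_ fun i hi => ?_
  · intro i _ j _ hij
    refine isCoprime_X_sub_C_of_isUnit_sub (IsUnit.mk0 _ (sub_ne_zero.2 fun h => hij ?_))
    simpa using qRoot_injective hq hμ h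
  · exact dvd_iff_isRoot.2 (h i (Finset.mem_range.1 hi))

/-- The difference of the two linear factors is a nonzero constant. This strips the superfluous
factor when an annihilator is computed in two ways. -/
theorem mem_of_mul_X_sub_C_mem {I : Ideal K[X]} {f : K[X]} {a b : K} (hab : a ≠ b)
    (ha : f * (X - C a) ∈ I) (hb : f * (X - C b) ∈ I) : f ∈ I := by
  have h := I.mul_mem_left (C (b - a)⁻¹) (I.sub_mem ha hb)
  have h1 : (C (b - a)⁻¹ : K[X]) * C (b - a) = 1 := by
    rw [← C_mul, inv_mul_cancel₀ (sub_ne_zero.2 hab.symm), C_1]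
  convert h using 1
  rw [C_sub] at h1
  linear_combination (-f) * h1

end Roots

theorem aeval_X_sub_C_mul_X_sub_C {K : Type*} [Field K] {B : Type*} [Ring B] [Algebra K B] (z : B)
    (a b : K) : aeval z ((X - C a) * (X - C b)) = z * z - (a + b) • z + (a * b) • (1 : B) := by
  have : (X - C a) * (X - C b) = X * X - (a + b) • X + (a * b) • (1 : K[X]) := by
    simp only [smul_eq_C_mul, C_add, C_mul]
    ring
  simp only [this, map_sub, map_add, map_mul, map_smul, aeval_X, map_one]

/-! ### Annihilators of the powers of x and y at a fixed Casimir value. -/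

namespace AmbiskewSystem

variable {K : Type*} [Field K] {q : Kˣ} {c : K} {r : ℕ} {B : Type*} [Ring B] [Algebra K B]
  (S : AmbiskewSystem q c r B)

/-- The polynomials whose value at `z` annihilates `s` from the left. -/
noncomputable def annIdeal (s : B) : Ideal K[X] where
  carrier := {f | aeval (S.z : B) f * s = 0}
  add_mem' := fun {f g} hf hg => by
    rw [Set.mem_ofPred_eq] at *
    rw [map_add, add_mul, hf, hg, add_zero]
  zero_mem' := by simp
  smul_mem' := fun f g hg => by
    rw [Set.mem_ofPred_eq] at *
    rw [smul_eq_mul, map_mul, mul_assoc, hg, mul_zero]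

theorem mem_annIdeal {s : B} {f : K[X]} : f ∈ S.annIdeal s ↔ aeval (S.z : B) f * s = 0 := Iff.rfl

theorem mul_aeval_z {s : B} {k : ℤ} (h : QComm q s (S.z : B) k) (f : K[X]) :
    s * aeval (S.z : B) f = aeval (S.z : B) (f.comp (C ((q ^ k : Kˣ) : K) * X)) * s := by
  induction f using Polynomial.induction_on' with
  | add f g hf hg => rw [map_add, mul_add, hf, hg, add_comp, map_add, add_mul]
  | monomial n a =>
    have h1 := h.pow_right n
    rw [monomial_comp, mul_pow, aeval_monomial, map_mul, map_mul, aeval_C, ← C_pow, aeval_C,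
      map_pow, map_pow, aeval_X, ← mul_assoc, ← Algebra.commutes, mul_assoc, h1, mul_assoc,
      mul_assoc]
    congr 1
    rw [Algebra.smul_def, zpow_mul, zpow_natCast, Units.val_pow_eq_pow_val, map_pow]

variable {S} {μ : K} {m : ℕ}
  (hw : S.w = algebraMap K B (-((q : K) * (qRoot q μ 0 + qRoot q μ m))))
  (hc : c = q * (qRoot q μ 0 * qRoot q μ m))

include hw hc

/-- Multiplying w + c z⁻¹ + q z by z clears the denominator, and the assumed values of w and c are
the coefficients that make the quadratic have roots ρ_0 and ρ_m. For z y x the same computation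
gives the roots shifted by one step, ρ_(-1) and ρ_(m-1). -/
theorem z_mul_x_mul_y : (S.z : B) * (S.x * S.y) =
    aeval (S.z : B) (C (q : K) * ((X - C (qRoot q μ 0)) * (X - C (qRoot q μ m)))) := by
  subst hc
  rw [map_mul, aeval_X_sub_C_mul_X_sub_C, aeval_C, ← Algebra.smul_def, S.x_y, hw,
    mul_add (S.z : B), mul_add (S.z : B),
    mul_smul_comm, Units.mul_inv, mul_smul_comm, ← Algebra.commutes, ← Algebra.smul_def]
  module

theorem z_mul_y_mul_x : (S.z : B) * (S.y * S.x) =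
    aeval (S.z : B) ((X - C (qRoot q μ (-1))) * (X - C (qRoot q μ (m - 1)))) := by
  have e1 : qRoot q μ (-1) = q * qRoot q μ 0 := by
    have := zpow_mul_qRoot (q := q) (μ := μ) 1 (-1)
    simpa using this.symm
  have e2 : qRoot q μ (m - 1) = q * qRoot q μ m := by
    have := zpow_mul_qRoot (q := q) (μ := μ) 1 (m - 1)
    simpa using this.symm
  subst hc
  rw [e1, e2, aeval_X_sub_C_mul_X_sub_C, S.y_x, hw, mul_add (S.z : B), mul_add (S.z : B),
    mul_smul_comm, Units.mul_inv, ← Algebra.commutes, ← Algebra.smul_def]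
  module

/-- Multiply f(z) y^(n+1) = 0 on the left by z x: passing x through f replaces z by q z, and the
remaining z x y is a quadratic in z. -/
theorem left_mem_annIdeal {n : ℕ} {f : K[X]} (hf : f ∈ S.annIdeal (S.y ^ (n + 1))) :
    f.comp (C (q : K) * X) * ((X - C (qRoot q μ 0)) * (X - C (qRoot q μ m))) ∈
      S.annIdeal (S.y ^ n) := by
  rw [mem_annIdeal] at hf
  have h1 := S.mul_aeval_z S.x_z f
  rw [zpow_one] at h1
  have h2 : aeval (S.z : B) (C (q : K) * (f.comp (C (q : K) * X) *
      ((X - C (qRoot q μ 0)) * (X - C (qRoot q μ m))))) * S.y ^ n = 0 := by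
    rw [mul_left_comm, map_mul, ← z_mul_x_mul_y hw hc, mul_assoc, mul_assoc, mul_assoc, ← pow_succ',
      ← mul_assoc, ← mul_assoc]
    have h3 : aeval (S.z : B) (f.comp (C (q : K) * X)) * S.z =
        S.z * aeval (S.z : B) (f.comp (C (q : K) * X)) := by
      have := congrArg (aeval (S.z : B)) (mul_comm (f.comp (C (q : K) * X)) X)
      simpa only [map_mul, aeval_X] using this
    rw [h3, mul_assoc (S.z : B), ← h1, mul_assoc, mul_assoc, hf, mul_zero, mul_zero]
  rw [map_mul, aeval_C, mul_assoc, ← Algebra.smul_def] at h2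
  exact (smul_eq_zero_iff_right q.ne_zero).1 h2

/-- Multiply f(z) y^(n+1) = 0 on the right by x: the factor z y x is a quadratic in z, and moving it
to the left of y^n shifts the indices of its roots down by n. -/
theorem right_mem_annIdeal {n : ℕ} {f : K[X]} (hf : f ∈ S.annIdeal (S.y ^ (n + 1))) :
    f * ((X - C (qRoot q μ (-(n + 1)))) * (X - C (qRoot q μ (m - (n + 1))))) ∈
      S.annIdeal (S.y ^ n) := by
  rw [mem_annIdeal] at hf
  have hyz : QComm q (S.y ^ n) (S.z : B) (-n) :=
    (S.y_z.symm.pow_right n).symm.congr (by ring)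
  have h1 := S.mul_aeval_z hyz ((X - C (qRoot q μ (-1))) * (X - C (qRoot q μ (m - 1))))
  rw [← z_mul_y_mul_x hw hc, mul_comp, X_sub_C_qRoot_comp, X_sub_C_qRoot_comp,
    mul_mul_mul_comm, ← C_mul] at h1
  have h2 : aeval (S.z : B) f * (S.y ^ n * (S.z * (S.y * S.x))) = 0 := by
    rw [← mul_assoc (S.y ^ n), hyz, smul_mul_assoc, mul_smul_comm, mul_assoc (S.z : B),
      ← mul_assoc (S.y ^ n), ← pow_succ, ← mul_assoc, ← mul_assoc]
    have h3 : aeval (S.z : B) f * S.z = S.z * aeval (S.z : B) f := by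
      have := congrArg (aeval (S.z : B)) (mul_comm f X)
      simpa only [map_mul, aeval_X] using this
    rw [h3, mul_assoc (S.z : B), hf]
    simp
  rw [h1, map_mul, aeval_C, mul_assoc, ← Algebra.smul_def, mul_smul_comm] at h2
  have h3 := (smul_eq_zero_iff_right (mul_ne_zero (Units.ne_zero _) (Units.ne_zero _))).1 h2
  rw [← mul_assoc, ← map_mul] at h3
  rw [mem_annIdeal]
  convert h3 using 7
  · congr 1; ring
  · congr 1; ring

variable (hq : ∀ n : ℕ, 0 < n → q ^ n ≠ 1) (hμ : μ ≠ 0)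

include hq hμ

/-- Let n + 1 be the least exponent with y^(n+1) = 0. Then y^n is killed by the quadratics with root
indices {0, m} and {-(n+1), m-(n+1)}. The only possible common index is 0 = m-(n+1), so unless n + 1
= m they are coprime and y^n = 0, against minimality. -/
theorem pow_y_eq_zero_of_pow_y_eq_zero (hm : 0 < m) {N : ℕ} (hN : S.y ^ N = 0) :
    S.y ^ m = 0 := by
  classical
  have hex : ∃ N, S.y ^ N = 0 := ⟨N, hN⟩
  rcases hn : Nat.find hex with - | n
  -- Least exponent 0 means 1 = 0, so the ring is trivial.
  · have h0 := Nat.find_spec hex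
    rw [hn, pow_zero] at h0
    rw [← mul_one (S.y ^ m), h0, mul_zero]
  · have h0 := Nat.find_spec hex
    rw [hn] at h0
    by_cases hnm : n + 1 = m
    · rwa [hnm] at h0
    have h1 : (1 : K[X]) ∈ S.annIdeal (S.y ^ (n + 1)) := by
      rw [mem_annIdeal, h0, mul_zero]
    have hl := left_mem_annIdeal hw hc h1
    have hr := right_mem_annIdeal hw hc h1
    rw [one_comp, one_mul] at hl
    rw [one_mul] at hr
    have hcop : IsCoprime ((X - C (qRoot q μ 0)) * (X - C (qRoot q μ m)))
        ((X - C (qRoot q μ (-(n + 1)))) * (X - C (qRoot q μ (m - (n + 1))))) := by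
      have hne : ∀ a b : ℤ, a ≠ b → IsCoprime (X - C (qRoot q μ a)) (X - C (qRoot q μ b)) :=
        fun a b hab => isCoprime_X_sub_C_of_isUnit_sub
          (IsUnit.mk0 _ (sub_ne_zero.2 fun h => hab (qRoot_injective hq hμ h)))
      refine IsCoprime.mul_left (IsCoprime.mul_right ?_ ?_) (IsCoprime.mul_right ?_ ?_) <;>
        · apply hne
          omega
    obtain ⟨a, b, hab⟩ := hcop
    have h2 : (1 : K[X]) ∈ S.annIdeal (S.y ^ n) := by
      rw [← hab]
      exact Ideal.add_mem _ (Ideal.mul_mem_left _ _ hl) (Ideal.mul_mem_left _ _ hr)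
    rw [mem_annIdeal, map_one, one_mul] at h2
    exact absurd h2 (Nat.find_min hex (by omega))

/-- Descending induction on the exponent of y. An annihilator of y^(n+1) with root indices 0, …, k-1
gives two of y^n: the left rule produces indices 0, …, k and the extra index m, the right rule
indices 0, …, k (as m-(n+1) = k) and the extra index -(n+1). The extra roots differ, so both drop
out. -/
theorem qRootProd_mem_annIdeal_y (hy : S.y ^ m = 0) (n k : ℕ) (hnk : n + k = m) :
    qRootProd q μ 0 k ∈ S.annIdeal (S.y ^ n) := by
  induction k generalizing n with
  | zero =>
    rw [add_zero] at hnk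
    rw [hnk, mem_annIdeal, hy, mul_zero]
  | succ k ih =>
    have h := ih (n + 1) (by omega)
    have hl := left_mem_annIdeal hw hc h
    have hr := right_mem_annIdeal hw hc h
    rw [qRootProd_comp] at hl
    refine mem_of_mul_X_sub_C_mem (a := qRoot q μ m) (b := qRoot q μ (-(n + 1)))
      (fun h => ?_) ?_ ?_
    · have := qRoot_injective hq hμ h
      omega
    · have := Ideal.mul_mem_left _ (C ((q : K) ^ k)⁻¹) hl
      convert this using 1
      rw [qRootProd_succ', zero_add]
      have h1 : (C ((q : K) ^ k)⁻¹ : K[X]) * C ((q : K) ^ k) = 1 := by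
        rw [← C_mul, inv_mul_cancel₀ (pow_ne_zero _ q.ne_zero), C_1]
      linear_combination (-((X - C (qRoot q μ 0)) * qRootProd q μ 1 k * (X - C (qRoot q μ m)))) * h1
    · convert hr using 1
      rw [qRootProd_succ, zero_add, show (m : ℤ) - (n + 1) = k by omega]
      ring

/-- Ascending induction on n, started by the annihilator of y^0 = 1. The one of x^n, with root
indices n, …, m-1, kills x^(n+1) after multiplication by x on the right; multiplication by x on the
left gives indices n+1, …, m. They share n+1, …, m-1, and the extra roots ρ_n ≠ ρ_m cancel. In
particular x^m = 0. -/
theorem qRootProd_mem_annIdeal_x (hy : S.y ^ m = 0) (n k : ℕ) (hnk : n + k = m) :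
    qRootProd q μ n k ∈ S.annIdeal (S.x ^ n) := by
  induction n generalizing k with
  | zero =>
    have := qRootProd_mem_annIdeal_y hw hc hq hμ hy 0 k hnk
    simpa using this
  | succ n ih =>
    have h := ih (k + 1) (by omega)
    rw [mem_annIdeal] at h
    refine mem_of_mul_X_sub_C_mem (a := qRoot q μ n) (b := qRoot q μ m) (fun h => ?_) ?_ ?_
    · have := qRoot_injective hq hμ h
      omega
    · rw [mul_comm]
      push_cast
      rw [← qRootProd_succ', mem_annIdeal, pow_succ, ← mul_assoc, h, zero_mul]
    · have h1 := S.mul_aeval_z S.x_z (qRootProd q μ n (k + 1))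
      rw [zpow_one, qRootProd_comp] at h1
      set Q : K := (q : K) ^ (k + 1) with hQ
      have hQ0 : Q ≠ 0 := pow_ne_zero _ q.ne_zero
      have h2 : aeval (S.z : B) (C Q * qRootProd q μ (n + 1) (k + 1)) *
          S.x ^ (n + 1) = 0 := by
        rw [pow_succ', ← mul_assoc, ← h1, mul_assoc, h, mul_zero]
      rw [map_mul, aeval_C, mul_assoc, ← Algebra.smul_def] at h2
      have h3 := (smul_eq_zero_iff_right hQ0).1 h2
      rw [qRootProd_succ, show (n : ℤ) + 1 + k = m by omega] at h3
      push_cast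
      exact h3

omit hw hc hq hμ

theorem coefHom_toLaurent {lam : K} (hlam : S.w = algebraMap K B lam) (f : K[X][X]) :
    S.coefHom (toLaurent f) = aeval (S.z : B) (f.map (evalRingHom lam)) := by
  induction f using Polynomial.induction_on' with
  | add f g hf hg => rw [map_add, map_add, hf, hg, Polynomial.map_add, map_add]
  | monomial n a =>
    rw [← C_mul_X_pow_eq_monomial, toLaurent_C_mul_X_pow, coefHom_single, Polynomial.map_mul,
      Polynomial.map_pow, map_X, map_C, map_mul, map_pow, aeval_X, aeval_C, hlam,
      aeval_algebraMap_apply]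
    simp

theorem coefHom_mul_z_pow {lam : K} (hlam : S.w = algebraMap K B lam) {f : K[X][T;T⁻¹]} {N : ℕ}
    {f' : K[X][X]} (h : toLaurent f' = f * LaurentPolynomial.T N) :
    S.coefHom f * (S.z : B) ^ N = aeval (S.z : B) (f'.map (evalRingHom lam)) := by
  rw [← coefHom_toLaurent hlam, h, map_mul, coefHom_T]
  simp

/-- Powers of z are units commuting with the coefficients, so clearing denominators does not affect
annihilation. This passes from Laurent polynomials to the principal ideal ring K[X]. -/
theorem map_eval_mem_annIdeal_iff {lam : K} (hlam : S.w = algebraMap K B lam) {f : K[X][T;T⁻¹]}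
    {N : ℕ} {f' : K[X][X]} (h : toLaurent f' = f * LaurentPolynomial.T N) {s : B} :
    f'.map (evalRingHom lam) ∈ S.annIdeal s ↔ S.coefHom f * s = 0 := by
  rw [mem_annIdeal, ← coefHom_mul_z_pow hlam h, ← (S.commute_coefHom
    (s := (S.z : B) ^ N) (S.w_z.symm.pow_left N) ((Commute.refl _).pow_left N) f).eq,
    mul_assoc, ← Units.val_pow_eq_pow_val, Units.mul_right_eq_zero]

/-- An element killed by `ψ` is killed by `π` as soon as this is so for polynomials in `z` times
powers of `x` and of `y`. -/
theorem eq_zero_of_map_eq_zero_of_annIdeal_le (hq : ∀ n : ℕ, 0 < n → q ^ n ≠ 1)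
    (hS : Function.Surjective S.normalForm) {M B' : Type*} [Ring M] [Algebra K M]
    [Ring B'] [Algebra K B'] (ψ : B →ₐ[K] M) (π : B →ₐ[K] B') {lam : K}
    (hψ : ψ S.w = algebraMap K M lam) (hπ : π S.w = algebraMap K B' lam)
    (hy : ∀ n, (S.map ψ).annIdeal ((S.map ψ).y ^ n) ≤ (S.map π).annIdeal ((S.map π).y ^ n))
    (hx : ∀ n, (S.map ψ).annIdeal ((S.map ψ).x ^ n) ≤ (S.map π).annIdeal ((S.map π).x ^ n))
    {s : B} (hs : ψ s = 0) : π s = 0 := by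
  obtain ⟨f, rfl⟩ := hS s
  rw [map_normalForm] at hs ⊢
  refine normalForm_eq_zero_of_components _ fun i => ?_
  have h := coefHom_mul_yPow_eq_zero _ hq hs i
  obtain ⟨N, f', hf'⟩ := LaurentPolynomial.exists_T_pow (f i)
  obtain ⟨n, hn | hn⟩ := i.2.2.eq_nat_or_neg
  · rw [hn, yPow_natCast] at h ⊢
    exact (map_eval_mem_annIdeal_iff (S := S.map π) hπ hf').1
      (hy n ((map_eval_mem_annIdeal_iff (S := S.map ψ) hψ hf').2 h))
  · rw [hn, yPow_neg_natCast] at h ⊢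
    exact (map_eval_mem_annIdeal_iff (S := S.map π) hπ hf').1
      (hx n ((map_eval_mem_annIdeal_iff (S := S.map ψ) hψ hf').2 h))

end AmbiskewSystem

/-! ### Twisted group algebras -/

section TwistMul

variable {k : Type*} [CommRing k] {G : Type*} [AddCommGroup G] (q : kˣ) (β : G →+ G →+ ℤ)

/-- The twisted convolution product as a bilinear map. -/
noncomputable def twistMul : (G →₀ k) →ₗ[k] (G →₀ k) →ₗ[k] (G →₀ k) :=
  Finsupp.lsum k fun a => LinearMap.toSpanSingleton k ((G →₀ k) →ₗ[k] (G →₀ k))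
    (Finsupp.lsum k fun b => ((q ^ β a b : kˣ) : k) • Finsupp.lsingle (a + b))

theorem twistMul_single_single (a b : G) (r s : k) :
    twistMul q β (Finsupp.single a r) (Finsupp.single b s) =
      Finsupp.single (a + b) (r * s * ((q ^ β a b : kˣ) : k)) := by
  rw [twistMul, Finsupp.lsum_single, LinearMap.toSpanSingleton_apply, LinearMap.smul_apply,
    Finsupp.lsum_single, LinearMap.smul_apply, Finsupp.lsingle_apply, Finsupp.smul_single,
    Finsupp.smul_single, smul_eq_mul, smul_eq_mul]
  congr 1
  ring

theorem twistMul_apply [DecidableEq G] (f g : G →₀ k) (c : G) :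
    twistMul q β f g c = ∑ a ∈ f.support, ∑ b ∈ g.support,
      if a + b = c then f a * g b * ((q ^ β a b : kˣ) : k) else 0 := by
  have h : twistMul q β f g = ∑ a ∈ f.support, ∑ b ∈ g.support,
      twistMul q β (Finsupp.single a (f a)) (Finsupp.single b (g b)) := by
    conv_lhs => rw [← Finsupp.sum_single f, ← Finsupp.sum_single g]
    simp only [Finsupp.sum, map_sum, LinearMap.sum_apply]
    exact Finset.sum_comm
  simp only [h, twistMul_single_single, Finsupp.finsetSum_apply, Finsupp.single_apply]

end TwistMul

/-- The twisted group algebra with basis `e_g`, `g ∈ G`, and `e_g e_h = q ^ β(g, h) e_{g + h}`. -/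
def TwistedAlgebra (k : Type*) [CommRing k] {G : Type*} [AddCommGroup G] (_q : kˣ)
    (_β : G →+ G →+ ℤ) : Type _ :=
  G →₀ k

namespace TwistedAlgebra

variable {k : Type*} [CommRing k] {G : Type*} [AddCommGroup G] {q : kˣ} {β : G →+ G →+ ℤ}

noncomputable instance : AddCommGroup (TwistedAlgebra k q β) :=
  inferInstanceAs (AddCommGroup (G →₀ k))

noncomputable instance {K : Type*} [Semiring K] [Module K k] : Module K (TwistedAlgebra k q β) :=
  inferInstanceAs (Module K (G →₀ k))

instance {K : Type*} [CommSemiring K] [Algebra K k] :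
    IsScalarTower K k (TwistedAlgebra k q β) :=
  inferInstanceAs (IsScalarTower K k (G →₀ k))

/-- The multiple `r e_g` of a basis element. -/
noncomputable def single (g : G) : k →ₗ[k] TwistedAlgebra k q β :=
  Finsupp.lsingle (M := k) g

/-- The coefficient of `e_g`. -/
noncomputable def coeff (g : G) : TwistedAlgebra k q β →ₗ[k] k :=
  Finsupp.lapply (M := k) g

theorem coeff_single [DecidableEq G] (g h : G) (r : k) :
    coeff h (single g r : TwistedAlgebra k q β) = if g = h then r else 0 :=
  Finsupp.single_apply

theorem coeff_single_self (g : G) (r : k) :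
    coeff g (single g r : TwistedAlgebra k q β) = r := by
  classical
  rw [coeff_single, if_pos rfl]

theorem ext_coeff {f f' : TwistedAlgebra k q β} (h : ∀ g, coeff g f = coeff g f') : f = f' :=
  Finsupp.ext h

@[elab_as_elim]
theorem induction_single {P : TwistedAlgebra k q β → Prop} (f : TwistedAlgebra k q β)
    (zero : P 0) (add : ∀ f g, P f → P g → P (f + g)) (single : ∀ g r, P (single g r)) : P f :=
  Finsupp.induction_linear f zero add single

variable (k q β) in
/-- The multiplication of the twisted group algebra as a bilinear map. -/
noncomputable def mulLin :
    TwistedAlgebra k q β →ₗ[k] TwistedAlgebra k q β →ₗ[k] TwistedAlgebra k q β :=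
  twistMul q β

theorem mulLin_single_single (a b : G) (r s : k) :
    mulLin k q β (single a r) (single b s) = single (a + b) (r * s * ((q ^ β a b : kˣ) : k)) :=
  twistMul_single_single q β a b r s

noncomputable instance : Mul (TwistedAlgebra k q β) := ⟨fun f g => mulLin k q β f g⟩

noncomputable instance : One (TwistedAlgebra k q β) := ⟨single 0 1⟩

theorem mul_def (f g : TwistedAlgebra k q β) : f * g = mulLin k q β f g := rfl

theorem one_def : (1 : TwistedAlgebra k q β) = single 0 1 := rfl

theorem single_mul_single (a b : G) (r s : k) :
    (single a r : TwistedAlgebra k q β) * single b s =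
      single (a + b) (r * s * ((q ^ β a b : kˣ) : k)) :=
  mulLin_single_single a b r s

noncomputable instance : Ring (TwistedAlgebra k q β) where
  __ := (inferInstance : AddCommGroup (TwistedAlgebra k q β))
  left_distrib f g h := by simp only [mul_def, map_add]
  right_distrib f g h := by simp only [mul_def, map_add, LinearMap.add_apply]
  zero_mul f := by simp only [mul_def, map_zero, LinearMap.zero_apply]
  mul_zero f := by simp only [mul_def, map_zero]
  mul_assoc f g h := by
    induction f using induction_single with
    | zero => simp only [mul_def, map_zero, LinearMap.zero_apply]
    | add f f' hf hf' => simp only [mul_def, map_add, LinearMap.add_apply] at *; rw [hf, hf']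
    | single a r =>
      induction g using induction_single with
      | zero => simp only [mul_def, map_zero, LinearMap.zero_apply]
      | add f f' hf hf' => simp only [mul_def, map_add, LinearMap.add_apply] at *; rw [hf, hf']
      | single b s =>
        induction h using induction_single with
        | zero => simp only [mul_def, map_zero]
        | add f f' hf hf' => simp only [mul_def, map_add] at *; rw [hf, hf']
        | single c t =>
          simp only [single_mul_single, map_add, AddMonoidHom.add_apply, zpow_add, Units.val_mul,
            add_assoc]
          congr 1
          ring
  one_mul f := by
    induction f using induction_single with
    | zero => simp only [mul_def, map_zero]
    | add f f' hf hf' => simp only [mul_def, map_add] at *; rw [hf, hf']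
    | single a r => rw [one_def, single_mul_single]; simp
  mul_one f := by
    induction f using induction_single with
    | zero => simp only [mul_def, map_zero, LinearMap.zero_apply]
    | add f f' hf hf' => simp only [mul_def, map_add, LinearMap.add_apply] at *; rw [hf, hf']
    | single a r => rw [one_def, single_mul_single]; simp

noncomputable instance {K : Type*} [CommSemiring K] [Algebra K k] :
    Algebra K (TwistedAlgebra k q β) :=
  Algebra.ofModule
    (fun c f g => by
      rw [mul_def, mul_def, ← algebraMap_smul k c f, ← algebraMap_smul k c, map_smul,
        LinearMap.smul_apply])
    (fun c f g => by
      rw [mul_def, mul_def, ← algebraMap_smul k c g, ← algebraMap_smul k c, map_smul])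

theorem smul_single {K : Type*} [CommSemiring K] [Algebra K k] (c : K) (g : G) (r : k) :
    c • (single g r : TwistedAlgebra k q β) = single g (c • r) :=
  Finsupp.smul_single _ _ _

/-- The support of an element. -/
noncomputable def support (f : TwistedAlgebra k q β) : Finset G := Finsupp.support (M := k) f

theorem mem_support {f : TwistedAlgebra k q β} {g : G} : g ∈ support f ↔ coeff g f ≠ 0 :=
  Finsupp.mem_support_iff (M := k)

theorem coeff_mul [DecidableEq G] (f g : TwistedAlgebra k q β) (c : G) :
    coeff c (f * g) = ∑ a ∈ support f, ∑ b ∈ support g,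
      if a + b = c then coeff a f * coeff b g * ((q ^ β a b : kˣ) : k) else 0 :=
  twistMul_apply q β f g c

/-- The supports of two nonzero elements contain a pair whose sum is attained only once. The
coefficient of the product there is a single product of nonzero scalars and a unit. -/
instance [UniqueSums G] [NoZeroDivisors k] : NoZeroDivisors (TwistedAlgebra k q β) where
  eq_zero_or_eq_zero_of_mul_eq_zero {f g} h := by
    classical
    by_contra! hfg
    have hne : ∀ f : TwistedAlgebra k q β, f ≠ 0 → (support f).Nonempty := fun f hf =>
      Finsupp.support_nonempty_iff.2 hf
    obtain ⟨a, ha, b, hb, hab⟩ := UniqueSums.uniqueAdd_of_nonempty (hne f hfg.1) (hne g hfg.2)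
    have h1 := coeff_mul f g (a + b)
    rw [h, map_zero, Finset.sum_eq_single a, Finset.sum_eq_single b, if_pos rfl] at h1
    · exact mul_ne_zero (mul_ne_zero (mem_support.1 ha) (mem_support.1 hb))
        (by
          have : Nontrivial k := ⟨_, _, mem_support.1 ha⟩
          exact Units.ne_zero _) h1.symm
    · intro b' hb' hne
      exact if_neg fun h => hne (hab ha hb' h).2
    · exact fun h => absurd hb h
    · intro a' ha' hne
      refine Finset.sum_eq_zero fun b' hb' => if_neg fun h => hne (hab ha' hb' h).1
    · exact fun h => absurd ha h

instance [Nontrivial k] : Nontrivial (TwistedAlgebra k q β) :=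
  ⟨1, 0, fun h => one_ne_zero (α := k) (by
    rw [← coeff_single_self (q := q) (β := β) (0 : G) (1 : k), ← one_def, h, map_zero])⟩

theorem coeff_mul_eq_zero {f g : TwistedAlgebra k q β} {c : G}
    (h : ∀ a b, coeff a f ≠ 0 → coeff b g ≠ 0 → a + b ≠ c) : coeff c (f * g) = 0 := by
  classical
  rw [coeff_mul]
  exact Finset.sum_eq_zero fun a ha => Finset.sum_eq_zero fun b hb =>
    if_neg (h a b (mem_support.1 ha) (mem_support.1 hb))

/-- The unit `c e_g`. -/
noncomputable def unit (g : G) (c : kˣ) : (TwistedAlgebra k q β)ˣ where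
  val := single g c
  inv := single (-g) (((c⁻¹ * q ^ β g g : kˣ) : k))
  val_inv := by
    rw [single_mul_single, one_def, add_neg_cancel, map_neg, ← Units.val_mul, ← Units.val_mul]
    simp
  inv_val := by
    rw [single_mul_single, one_def, neg_add_cancel, map_neg, AddMonoidHom.neg_apply,
      ← Units.val_mul, ← Units.val_mul]
    congr 2
    simp

@[simp] theorem val_unit (g : G) (c : kˣ) :
    ((unit g c : (TwistedAlgebra k q β)ˣ) : TwistedAlgebra k q β) = single g (c : k) := rfl

theorem unit_mul_unit (g h : G) (c d : kˣ) :
    (unit g c : (TwistedAlgebra k q β)ˣ) * (unit h d : (TwistedAlgebra k q β)ˣ) =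
      (unit (g + h) (c * d * q ^ β g h) : (TwistedAlgebra k q β)ˣ) := by
  ext1
  simp only [Units.val_mul, val_unit, single_mul_single]

theorem single_mul_comm (g h : G) (c d : k) :
    (single g c : TwistedAlgebra k q β) * single h d =
      ((q ^ (β g h - β h g) : kˣ) : k) • (single h d * single g c) := by
  rw [single_mul_single, single_mul_single, ← map_smul, add_comm h g, zpow_sub]
  congr 1
  rw [smul_eq_mul, mul_left_comm, ← Units.val_mul, mul_comm d c]
  simp

theorem unit_zpow (g : G) (hg : β g g = 0) (n : ℤ) :
    (unit g 1 : (TwistedAlgebra k q β)ˣ) ^ n =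
      (unit (n • g) 1 : (TwistedAlgebra k q β)ˣ) := by
  have hmul : ∀ a b : ℤ, (unit (a • g) 1 : (TwistedAlgebra k q β)ˣ) *
      (unit (b • g) 1 : (TwistedAlgebra k q β)ˣ) =
      (unit ((a + b) • g) 1 : (TwistedAlgebra k q β)ˣ) := by
    intro a b
    rw [unit_mul_unit, add_smul]
    simp [hg]
  have h0 : (unit (0 : G) 1 : (TwistedAlgebra k q β)ˣ) = 1 := by
    ext1
    simp [one_def]
  induction n using Int.induction_on with
  | zero => rw [zpow_zero, zero_smul, h0]
  | succ n ih => rw [zpow_add_one, ih, ← hmul, one_smul]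
  | pred n ih =>
    rw [zpow_sub_one, ih, mul_inv_eq_iff_eq_mul]
    have := hmul (-(n : ℤ) - 1) 1
    rw [one_smul, sub_add_cancel] at this
    exact this.symm

end TwistedAlgebra

/-! ### The torus of rank `2n` -/

/-- The pairing `-∑ b_k a'_k` of `(a, b)` and `(a', b')`. -/
def torusPairing (n : ℕ) :
    ((Fin n → ℤ) × (Fin n → ℤ)) →+ ((Fin n → ℤ) × (Fin n → ℤ)) →+ ℤ :=
  AddMonoidHom.mk' (fun g => AddMonoidHom.mk' (fun h => -(g.2 ⬝ᵥ h.1))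
    (fun h h' => by rw [Prod.fst_add, dotProduct_add, neg_add]))
    (fun g g' => by
      ext1 h
      change -((g.2 + g'.2) ⬝ᵥ h.1) = -(g.2 ⬝ᵥ h.1) + -(g'.2 ⬝ᵥ h.1)
      rw [add_dotProduct, neg_add])

theorem torusPairing_apply (n : ℕ) (g h : (Fin n → ℤ) × (Fin n → ℤ)) :
    torusPairing n g h = -(g.2 ⬝ᵥ h.1) := rfl

/-- The exponent of the image of the `i`-th generator (counted from `0`). -/
def torusExponent (n i : ℕ) : (Fin n → ℤ) × (Fin n → ℤ) :=
  (fun k => if i = 2 * k then 1 else 0, fun k => if Odd i ∧ 2 * (k : ℕ) ≤ i then 1 else 0)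

/-- An even i = 2k has exponent the k-th basis vector of the first factor, or 0 if k ≥ n; an odd i =
2k + 1 has exponent the sum of the basis vectors 0, …, k of the second factor. Only an odd index
against a smaller even one pairs nontrivially. The bound j < 2n matters: for n = r the last
generator, of index 2r, gets exponent 0 and so becomes a scalar. -/
theorem torusPairing_torusExponent (n i j : ℕ) :
    torusPairing n (torusExponent n i) (torusExponent n j) =
      if Odd i ∧ Even j ∧ j ≤ i ∧ j < 2 * n then -1 else 0 := by
  rw [torusPairing_apply, dotProduct]
  split_ifs with h
  · obtain ⟨hi, ⟨l, rfl⟩, hji, hjn⟩ := h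
    rw [Finset.sum_eq_single ⟨l, by omega⟩]
    · have : 2 * l ≤ i := by omega
      simp [torusExponent, hi, this, ← two_mul]
    · intro k _ hk
      have : l + l ≠ 2 * k := fun h => hk (Fin.ext (by simp; omega))
      simp [torusExponent, this]
    · simp
  · rw [neg_eq_zero]
    refine Finset.sum_eq_zero fun k _ => ?_
    simp only [torusExponent]
    split_ifs with h1 h2 h2 <;> simp
    exact h ⟨h1.1, ⟨k, by omega⟩, by omega, by have := k.2; omega⟩

/-- The antisymmetrized pairing is the commutation exponent, and it reproduces the q_{ij}. For n = r
+ 1 it also covers the index 2r + 1, which represents y: conjugation by y is α, so y behaves like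
one more generator of even number. -/
theorem torusPairing_sub (n : ℕ) {i j : ℕ} (hji : j < i) :
    torusPairing n (torusExponent n i) (torusExponent n j) -
      torusPairing n (torusExponent n j) (torusExponent n i) =
      if Odd i ∧ Even j ∧ j < 2 * n then -1 else 0 := by
  have h : ¬(Odd j ∧ Even i ∧ i ≤ j ∧ i < 2 * n) := fun h => absurd h.2.2.1 (by omega)
  rw [torusPairing_torusExponent, torusPairing_torusExponent, if_neg h]
  simp [hji.le]

/-! ### Goldie ranks -/

/-- Independence passes to cyclic right ideals generated by one nonzero element of each, so it can
be expressed by elements of the source ring and the predicate "lies in the kernel". The rank of the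
image then depends only on the kernel. -/
theorem exists_iSupIndep_iff_of_surjective {R S : Type*} [Ring R] [Ring S] {f : R →+* S}
    (hf : Function.Surjective f) (k : ℕ) :
    (∃ U : Fin k → Submodule Sᵐᵒᵖ S, iSupIndep U ∧ ∀ i, U i ≠ ⊥) ↔
      ∃ s : Fin k → R, (∀ i, f (s i) ≠ 0) ∧
        ∀ r : Fin k → R, f (∑ i, s i * r i) = 0 → ∀ i, f (s i * r i) = 0 := by
  classical
  constructor
  · rintro ⟨U, hU, hne⟩
    have h1 : ∀ i, ∃ s : R, f s ∈ U i ∧ f s ≠ 0 := fun i => by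
      obtain ⟨u, hu, hu0⟩ := Submodule.exists_mem_ne_zero_of_ne_bot (hne i)
      obtain ⟨s, rfl⟩ := hf u
      exact ⟨s, hu, hu0⟩
    choose s hs hs0 using h1
    refine ⟨s, hs0, fun r hr i => ?_⟩
    rw [iSupIndep_iff_finsetSum_eq_zero_imp_eq_zero] at hU
    refine hU Finset.univ (fun i => f (s i * r i)) (fun i _ => ?_) ?_ i (Finset.mem_univ i)
    · rw [map_mul]
      exact (U i).smul_mem (MulOpposite.op (f (r i))) (hs i)
    · rwa [← map_sum]
  · rintro ⟨s, hs0, hs⟩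
    refine ⟨fun i => Submodule.span Sᵐᵒᵖ {f (s i)}, ?_, fun i h => ?_⟩
    · rw [iSupIndep_iff_finsetSum_eq_zero_imp_eq_zero]
      intro t v hv hsum i hi
      have h1 : ∀ i, ∃ r, v i = f (s i * r) ∨ i ∉ t := by
        intro i
        by_cases hi : i ∈ t
        · obtain ⟨a, ha⟩ := Submodule.mem_span_singleton.1 (hv i hi)
          obtain ⟨r, hr⟩ := hf a.unop
          refine ⟨r, Or.inl ?_⟩
          rw [map_mul, hr, ← ha]
          rfl
        · exact ⟨0, Or.inr hi⟩
      choose r hr using h1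
      have h2 := hs (fun i => if i ∈ t then r i else 0) (by
        rw [map_sum, ← hsum, ← Finset.sum_subset (Finset.subset_univ t)]
        · refine Finset.sum_congr rfl fun i hi => ?_
          rw [if_pos hi]
          exact ((hr i).resolve_right (not_not.2 hi)).symm
        · intro i _ hi
          rw [if_neg hi, mul_zero, map_zero]) i
      rw [if_pos hi] at h2
      rw [(hr i).resolve_right (not_not.2 hi), h2]
    · rw [Submodule.span_singleton_eq_bot] at h
      exact hs0 i h

theorem rightGoldieRank_eq_of_surjective {R S S' : Type*} [Ring R] [Ring S] [Ring S']
    {f : R →+* S} {f' : R →+* S'} (hf : Function.Surjective f) (hf' : Function.Surjective f')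
    (h : ∀ a, f a = 0 ↔ f' a = 0) : rightGoldieRank S = rightGoldieRank S' := by
  unfold rightGoldieRank
  refine iSup_congr fun k => ?_
  have : (∃ U : Fin k → Submodule Sᵐᵒᵖ S, iSupIndep U ∧ ∀ i, U i ≠ ⊥) ↔
      (∃ U : Fin k → Submodule S'ᵐᵒᵖ S', iSupIndep U ∧ ∀ i, U i ≠ ⊥) := by
    rw [exists_iSupIndep_iff_of_surjective hf, exists_iSupIndep_iff_of_surjective hf']
    simp only [ne_eq, h]
  exact iSup_congr_Prop this fun _ => rfl

/-- The box of side `2 N + 1` in `ℤ ^ (2 r)`. -/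
noncomputable def latticeBox (r N : ℕ) : Finset ((Fin r → ℤ) × (Fin r → ℤ)) :=
  (Finset.Icc (fun _ => -(N : ℤ)) fun _ => (N : ℤ)) ×ˢ
    Finset.Icc (fun _ => -(N : ℤ)) fun _ => (N : ℤ)

theorem mem_latticeBox {r N : ℕ} {g : (Fin r → ℤ) × (Fin r → ℤ)} :
    g ∈ latticeBox r N ↔ (∀ i, |g.1 i| ≤ N) ∧ ∀ i, |g.2 i| ≤ N := by
  simp only [latticeBox, Finset.mem_product, Finset.mem_Icc, Pi.le_def, abs_le, forall_and]

theorem card_latticeBox (r N : ℕ) : (latticeBox r N).card = (2 * N + 1) ^ (2 * r) := by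
  have h : ((N : ℤ) + 1 - -(N : ℤ)).toNat = 2 * N + 1 := by omega
  rw [latticeBox, Finset.card_product, Pi.card_Icc]
  simp only [Int.card_Icc, Finset.prod_const, Finset.card_univ, Fintype.card_fin, h]
  ring

theorem add_mem_latticeBox {r N d : ℕ} {g h : (Fin r → ℤ) × (Fin r → ℤ)}
    (hg : g ∈ latticeBox r d) (hh : h ∈ latticeBox r N) : g + h ∈ latticeBox r (N + d) := by
  rw [mem_latticeBox] at *
  push_cast
  refine ⟨fun i => (abs_add_le _ _).trans ?_, fun i => (abs_add_le _ _).trans ?_⟩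
  · linarith [hg.1 i, hh.1 i]
  · linarith [hg.2 i, hh.2 i]

theorem exists_subset_latticeBox {r : ℕ} (t : Finset ((Fin r → ℤ) × (Fin r → ℤ))) :
    ∃ d, t ⊆ latticeBox r d := by
  refine ⟨t.sup fun g => (∑ i, (g.1 i).natAbs) + ∑ i, (g.2 i).natAbs, fun g hg => ?_⟩
  have h := Finset.le_sup (f := fun g : (Fin r → ℤ) × (Fin r → ℤ) =>
    (∑ i, (g.1 i).natAbs) + ∑ i, (g.2 i).natAbs) hg
  rw [mem_latticeBox]
  have h1 : ∀ i, (g.1 i).natAbs ≤ ∑ i, (g.1 i).natAbs := fun i =>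
    Finset.single_le_sum (f := fun i => (g.1 i).natAbs) (fun _ _ => Nat.zero_le _)
      (Finset.mem_univ i)
  have h2 : ∀ i, (g.2 i).natAbs ≤ ∑ i, (g.2 i).natAbs := fun i =>
    Finset.single_le_sum (f := fun i => (g.2 i).natAbs) (fun _ _ => Nat.zero_le _)
      (Finset.mem_univ i)
  refine ⟨fun i => ?_, fun i => ?_⟩
  · rw [Int.abs_eq_natAbs]
    exact_mod_cast (h1 i).trans (by omega)
  · rw [Int.abs_eq_natAbs]
    exact_mod_cast (h2 i).trans (by omega)

/-- The ratio of the sizes of the boxes of radius N + d and N tends to 1: enlarging by a fixed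
margin is asymptotically free. -/
theorem le_of_mul_pow_le {k m d s : ℕ}
    (h : ∀ N : ℕ, k * (2 * N + 1) ^ s ≤ m * (2 * (N + d) + 1) ^ s) : k ≤ m := by
  have hpos : ∀ N : ℕ, (0 : ℝ) < 2 * N + 1 := fun N => by positivity
  have h1 : ∀ N : ℕ, (k : ℝ) ≤ m * (1 + 2 * d * (2 * N + 1 : ℝ)⁻¹) ^ s := by
    intro N
    have h2 : (k : ℝ) * (2 * N + 1) ^ s ≤ m * (2 * (N + d) + 1) ^ s := by exact_mod_cast h N
    have h3 : (1 + 2 * d * (2 * N + 1 : ℝ)⁻¹) = (2 * (N + d) + 1) / (2 * N + 1) := by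
      field_simp [(hpos N).ne']
      ring
    rw [h3, div_pow, ← mul_div_assoc, le_div_iff₀ (pow_pos (hpos N) s)]
    exact h2
  have h2 : Filter.Tendsto (fun N : ℕ => (m : ℝ) * (1 + 2 * d * (2 * N + 1 : ℝ)⁻¹) ^ s)
      Filter.atTop (nhds (m * (1 + 2 * d * 0) ^ s)) := by
    refine (((Filter.Tendsto.const_mul _ (Filter.Tendsto.inv_tendsto_atTop ?_)).const_add
      1).pow s).const_mul _
    exact Filter.tendsto_atTop_add_const_right _ _
      (tendsto_natCast_atTop_atTop.const_mul_atTop two_pos)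
  have h3 := ge_of_tendsto' h2 h1
  rw [mul_zero, add_zero, one_pow, mul_one] at h3
  exact_mod_cast h3

open TwistedAlgebra in
/-- The number of independent right ideals of a matrix ring over a quantum torus is bounded by the
size of the matrices, by comparing dimensions of the spans of boxes of monomials. -/
theorem le_of_independent_matrix {K : Type*} [Field K] {q : Kˣ} {r : ℕ}
    {β : ((Fin r → ℤ) × (Fin r → ℤ)) →+ ((Fin r → ℤ) × (Fin r → ℤ)) →+ ℤ} {m k : ℕ} (hm : 0 < m)
    (s : Fin k → Matrix (Fin m) (Fin m) (TwistedAlgebra K q β)) (hs0 : ∀ i, s i ≠ 0)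
    (hs : ∀ t : Fin k → Matrix (Fin m) (Fin m) (TwistedAlgebra K q β),
      ∑ i, s i * t i = 0 → ∀ i, s i * t i = 0) : k ≤ m := by
  classical
  have h1 : ∀ i, ∃ a b, s i a b ≠ 0 := fun i => by
    by_contra! h
    exact hs0 i (Matrix.ext h)
  choose a b hab using h1
  obtain ⟨d, hd⟩ := exists_subset_latticeBox (Finset.univ.biUnion fun i : Fin k =>
    Finset.univ.biUnion fun a : Fin m => Finset.univ.biUnion fun b : Fin m => support (s i a b))
  have hd' : ∀ i a b g, coeff g (s i a b) ≠ 0 → g ∈ latticeBox r d := fun i a b g hg =>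
    hd (by
      simp only [Finset.mem_biUnion, Finset.mem_univ, true_and]
      exact ⟨i, a, b, mem_support.2 hg⟩)
  refine le_of_mul_pow_le (d := d) (s := 2 * r) fun N => ?_
  -- For each i, a row of m unknown elements supported in the box of radius N. It will be the row `b
  -- i` of a matrix multiplying s_i, chosen so as to meet the nonzero entry of s_i at (a_i, b_i).
  let v : (Fin k × Fin m × latticeBox r N → K) → Fin k → Fin m → TwistedAlgebra K q β :=
    fun c i j => ∑ g : latticeBox r N, c (i, j, g) •
      (single (g : (Fin r → ℤ) × (Fin r → ℤ)) (1 : K) : TwistedAlgebra K q β)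
  have hv : ∀ c i j g, coeff g (v c i j) =
      if h : g ∈ latticeBox r N then c (i, j, ⟨g, h⟩) else 0 := by
    intro c i j g
    simp only [v, map_sum, map_smul, coeff_single, smul_eq_mul, mul_ite, mul_one, mul_zero]
    split_ifs with h
    · rw [Finset.sum_eq_single ⟨g, h⟩]
      · simp
      · intro g' _ hg'
        rw [if_neg fun h => hg' (Subtype.ext h)]
      · simp
    · refine Finset.sum_eq_zero fun g' _ => if_neg ?_
      rintro rfl
      exact h g'.2
  let Φ : (Fin k × Fin m × latticeBox r N → K) →ₗ[K]
      (Fin m × Fin m × latticeBox r (N + d) → K) :=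
    { toFun := fun c x => coeff (x.2.2 : (Fin r → ℤ) × (Fin r → ℤ))
        (∑ i, s i x.1 (b i) * v c i x.2.1)
      map_add' := fun c c' => by
        funext x
        simp only [v, Pi.add_apply, add_smul, Finset.sum_add_distrib, mul_add, map_add]
      map_smul' := fun e c => by
        funext x
        simp only [v, Pi.smul_apply, smul_eq_mul, mul_smul, ← Finset.smul_sum, mul_smul_comm,
          map_smul, RingHom.id_apply] }
  -- A vanishing image is a relation ∑ s_i t_i = 0, so each s_i t_i = 0 by independence. Its entry
  -- in row a_i is the nonzero entry of s_i times an unknown, and the torus is a domain.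
  have hΦ : Function.Injective Φ := by
    rw [injective_iff_map_eq_zero]
    intro c hc
    have h2 : ∀ a j, ∑ i, s i a (b i) * v c i j = 0 := by
      intro a j
      refine ext_coeff fun h => ?_
      rw [map_zero]
      by_cases hh : h ∈ latticeBox r (N + d)
      · exact congrFun hc (a, j, ⟨h, hh⟩)
      · rw [map_sum]
        refine Finset.sum_eq_zero fun i _ => coeff_mul_eq_zero fun g g' hg hg' hgg => hh ?_
        rw [← hgg]
        refine add_mem_latticeBox (hd' _ _ _ _ hg) ?_
        by_contra hcon
        rw [hv, dif_neg hcon] at hg'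
        exact hg' rfl
    have h3 : ∀ i, s i * Matrix.of (fun l j => if l = b i then v c i j else 0) = 0 := by
      refine hs _ (Matrix.ext fun a j => ?_)
      rw [Matrix.sum_apply]
      refine Eq.trans (Finset.sum_congr rfl fun i _ => ?_) (h2 a j)
      rw [Matrix.mul_apply]
      simp
    funext ⟨i, j, g⟩
    have h4 := congrFun (congrFun (h3 i) (a i)) j
    rw [Matrix.mul_apply] at h4
    simp only [Matrix.of_apply, mul_ite, mul_zero, Finset.sum_ite_eq', Finset.mem_univ, if_true,
      Matrix.zero_apply] at h4
    have h5 := (mul_eq_zero.1 h4).resolve_left (hab i)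
    have h6 := hv c i j g
    rw [h5, map_zero, dif_pos g.2] at h6
    exact h6.symm
  -- This reads k m (2N+1)^(2r) ≤ m² (2(N+d)+1)^(2r); one factor m cancels.
  have hcard := card_le_of_injective K Φ hΦ
  simp only [Fintype.card_prod, Fintype.card_fin, Fintype.card_coe, card_latticeBox] at hcard
  refine Nat.le_of_mul_le_mul_left ?_ hm
  calc m * (k * (2 * N + 1) ^ (2 * r)) = k * (m * (2 * N + 1) ^ (2 * r)) := by ring
    _ ≤ _ := hcard

theorem rightGoldieRank_matrix {K : Type*} [Field K] {q : Kˣ} {r : ℕ}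
    {β : ((Fin r → ℤ) × (Fin r → ℤ)) →+ ((Fin r → ℤ) × (Fin r → ℤ)) →+ ℤ} {m : ℕ} (hm : 0 < m) :
    rightGoldieRank (Matrix (Fin m) (Fin m) (TwistedAlgebra K q β)) = m := by
  have hsurj := Function.surjective_id (α := Matrix (Fin m) (Fin m) (TwistedAlgebra K q β))
  refine le_antisymm (iSup₂_le fun k hk => ?_) (le_iSup₂_of_le m ?_ le_rfl)
  · obtain ⟨s, hs0, hs⟩ := (exists_iSupIndep_iff_of_surjective (f := RingHom.id _) hsurj k).1 hk
    exact_mod_cast le_of_independent_matrix hm s hs0 hs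
  · refine (exists_iSupIndep_iff_of_surjective (f := RingHom.id _) hsurj m).2
      -- The right ideals generated by the diagonal matrix units consist of matrices with a single
      -- nonzero row, and the rows are independent.
      ⟨fun i => Matrix.single i i 1, fun i h => ?_, fun t ht i => ?_⟩
    · have := congrFun (congrFun h i) i
      simp at this
    · rw [RingHom.id_apply] at ht ⊢
      ext a j
      by_cases ha : a = i
      · subst ha
        have h1 := congrFun (congrFun ht a) j
        rw [Matrix.sum_apply, Finset.sum_eq_single a] at h1
        · exact h1
        · intro i' _ hi'
          rw [Matrix.single_mul_apply_of_ne _ _ _ _ _ hi'.symm]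
        · simp
      · rw [Matrix.single_mul_apply_of_ne _ _ _ _ _ ha, Matrix.zero_apply]

/-! ### Universal properties -/

namespace QuantumTorus

variable {K : Type*} [Field K] {n : ℕ} {Q : Fin n → Fin n → Kˣ} {B : Type*} [Ring B] [Algebra K B]

theorem z_mul_zInv (i : Fin n) : z Q i * zInv Q i = 1 := by
  have h := mk_rel Q (.mul_inv i)
  rwa [map_mul, map_one] at h

theorem zInv_mul_z (i : Fin n) : zInv Q i * z Q i = 1 := by
  have h := mk_rel Q (.inv_mul i)
  rwa [map_mul, map_one] at h

theorem z_mul_z {i j : Fin n} (h : j < i) : z Q i * z Q j = (Q i j : K) • (z Q j * z Q i) := by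
  have h := mk_rel Q (.comm i j h)
  rwa [map_mul, map_smul, map_mul] at h

/-- The generator `z_i` as a unit. -/
noncomputable def zUnit (Q : Fin n → Fin n → Kˣ) (i : Fin n) : (QuantumTorus Q)ˣ :=
  ⟨z Q i, zInv Q i, z_mul_zInv i, zInv_mul_z i⟩

/-- The homomorphism given by units satisfying the relations of the quantum torus. -/
noncomputable def lift (g : Fin n → Bˣ)
    (hg : ∀ i j, j < i → (g i : B) * g j = (Q i j : K) • ((g j : B) * g i)) :
    QuantumTorus Q →ₐ[K] B :=
  RingQuot.liftAlgHom K (s := QuantumTorusRel Q)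
    ⟨FreeAlgebra.lift K (Sum.elim (fun i => (g i : B)) fun i => (↑(g i)⁻¹ : B)), by
      intro f f' h
      cases h with
      | mul_inv i => simp
      | inv_mul i => simp
      | comm i j h => simpa using hg i j h⟩

theorem lift_z (g : Fin n → Bˣ) (hg) (i : Fin n) : lift (Q := Q) g hg (z Q i) = g i := by
  refine (RingQuot.liftAlgHom_mkAlgHom_apply K _ _ _).trans ?_
  simp

theorem lift_zInv (g : Fin n → Bˣ) (hg) (i : Fin n) :
    lift (Q := Q) g hg (zInv Q i) = (↑(g i)⁻¹ : B) := by
  refine (RingQuot.liftAlgHom_mkAlgHom_apply K _ _ _).trans ?_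
  simp

/-- The universal property yields a homomorphism into N; followed by the inclusion it fixes the
generators, so it is the identity. -/
theorem eq_top_of_mem (N : Subalgebra K (QuantumTorus Q)) (h : ∀ i, z Q i ∈ N)
    (h' : ∀ i, zInv Q i ∈ N) : N = ⊤ := by
  have h1 : N.val.comp (lift (B := N)
      (fun i => ⟨⟨z Q i, h i⟩, ⟨zInv Q i, h' i⟩, Subtype.ext (z_mul_zInv i),
        Subtype.ext (zInv_mul_z i)⟩) fun i j hij => Subtype.ext (z_mul_z hij)) =
      AlgHom.id K _ := by
    refine hom_ext Q (fun i => ?_) (fun i => ?_)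
    · rw [AlgHom.comp_apply, lift_z]
      rfl
    · rw [AlgHom.comp_apply, lift_zInv]
      rfl
  refine eq_top_iff.2 fun a _ => ?_
  have h2 := DFunLike.congr_fun h1 a
  rw [AlgHom.id_apply] at h2
  rw [← h2]
  exact Subtype.property _

/-- An intertwining relation holds on the quantum torus if it holds for the generators. -/
theorem mul_eq_of_z (φ ψ : QuantumTorus Q →ₐ[K] B) (s : B)
    (h : ∀ i, s * φ (z Q i) = ψ (z Q i) * s) (a : QuantumTorus Q) : s * φ a = ψ a * s := by
  let N : Subalgebra K (QuantumTorus Q) :=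
    { carrier := {a | s * φ a = ψ a * s}
      mul_mem' := fun {a b} ha hb => by
        rw [Set.mem_ofPred_eq] at *
        rw [map_mul, map_mul, ← mul_assoc, ha, mul_assoc, hb, mul_assoc]
      add_mem' := fun {a b} ha hb => by
        rw [Set.mem_ofPred_eq] at *
        rw [map_add, map_add, mul_add, ha, hb, add_mul]
      algebraMap_mem' := fun c => by
        rw [Set.mem_ofPred_eq, AlgHom.commutes, AlgHom.commutes, Algebra.commutes] }
  have hN : N = ⊤ := by
    refine eq_top_of_mem N h fun i => ?_
    change s * φ (zInv Q i) = ψ (zInv Q i) * s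
    calc s * φ (zInv Q i) = ψ (zInv Q i) * (ψ (z Q i) * s) * φ (zInv Q i) := by
          rw [← mul_assoc, ← map_mul, zInv_mul_z, map_one, one_mul]
      _ = ψ (zInv Q i) * s := by
          rw [← h i, mul_assoc, mul_assoc, ← map_mul, z_mul_zInv, map_one, mul_one]
  exact (hN ▸ Algebra.mem_top : a ∈ N)

end QuantumTorus

namespace TwoGen

variable {K : Type*} [Field K] {A : Type*} [Ring A] [Algebra K A] {B : Type*} [Ring B]
  [Algebra K B]

/-- The homomorphism from the free algebra with given values on `A`, `x` and `y`. -/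
noncomputable def lift (φ : A →ₐ[K] B) (X Y : B) : FreeAlgebra K (TwoGen A) →ₐ[K] B :=
  FreeAlgebra.lift K fun s => TwoGen.rec (fun a => φ a) X Y s

@[simp] theorem lift_coef (φ : A →ₐ[K] B) (X Y : B) (a : A) :
    lift φ X Y (FreeAlgebra.ι K (coef a)) = φ a := by simp [lift]

@[simp] theorem lift_x (φ : A →ₐ[K] B) (X Y : B) :
    lift φ X Y (FreeAlgebra.ι K x) = X := by simp [lift]

@[simp] theorem lift_y (φ : A →ₐ[K] B) (X Y : B) :
    lift φ X Y (FreeAlgebra.ι K y) = Y := by simp [lift]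

theorem lift_rel (φ : A →ₐ[K] B) (X Y : B) {f g : FreeAlgebra K (TwoGen A)}
    (h : CoefRel K A f g) : lift φ X Y f = lift φ X Y g := by
  cases h with
  | add a b => simp
  | mul a b => simp
  | scalar c => simp

/-- The homomorphism on `A` given by a map compatible with the relations. -/
noncomputable def coefHom (f : FreeAlgebra K (TwoGen A) →ₐ[K] B)
    (h : ∀ s t, CoefRel K A s t → f s = f t) : A →ₐ[K] B :=
  AlgHom.ofLinearMap
    { toFun := fun a => f (FreeAlgebra.ι K (coef a))
      map_add' := fun a b => by rw [h _ _ (.add a b), map_add]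
      map_smul' := fun c a => by
        rw [Algebra.smul_def, h _ _ (.mul _ a), map_mul, h _ _ (.scalar c), AlgHom.commutes,
          RingHom.id_apply, Algebra.smul_def] }
    (by
      have := h _ _ (.scalar 1)
      rw [map_one, map_one, map_one] at this
      exact this)
    fun a b => by
      change f _ = f _ * f _
      rw [h _ _ (.mul a b), map_mul]

end TwoGen

namespace Ambiskew

variable {K : Type*} [Field K] {A : Type*} [Ring A] [Algebra K A]
  (α : A ≃ₐ[K] A) (v : A) (ρ : Kˣ) {B : Type*} [Ring B] [Algebra K B]

/-- The canonical map from the free algebra. -/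
noncomputable def mk : FreeAlgebra K (TwoGen A) →ₐ[K] Ambiskew α v ρ :=
  RingQuot.mkAlgHom K (TwoGen.AmbiskewRel α v ρ)

theorem mk_rel {f g : FreeAlgebra K (TwoGen A)} (h : TwoGen.AmbiskewRel α v ρ f g) :
    mk α v ρ f = mk α v ρ g :=
  RingQuot.mkAlgHom_rel K h

/-- The homomorphism from the coefficient algebra. -/
noncomputable def coef : A →ₐ[K] Ambiskew α v ρ :=
  TwoGen.coefHom (mk α v ρ) fun _ _ h => mk_rel α v ρ (.coef h)

/-- The generator `x`. -/
noncomputable def x : Ambiskew α v ρ := mk α v ρ (FreeAlgebra.ι K TwoGen.x)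

/-- The generator `y`. -/
noncomputable def y : Ambiskew α v ρ := mk α v ρ (FreeAlgebra.ι K TwoGen.y)

theorem y_mul_coef (a : A) : y α v ρ * coef α v ρ a = coef α v ρ (α a) * y α v ρ := by
  have h := mk_rel α v ρ (.y_coef a)
  rwa [map_mul, map_mul] at h

theorem x_mul_coef (a : A) : x α v ρ * coef α v ρ (α a) = coef α v ρ a * x α v ρ := by
  have h := mk_rel α v ρ (.x_coef (α a))
  rwa [map_mul, map_mul, AlgEquiv.symm_apply_apply] at h

theorem x_mul_y : x α v ρ * y α v ρ = (ρ : K) • (y α v ρ * x α v ρ) + coef α v ρ v := by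
  have h := mk_rel α v ρ .x_y
  rwa [map_mul, map_add, map_smul, map_mul] at h

theorem eq_top_of_mem (N : Subalgebra K (Ambiskew α v ρ)) (hc : ∀ a, coef α v ρ a ∈ N)
    (hx : x α v ρ ∈ N) (hy : y α v ρ ∈ N) : N = ⊤ := by
  suffices h : ∀ f, mk α v ρ f ∈ N by
    refine eq_top_iff.2 fun s _ => ?_
    obtain ⟨f, rfl⟩ := RingQuot.mkAlgHom_surjective K (TwoGen.AmbiskewRel α v ρ) s
    exact h f
  intro f
  induction f using FreeAlgebra.induction with
  | grade0 c =>
    rw [AlgHom.commutes]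
    exact N.algebraMap_mem c
  | grade1 s =>
    cases s with
    | coef a => exact hc a
    | x => exact hx
    | y => exact hy
  | mul f g hf hg => rw [map_mul]; exact N.mul_mem hf hg
  | add f g hf hg => rw [map_add]; exact N.add_mem hf hg

/-- The universal property of the ambiskew polynomial algebra. -/
noncomputable def lift (φ : A →ₐ[K] B) (X Y : B) (hY : ∀ a, Y * φ a = φ (α a) * Y)
    (hX : ∀ a, X * φ (α a) = φ a * X) (hXY : X * Y = (ρ : K) • (Y * X) + φ v) :
    Ambiskew α v ρ →ₐ[K] B :=
  RingQuot.liftAlgHom K (s := TwoGen.AmbiskewRel α v ρ) ⟨TwoGen.lift φ X Y, by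
    intro f g h
    cases h with
    | coef h => exact TwoGen.lift_rel φ X Y h
    | y_coef a => simpa using hY a
    | x_coef a => simpa using hX (α.symm a)
    | x_y => simpa using hXY⟩

section

variable (φ : A →ₐ[K] B) (X Y : B) (hY hX hXY)

theorem lift_coef (a : A) : lift α v ρ φ X Y hY hX hXY (coef α v ρ a) = φ a := by
  refine (RingQuot.liftAlgHom_mkAlgHom_apply K _ _ _).trans ?_
  simp

theorem lift_x : lift α v ρ φ X Y hY hX hXY (x α v ρ) = X := by
  refine (RingQuot.liftAlgHom_mkAlgHom_apply K _ _ _).trans ?_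
  simp

theorem lift_y : lift α v ρ φ X Y hY hX hXY (y α v ρ) = Y := by
  refine (RingQuot.liftAlgHom_mkAlgHom_apply K _ _ _).trans ?_
  simp

end

section Casimir

variable {α v} {u : A} (hv : v = u - α u) (hu : ∀ a, Commute u a)

/-- The Casimir element `x y - u`. -/
noncomputable def casimir (α : A ≃ₐ[K] A) (v u : A) : Ambiskew α v 1 :=
  x α v 1 * y α v 1 - coef α v 1 u

include hv in
theorem y_mul_x : y α v 1 * x α v 1 = casimir α v u + coef α v 1 (α u) := by
  have h := x_mul_y α v 1
  rw [Units.val_one, one_smul] at h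
  rw [casimir, h, hv, map_sub]
  abel

-- Evaluate x y x with both bracketings. The next statement uses y x y in the same way.
include hv in
theorem commute_casimir_x : Commute (casimir α v u) (x α v 1) := by
  have h := y_mul_x hv
  have h1 : x α v 1 * (y α v 1 * x α v 1) =
      casimir α v u * x α v 1 + coef α v 1 u * x α v 1 := by
    rw [← mul_assoc, ← add_mul, casimir, sub_add_cancel]
  rw [h, mul_add, x_mul_coef] at h1
  exact (add_right_cancel h1).symm

include hv in
theorem commute_casimir_y : Commute (casimir α v u) (y α v 1) := by
  have h := y_mul_x hv
  have h1 : y α v 1 * x α v 1 * y α v 1 =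
      y α v 1 * casimir α v u + coef α v 1 (α u) * y α v 1 := by
    rw [mul_assoc, ← y_mul_coef, ← mul_add, casimir, sub_add_cancel]
  rw [h, add_mul] at h1
  exact add_right_cancel h1

include hu in
theorem commute_casimir_coef (a : A) : Commute (casimir α v u) (coef α v 1 a) := by
  refine Commute.sub_left ?_ ((hu a).map (coef α v 1))
  change x α v 1 * y α v 1 * coef α v 1 a = coef α v 1 a * (x α v 1 * y α v 1)
  rw [mul_assoc, y_mul_coef, ← mul_assoc, x_mul_coef, mul_assoc]

end Casimir


end Ambiskew

namespace GWA

variable {K : Type*} [Field K] {A : Type*} [Ring A] [Algebra K A]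
  (α : A ≃ₐ[K] A) (u : A) {B : Type*} [Ring B] [Algebra K B]

theorem coef_algebraMap (c : K) : coef α u (algebraMap K A c) = algebraMap K _ c := by
  have h := mk_rel α u (.coef (.scalar c))
  rwa [AlgHom.commutes] at h

theorem coef_add (a b : A) : coef α u (a + b) = coef α u a + coef α u b := by
  have h := mk_rel α u (.coef (.add a b))
  rwa [map_add] at h

theorem X_mul_Y : X α u * Y α u = coef α u u := by
  have h := mk_rel α u .x_y
  rwa [map_mul] at h

theorem eq_top_of_mem (N : Subalgebra K (GWA α u)) (hc : ∀ a, coef α u a ∈ N)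
    (hx : X α u ∈ N) (hy : Y α u ∈ N) : N = ⊤ := by
  suffices h : ∀ f, mk α u f ∈ N by
    refine eq_top_iff.2 fun s _ => ?_
    obtain ⟨f, rfl⟩ := RingQuot.mkAlgHom_surjective K (TwoGen.GWARel α u) s
    exact h f
  intro f
  induction f using FreeAlgebra.induction with
  | grade0 c =>
    rw [AlgHom.commutes]
    exact N.algebraMap_mem c
  | grade1 s =>
    cases s with
    | coef a => exact hc a
    | x => exact hx
    | y => exact hy
  | mul f g hf hg => rw [map_mul]; exact N.mul_mem hf hg
  | add f g hf hg => rw [map_add]; exact N.add_mem hf hg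

/-- The universal property of the generalized Weyl algebra. -/
noncomputable def lift (φ : A →ₐ[K] B) (X Y : B) (hY : ∀ a, Y * φ a = φ (α a) * Y)
    (hX : ∀ a, X * φ (α a) = φ a * X) (hYX : Y * X = φ (α u)) (hXY : X * Y = φ u) :
    GWA α u →ₐ[K] B :=
  RingQuot.liftAlgHom K (s := TwoGen.GWARel α u) ⟨TwoGen.lift φ X Y, by
    intro f g h
    cases h with
    | coef h => exact TwoGen.lift_rel φ X Y h
    | y_coef a => simpa using hY a
    | x_coef a => simpa using hX (α.symm a)
    | y_x => simpa using hYX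
    | x_y => simpa using hXY⟩

variable (φ : A →ₐ[K] B) (x y : B) (hY hX hYX hXY)

theorem lift_coef (a : A) : lift α u φ x y hY hX hYX hXY (coef α u a) = φ a := by
  refine (RingQuot.liftAlgHom_mkAlgHom_apply K _ _ _).trans ?_
  simp

theorem lift_X : lift α u φ x y hY hX hYX hXY (X α u) = x := by
  refine (RingQuot.liftAlgHom_mkAlgHom_apply K _ _ _).trans ?_
  simp

theorem lift_Y : lift α u φ x y hY hX hYX hXY (Y α u) = y := by
  refine (RingQuot.liftAlgHom_mkAlgHom_apply K _ _ _).trans ?_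
  simp

end GWA

namespace Ambiskew

variable {K : Type*} [Field K] {A : Type*} [Ring A] [Algebra K A] (α : A ≃ₐ[K] A) (v : A)

variable {u : A} (hv : v = u - α u) (lam : K)

theorem toGWA_coef (a : A) : toGWA α u v hv lam (coef α v 1 a) = GWA.coef α _ a :=
  RingQuot.liftAlgHom_mkAlgHom_apply K _ _ _

theorem toGWA_x : toGWA α u v hv lam (x α v 1) = GWA.X α _ :=
  RingQuot.liftAlgHom_mkAlgHom_apply K _ _ _

theorem toGWA_y : toGWA α u v hv lam (y α v 1) = GWA.Y α _ :=
  RingQuot.liftAlgHom_mkAlgHom_apply K _ _ _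

theorem toGWA_surjective : Function.Surjective (toGWA α u v hv lam) := by
  rw [← AlgHom.range_eq_top]
  exact GWA.eq_top_of_mem _ _ _ (fun a => ⟨_, toGWA_coef α v hv lam a⟩)
    ⟨_, toGWA_x α v hv lam⟩ ⟨_, toGWA_y α v hv lam⟩

end Ambiskew

/-! ### The algebra over the quantum torus in `2r + 1` generators -/

namespace TorusExample

variable {K : Type*} [Field K] (r : ℕ) (hp : Odd (2 * r + 1)) (q : Kˣ)

/-- The index of the generator with odd number `2j + 1`. -/
def oddIdx (j : Fin r) : Fin (2 * r + 1) := ⟨2 * j, by omega⟩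

/-- The index of the generator with even number `2j + 2`. -/
def evenIdx (j : Fin r) : Fin (2 * r + 1) := ⟨2 * j + 1, by omega⟩

/-- The index of the last generator. -/
def lastIdx : Fin (2 * r + 1) := ⟨2 * r, by omega⟩

variable {r}

theorem cases_idx {P : Fin (2 * r + 1) → Prop}
    (ho : ∀ j, P (oddIdx r j)) (he : ∀ j, P (evenIdx r j))
    (hl : P (lastIdx r)) (i) : P i := by
  obtain ⟨i, hi⟩ := i
  obtain ⟨k, rfl | rfl⟩ := i.even_or_odd'
  · by_cases hk : k = r
    · subst hk
      exact hl
    · exact ho ⟨k, by omega⟩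
  · exact he ⟨k, by omega⟩

variable {q}

theorem Q_eq (i j : Fin (2 * r + 1)) :
    Q (2 * r + 1) q i j = q ^ (if Odd (i : ℕ) ∧ Even (j : ℕ) then -1 else 0 : ℤ) := by
  have h1 : Even ((i : ℕ) + 1) ↔ Odd (i : ℕ) := by rw [Nat.even_add_one, Nat.not_even_iff_odd]
  have h2 : Odd ((j : ℕ) + 1) ↔ Even (j : ℕ) := by rw [Nat.odd_add_one, Nat.not_odd_iff_even]
  simp only [Q, h1, h2]
  split_ifs <;> simp

theorem qComm_z {i j : Fin (2 * r + 1)} (h : j < i) :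
    QComm q (QuantumTorus.z (Q (2 * r + 1) q) i) (QuantumTorus.z (Q (2 * r + 1) q) j)
      (if Odd (i : ℕ) ∧ Even (j : ℕ) then -1 else 0) := by
  rw [QComm, ← Q_eq]
  exact QuantumTorus.z_mul_z h

theorem commute_z {i j : Fin (2 * r + 1)} (h : Even ((i : ℕ) + j)) :
    Commute (QuantumTorus.z (Q (2 * r + 1) q) i) (QuantumTorus.z (Q (2 * r + 1) q) j) := by
  have h' : Odd (i : ℕ) ↔ ¬ Even (j : ℕ) := by
    rw [Nat.even_add] at h
    rw [← Nat.not_even_iff_odd, h]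
  rcases lt_trichotomy j i with hij | rfl | hij
  · refine QComm.zero_iff.1 ((qComm_z hij).congr ?_)
    rw [if_neg (by tauto)]
  · exact Commute.refl _
  · refine (QComm.zero_iff.1 ((qComm_z hij).congr ?_)).symm
    rw [if_neg]
    rw [← Nat.not_even_iff_odd] at h' ⊢
    tauto

theorem commute_z_of_odd {i j : Fin (2 * r + 1)} (hij : j < i) (h : Odd (j : ℕ)) :
    Commute (QuantumTorus.z (Q (2 * r + 1) q) i) (QuantumTorus.z (Q (2 * r + 1) q) j) := by
  refine QComm.zero_iff.1 ((qComm_z hij).congr ?_)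
  rw [if_neg]
  rw [← Nat.not_even_iff_odd] at h
  tauto

/-- Generators of odd number commute with each other, and q_{pj} = 1 for even j because p is odd. -/
theorem commute_last (a : A (2 * r + 1) q) :
    Commute (QuantumTorus.z (Q (2 * r + 1) q) (lastIdx r)) a := by
  refine QuantumTorus.mul_eq_of_z (AlgHom.id K _) (AlgHom.id K _) _ (fun i => ?_) a
  change Commute _ _
  induction i using cases_idx with
  | ho j => exact commute_z (by simp [lastIdx, oddIdx, Nat.even_add])
  | he j =>
    have hlt : evenIdx r j < lastIdx r := Fin.mk_lt_mk.2 (by omega)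
    exact commute_z_of_odd hlt (by simp [evenIdx])
  | hl => exact Commute.refl _

theorem alpha_z (i : Fin (2 * r + 1)) : alpha (2 * r + 1) q (QuantumTorus.z _ i) =
    ((q ^ (if Even (i : ℕ) then -1 else 0 : ℤ) : Kˣ) : K) • QuantumTorus.z _ i := by
  refine (QuantumTorus.scaleHom_z (Q (2 * r + 1) q) _ _).trans ?_
  have h2 : Odd ((i : ℕ) + 1) ↔ Even (i : ℕ) := by rw [Nat.odd_add_one, Nat.not_odd_iff_even]
  simp only [h2]
  split_ifs <;> simp

theorem u_eq : u (2 * r + 1) hp q = ((q : K) ^ r) • QuantumTorus.zInv _ (lastIdx r) +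
    (q : K) • QuantumTorus.z _ (lastIdx r) := by
  have : (2 * r + 1 - 1) / 2 = r := by omega
  rw [u, this]
  rfl

theorem commute_u (a : A (2 * r + 1) q) : Commute (u (2 * r + 1) hp q) a := by
  rw [u_eq]
  refine Commute.add_left (Commute.smul_left ?_ _) ((commute_last a).smul_left _)
  exact Commute.units_inv_left (u := QuantumTorus.zUnit _ (lastIdx r)) (commute_last a)

theorem alpha_u : alpha (2 * r + 1) q (u (2 * r + 1) hp q) =
    ((q : K) ^ r * q) • QuantumTorus.zInv _ (lastIdx r) + QuantumTorus.z _ (lastIdx r) := by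
  have h := v_eq (2 * r + 1) hp q
  have h2 : (2 * r + 1 - 1) / 2 = r := by omega
  have h1 : v (2 * r + 1) hp q = (1 - (q : K)) • (((q : K) ^ r) • QuantumTorus.zInv _ (lastIdx r)
      - QuantumTorus.z _ (lastIdx r)) := by
    rw [v, h2]
    rfl
  rw [eq_sub_iff_add_eq', ← eq_sub_iff_add_eq] at h
  rw [h, h1, u_eq]
  module

variable (q)

/-- The homomorphism from the quantum torus to `R`. -/
noncomputable abbrev coef : A (2 * r + 1) q →ₐ[K] R (2 * r + 1) hp q :=
  Ambiskew.coef (alpha (2 * r + 1) q) (v (2 * r + 1) hp q) 1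

/-- The generators of the quantum torus as units of `R`. -/
noncomputable def coefUnit (i : Fin (2 * r + 1)) : (R (2 * r + 1) hp q)ˣ :=
  Units.map (coef hp q : A (2 * r + 1) q →* R (2 * r + 1) hp q) (QuantumTorus.zUnit _ i)

theorem val_coefUnit (i : Fin (2 * r + 1)) :
    (coefUnit hp q i : R (2 * r + 1) hp q) = coef hp q (QuantumTorus.z _ i) := rfl

theorem val_inv_coefUnit (i : Fin (2 * r + 1)) :
    (↑(coefUnit hp q i)⁻¹ : R (2 * r + 1) hp q) = coef hp q (QuantumTorus.zInv _ i) := rfl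

theorem qComm_y (i : Fin (2 * r + 1)) :
    QComm q (Ambiskew.y (alpha (2 * r + 1) q) (v (2 * r + 1) hp q) 1)
      (coefUnit hp q i : R (2 * r + 1) hp q) (if Even (i : ℕ) then -1 else 0) := by
  rw [QComm, val_coefUnit, Ambiskew.y_mul_coef, alpha_z, map_smul, smul_mul_assoc]

theorem qComm_x (i : Fin (2 * r + 1)) :
    QComm q (Ambiskew.x (alpha (2 * r + 1) q) (v (2 * r + 1) hp q) 1)
      (coefUnit hp q i : R (2 * r + 1) hp q) (if Even (i : ℕ) then 1 else 0) := by
  have h := Ambiskew.x_mul_coef (alpha (2 * r + 1) q) (v (2 * r + 1) hp q) 1 (QuantumTorus.z _ i)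
  rw [alpha_z, map_smul, mul_smul_comm] at h
  rw [QComm, val_coefUnit, ← h, smul_smul, ← Units.val_mul, ← zpow_add]
  split_ifs <;> simp

/-- The generators of `R`, with the Casimir element. -/
noncomputable def system : AmbiskewSystem q ((q : K) ^ r) r (R (2 * r + 1) hp q) where
  x := Ambiskew.x _ _ _
  y := Ambiskew.y _ _ _
  w := Ambiskew.casimir _ _ (u (2 * r + 1) hp q)
  z := coefUnit hp q (lastIdx r)
  o j := coefUnit hp q (oddIdx r j)
  e j := coefUnit hp q (evenIdx r j)
  x_y := by
    rw [Ambiskew.casimir, val_inv_coefUnit, val_coefUnit, ← map_smul, ← map_smul, ← map_add,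
      ← u_eq hp, sub_add_cancel]
  y_x := by
    rw [Ambiskew.y_mul_x (v_eq (2 * r + 1) hp q), alpha_u, map_add, map_smul]
    rfl
  w_x := Ambiskew.commute_casimir_x (v_eq (2 * r + 1) hp q)
  w_y := Ambiskew.commute_casimir_y (v_eq (2 * r + 1) hp q)
  w_z := Ambiskew.commute_casimir_coef (commute_u hp) _
  w_o _ := Ambiskew.commute_casimir_coef (commute_u hp) _
  w_e _ := Ambiskew.commute_casimir_coef (commute_u hp) _
  z_o j := (commute_last (QuantumTorus.z _ (oddIdx r j))).map (coef hp q)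
  z_e j := (commute_last (QuantumTorus.z _ (evenIdx r j))).map (coef hp q)
  o_o i j := Units.ext ((commute_z (i := oddIdx r i) (j := oddIdx r j)
    (by simp [oddIdx, Nat.even_add])).map (coef hp q))
  e_e i j := Units.ext ((commute_z (i := evenIdx r i) (j := evenIdx r j)
    (by simp [evenIdx, Nat.even_add])).map (coef hp q))
  e_o i j := by
    refine QComm.map (s := QuantumTorus.z _ (evenIdx r i)) (t := QuantumTorus.z _ (oddIdx r j)) ?_
      (coef hp q)
    split_ifs with h
    · refine (qComm_z ?_).congr ?_
      · simp only [evenIdx, oddIdx, Fin.lt_def, Fin.le_def] at h ⊢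
        omega
      · simp [evenIdx, oddIdx]
    · refine QComm.of_commute (commute_z_of_odd ?_ ?_).symm
      · simp only [evenIdx, oddIdx, Fin.lt_def, Fin.le_def] at h ⊢
        omega
      · simp [evenIdx]
  y_z := (qComm_y hp q (lastIdx r)).congr (by simp [lastIdx])
  y_o j := (qComm_y hp q (oddIdx r j)).congr (by simp [oddIdx])
  y_e j := QComm.zero_iff.1 ((qComm_y hp q (evenIdx r j)).congr (by simp [evenIdx]))
  x_z := (qComm_x hp q (lastIdx r)).congr (by simp [lastIdx])
  x_o j := (qComm_x hp q (oddIdx r j)).congr (by simp [oddIdx])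
  x_e j := QComm.zero_iff.1 ((qComm_x hp q (evenIdx r j)).congr (by simp [evenIdx]))

theorem system_generates : (system hp q).Generates := by
  intro N hx hy hz hz' ho ho' he he'
  refine Ambiskew.eq_top_of_mem _ _ _ N (fun a => ?_) hx hy
  have h : N.comap (Ambiskew.coef (alpha (2 * r + 1) q) (v (2 * r + 1) hp q) 1) = ⊤ := by
    refine QuantumTorus.eq_top_of_mem _ (fun i => ?_) (fun i => ?_)
    · induction i using cases_idx with
      | ho j => exact ho j
      | he j => exact he j
      | hl => exact hz
    · induction i using cases_idx with
      | ho j => exact ho' j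
      | he j => exact he' j
      | hl => exact hz'
  exact (h ▸ Algebra.mem_top : a ∈ N.comap _)

end TorusExample

namespace TwistedAlgebra

variable {K : Type*} [Field K] (k : Type*) [CommRing k] [Algebra K k] (q : Kˣ) (n : ℕ)

/-- The quantum torus of rank `2n` over an algebra `k`. -/
abbrev Torus : Type _ :=
  TwistedAlgebra k (Units.map (algebraMap K k : K →* k) q) (torusPairing n)

variable {k n}

theorem qComm_single (g h : (Fin n → ℤ) × (Fin n → ℤ)) (a b : k) :
    QComm q (single g a : Torus k q n) (single h b)
      (torusPairing n g h - torusPairing n h g) := by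
  rw [QComm, single_mul_comm, ← map_zpow, Units.coe_map, MonoidHom.coe_coe, algebraMap_smul]

end TwistedAlgebra

/-! ### Homomorphisms from R to a domain, with prescribed Casimir value. -/

namespace TorusExample

open TwistedAlgebra

variable {K : Type*} [Field K] {r : ℕ} (hp : Odd (2 * r + 1)) (q : Kˣ) {k : Type*} [CommRing k]
  [Algebra K k]

/-- The homomorphism to the torus of rank `2n` scaling the generators by given units. -/
noncomputable def torusHom {n : ℕ} (hn : r ≤ n) (d : Fin (2 * r + 1) → kˣ) :
    A (2 * r + 1) q →ₐ[K] Torus k q n :=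
  QuantumTorus.lift (fun i => unit (torusExponent n i) (d i)) fun i j hij => by
    have h := qComm_single q (torusExponent n i) (torusExponent n j) (d i : k) (d j : k)
    rw [torusPairing_sub n hij, QComm] at h
    rw [val_unit, val_unit, h, Q_eq]
    -- The index j = 2r would need a larger i, and none exists among the generators; so the
    -- truncation in the pairing has no effect here, even for n = r.
    have hj : Odd (i : ℕ) → (j : ℕ) < 2 * n := by
      intro hi
      have := i.2
      rw [Fin.lt_def] at hij
      omega
    congr 4
    simp only [eq_iff_iff]
    tauto

variable {n : ℕ} (hn : r ≤ n) (d : Fin (2 * r + 1) → kˣ)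

theorem torusHom_z (i : Fin (2 * r + 1)) : torusHom q hn d (QuantumTorus.z _ i) =
    single (torusExponent n i) (d i : k) :=
  QuantumTorus.lift_z _ _ i

theorem torusHom_zInv (i : Fin (2 * r + 1)) : torusHom q hn d (QuantumTorus.zInv _ i) =
    (↑(unit (torusExponent n i) (d i) : (Torus k q n)ˣ)⁻¹ : Torus k q n) :=
  QuantumTorus.lift_zInv _ _ i

variable (k) in
/-- The embedding of the quantum torus on `2r + 1` generators. -/
noncomputable abbrev baseHom : A (2 * r + 1) q →ₐ[K] Torus k q (r + 1) :=
  torusHom q r.le_succ fun _ => 1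

variable (k) in
/-- The image of `y` in the torus. -/
noncomputable def yUnit (r : ℕ) (q : Kˣ) : (Torus k q (r + 1))ˣ :=
  unit (torusExponent (r + 1) (2 * r + 1)) 1

theorem yUnit_mul_baseHom (a : A (2 * r + 1) q) :
    (yUnit k r q : Torus k q (r + 1)) * baseHom q k a =
      baseHom q k (alpha (2 * r + 1) q a) * yUnit k r q := by
  refine QuantumTorus.mul_eq_of_z (baseHom q k)
    ((baseHom q k).comp (alpha (2 * r + 1) q).toAlgHom) _ (fun i => ?_) a
  change (single _ _ : Torus k q (r + 1)) * baseHom q k (QuantumTorus.z _ i) =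
    baseHom q k (alpha (2 * r + 1) q (QuantumTorus.z _ i)) * _
  rw [alpha_z, map_smul, torusHom_z, qComm_single, torusPairing_sub (r + 1) i.2, smul_mul_assoc]
  have : (i : ℕ) < 2 * (r + 1) := by omega
  simp [this, yUnit]

variable (c : k)

/-- The image of `x y` in the torus. -/
noncomputable def xyImage : Torus k q (r + 1) :=
  algebraMap k _ c + baseHom q k (u (2 * r + 1) hp q)

/-- The homomorphism from `R` to the torus of rank `2r + 2` with Casimir element `c`. -/
noncomputable def domainHom : R (2 * r + 1) hp q →ₐ[K] Torus k q (r + 1) :=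
  Ambiskew.lift _ _ _ (baseHom q k)
    -- The image of x is forced: x y must be the Casimir value plus u, and y is a unit.
    (xyImage hp q c * (↑(yUnit k r q)⁻¹ : Torus k q (r + 1)))
    (yUnit k r q : Torus k q (r + 1)) (yUnit_mul_baseHom q)
    (fun a => by
      have h : (↑(yUnit k r q)⁻¹ : Torus k q (r + 1)) * baseHom q k (alpha (2 * r + 1) q a) =
          baseHom q k a * (↑(yUnit k r q)⁻¹ : Torus k q (r + 1)) := by
        rw [Units.inv_mul_eq_iff_eq_mul, ← mul_assoc, yUnit_mul_baseHom, Units.mul_inv_cancel_right]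
      have h2 : Commute (xyImage hp q c) (baseHom q k a) :=
        (Algebra.commute_algebraMap_left c _).add_left ((commute_u hp a).map (baseHom q k))
      rw [mul_assoc, h, ← mul_assoc, h2.eq, mul_assoc])
    (by
      rw [Units.val_one, one_smul, Units.inv_mul_cancel_right, v_eq, xyImage, add_mul, mul_add,
        ← mul_assoc, ← mul_assoc, ← Algebra.commutes c (yUnit k r q : Torus k q (r + 1)),
        yUnit_mul_baseHom, Units.mul_inv_cancel_right, Units.mul_inv_cancel_right, map_sub]
      abel)

theorem domainHom_coef (a : A (2 * r + 1) q) :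
    domainHom hp q c (coef hp q a) = baseHom q k a :=
  Ambiskew.lift_coef ..

theorem domainHom_y : domainHom hp q c (system hp q).y = yUnit k r q :=
  Ambiskew.lift_y ..

theorem domainHom_x : domainHom hp q c (system hp q).x =
    xyImage hp q c * (↑(yUnit k r q)⁻¹ : Torus k q (r + 1)) :=
  Ambiskew.lift_x ..

theorem domainHom_w : domainHom hp q c (system hp q).w = algebraMap k _ c := by
  have h : (system hp q).w =
      (system hp q).x * (system hp q).y - coef hp q (u (2 * r + 1) hp q) := rfl
  rw [h, map_sub, map_mul, domainHom_x, domainHom_y, domainHom_coef, Units.inv_mul_cancel_right,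
    xyImage, add_sub_cancel_right]

theorem aeval_domainHom_w (g : K[X]) : aeval (domainHom hp q c (system hp q).w) g =
    algebraMap k _ (aeval c g) := by
  rw [domainHom_w]
  exact aeval_algebraMap_apply _ _ _

theorem torusPairing_torusExponent_self (n i : ℕ) :
    torusPairing n (torusExponent n i) (torusExponent n i) = 0 := by
  rw [torusPairing_torusExponent, if_neg]
  rintro ⟨h1, h2, -⟩
  exact (Nat.not_even_iff_odd.2 h1) h2

theorem domainHom_z_zpow (i : ℤ) :
    (((((system hp q).map (domainHom hp q c)).z ^ i : (Torus k q (r + 1))ˣ)) : Torus k q (r + 1)) =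
      single (i • torusExponent (r + 1) (2 * r)) 1 := by
  have h : ((system hp q).map (domainHom hp q c)).z =
      (unit (torusExponent (r + 1) (2 * r)) 1 : (Torus k q (r + 1))ˣ) := by
    refine Units.ext ?_
    refine (domainHom_coef hp q c (QuantumTorus.z _ (lastIdx r))).trans ?_
    rw [torusHom_z]
    rfl
  rw [h, unit_zpow _ (torusPairing_torusExponent_self _ _), val_unit, Units.val_one]

theorem smul_torusExponent_injective (r : ℕ) :
    Function.Injective fun i : ℤ => i • torusExponent (r + 1) (2 * r) := by
  intro i j h
  have h1 := congrFun (congrArg Prod.fst h) (Fin.last r)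
  simpa [torusExponent] using h1

/-- The powers of z go to distinct basis elements of the torus, while polynomials in w go to scalars
of k; compare coefficients. -/
theorem zIndependent_domainHom : ((system hp q).map (domainHom hp q c)).ZIndependent := by
  classical
  intro f hf i
  have h := congrArg (TwistedAlgebra.coeff (i • torusExponent (r + 1) (2 * r))) hf
  change aeval (domainHom hp q c (system hp q).w) (f.coeff i) = 0
  rw [AmbiskewSystem.coefHom_eq_sum, Finsupp.sum, map_sum, map_zero] at h
  rw [aeval_domainHom_w]
  have h2 : ∀ j, TwistedAlgebra.coeff (i • torusExponent (r + 1) (2 * r))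
      (aeval (domainHom hp q c (system hp q).w) (f.coeff j) *
        (((((system hp q).map (domainHom hp q c)).z ^ j : (Torus k q (r + 1))ˣ)) :
          Torus k q (r + 1))) = if j = i then aeval c (f.coeff j) else 0 := by
    intro j
    rw [domainHom_z_zpow, aeval_domainHom_w, ← Algebra.smul_def, map_smul, coeff_single]
    simp only [(smul_torusExponent_injective r).eq_iff]
    simp
  have h3 : aeval c (f.coeff i) = 0 := by
    replace h := (Finset.sum_congr rfl fun j _ => (h2 j).symm).trans h
    rw [Finset.sum_ite_eq'] at h
    by_cases hi : i ∈ f.coeff.support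
    · rwa [if_pos hi] at h
    · rw [Finsupp.notMem_support_iff.1 hi, map_zero]
  rw [h3, map_zero]

variable [Nontrivial k]

theorem domainHom_y_ne_zero : domainHom hp q c (system hp q).y ≠ 0 := by
  rw [domainHom_y]
  exact Units.ne_zero _

/-- Up to a unit this is c + q^r z⁻¹ + q z, and the three terms sit at different exponents; the
coefficient at z is q ≠ 0, whatever c is. -/
theorem domainHom_x_ne_zero : domainHom hp q c (system hp q).x ≠ 0 := by
  rw [domainHom_x, Ne, Units.mul_left_eq_zero, xyImage, u_eq, map_add, map_smul, map_smul,
    torusHom_z, torusHom_zInv]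
  intro h
  have hinj {i j : ℤ} := (smul_torusExponent_injective r).ne (a₁ := i) (a₂ := j)
  have h0 : (0 : (Fin (r + 1) → ℤ) × (Fin (r + 1) → ℤ)) ≠ torusExponent (r + 1) (2 * r) := by
    simpa using hinj (zero_ne_one (α := ℤ))
  have h1 : -torusExponent (r + 1) (2 * r) ≠ torusExponent (r + 1) (2 * r) := by
    simpa using hinj (show (-1 : ℤ) ≠ 1 by decide)
  have h2 := congrArg (TwistedAlgebra.coeff (torusExponent (r + 1) (2 * r))) h
  rw [Algebra.algebraMap_eq_smul_one, one_def, TwistedAlgebra.smul_single,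
    show (lastIdx r : ℕ) = 2 * r from rfl, map_add, map_add, coeff_single, if_neg h0,
    TwistedAlgebra.smul_single, coeff_single_self] at h2
  change _ + (TwistedAlgebra.coeff _ (_ • single (-torusExponent (r + 1) (2 * r)) _) + _) = _ at h2
  rw [TwistedAlgebra.smul_single, coeff_single, if_neg h1] at h2
  simp [Algebra.smul_def] at h2

end TorusExample

/-! ### Matrix representations of generalized Weyl algebras -/

section WeightedShift

variable {K : Type*} [Field K] (T : Type*) [Ring T] [Algebra K T] (m : ℕ)

/-- The matrix with ones above the diagonal. -/
def upShift : Matrix (Fin m) (Fin m) T := Matrix.of fun i j => if (j : ℕ) = i + 1 then 1 else 0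

/-- The matrix with the scalars `d 1, …, d (m - 1)` below the diagonal. -/
def downShift (d : ℕ → K) : Matrix (Fin m) (Fin m) T :=
  Matrix.of fun i j => if (i : ℕ) = j + 1 then algebraMap K T (d i) else 0

variable {T m}

theorem upShift_apply (i j : Fin m) : upShift T m i j = if (j : ℕ) = i + 1 then 1 else 0 := rfl

theorem downShift_apply (d : ℕ → K) (i j : Fin m) :
    downShift T m d i j = if (i : ℕ) = j + 1 then algebraMap K T (d i) else 0 := rfl

theorem upShift_pow_apply (n : ℕ) (i j : Fin m) :
    (upShift T m ^ n) i j = if (j : ℕ) = i + n then 1 else 0 := by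
  induction n generalizing i j with
  | zero => simp [Matrix.one_apply, Fin.ext_iff, eq_comm]
  | succ n ih =>
    rw [pow_succ', Matrix.mul_apply]
    simp only [ih, upShift_apply, ite_mul, one_mul, zero_mul]
    by_cases h : (i : ℕ) + 1 < m
    · rw [Finset.sum_eq_single ⟨i + 1, h⟩]
      · simp only [if_true, add_assoc, add_comm 1 n]
      · intro k _ hk
        exact if_neg fun h => hk (Fin.ext h)
      · simp
    · have := j.2
      rw [if_neg (by omega)]
      refine Finset.sum_eq_zero fun k _ => if_neg ?_
      have := k.2
      omega

theorem downShift_pow_apply (d : ℕ → K) (n : ℕ) (i j : Fin m) : (downShift T m d ^ n) i j =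
    if (i : ℕ) = j + n then algebraMap K T (∏ l ∈ Finset.Ico ((j : ℕ) + 1) (i + 1), d l)
    else 0 := by
  induction n generalizing i j with
  | zero =>
    by_cases h : i = j
    · subst h; simp
    · simp [h, Fin.ext_iff.not.1 h]
  | succ n ih =>
    rw [pow_succ', Matrix.mul_apply]
    simp only [ih, downShift_apply, ite_mul, zero_mul]
    by_cases h : 0 < (i : ℕ)
    · have hi : (i : ℕ) - 1 < m := by omega
      have e : (i : ℕ) - 1 + 1 = i := Nat.sub_add_cancel h
      rw [Finset.sum_eq_single ⟨i - 1, hi⟩]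
      · simp only [e, if_true]
        by_cases h1 : (i : ℕ) = j + (n + 1)
        · have h2 : (i : ℕ) - 1 = j + n := by omega
          rw [if_pos h2, if_pos h1, ← map_mul, Finset.prod_Ico_succ_top (by omega), mul_comm]
        · have h2 : ¬ (i : ℕ) - 1 = j + n := by omega
          rw [if_neg h2, if_neg h1, mul_zero]
      · intro k _ hk
        refine if_neg fun h => hk (Fin.ext ?_)
        simp
        omega
      · simp
    · rw [if_neg (by omega)]
      exact Finset.sum_eq_zero fun k _ => if_neg (by omega)

/-- The last row of the upper shift is zero, which agrees with the diagonal formula only because d m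
= 0. For the product in the other order the first row requires d 0 = 0. -/
theorem upShift_mul_downShift {d : ℕ → K} (hd : d m = 0) :
    upShift T m * downShift T m d =
      Matrix.diagonal fun i : Fin m => algebraMap K T (d (i + 1)) := by
  ext i j
  rw [Matrix.mul_apply, Matrix.diagonal_apply]
  simp only [upShift_apply, downShift_apply, ite_mul, one_mul, zero_mul]
  by_cases h : (i : ℕ) + 1 < m
  · rw [Finset.sum_eq_single ⟨i + 1, h⟩]
    · simp [Fin.ext_iff]
    · intro k _ hk
      exact if_neg fun h => hk (Fin.ext h)
    · simp
  · have hm : (i : ℕ) + 1 = m := by omega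
    rw [hm, hd, map_zero, ite_self]
    refine Finset.sum_eq_zero fun k _ => if_neg ?_
    have := k.2
    omega

theorem downShift_mul_upShift {d : ℕ → K} (hd : d 0 = 0) :
    downShift T m d * upShift T m = Matrix.diagonal fun i : Fin m => algebraMap K T (d i) := by
  ext i j
  rw [Matrix.mul_apply, Matrix.diagonal_apply]
  simp only [upShift_apply, downShift_apply, mul_ite, mul_one, mul_zero]
  by_cases h : 0 < (i : ℕ)
  · have e : (i : ℕ) - 1 + 1 = i := Nat.sub_add_cancel h
    rw [Finset.sum_eq_single ⟨i - 1, by omega⟩]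
    · simp only [e, if_true, Fin.ext_iff, @eq_comm _ (i : ℕ)]
    · intro k _ hk
      split_ifs with h1 h2
      · exact absurd (Fin.ext (by simp; omega)) hk
      · rfl
      · rfl
    · simp
  · have hm : (i : ℕ) = 0 := by omega
    rw [hm, hd, map_zero, ite_self]
    refine Finset.sum_eq_zero fun k _ => ?_
    rw [if_neg (Nat.succ_ne_zero _).symm, ite_self]

end WeightedShift

namespace GWA

variable {K : Type*} [Field K] {A : Type*} [Ring A] [Algebra K A] {T : Type*} [Ring T] [Algebra K T]
  (α : A ≃ₐ[K] A) (χ : A →ₐ[K] T) (m : ℕ)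

/-- The homomorphism to diagonal matrices with entries `χ (α ^ ℓ a)`. -/
def diagHom : A →ₐ[K] Matrix (Fin m) (Fin m) T :=
  (Matrix.diagonalAlgHom K).comp
    (AlgHom.pi fun ℓ : Fin m => χ.comp ((α ^ (ℓ : ℕ) : A ≃ₐ[K] A) : A →ₐ[K] A))

theorem diagHom_apply (a : A) :
    diagHom α χ m a = Matrix.diagonal fun ℓ : Fin m => χ ((α ^ (ℓ : ℕ)) a) := rfl

theorem pow_succ_apply (ℓ : ℕ) (a : A) : (α ^ (ℓ + 1)) a = (α ^ ℓ) (α a) := by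
  rw [pow_succ, AlgEquiv.mul_apply]

variable {u : A} {d : ℕ → K} (hd : ∀ ℓ : ℕ, χ ((α ^ ℓ) u) = algebraMap K T (d ℓ)) (h0 : d 0 = 0)
  (hm : d m = 0)

/-- The representation of a generalized Weyl algebra by matrices of size `m`. -/
noncomputable def matrixHom : GWA α u →ₐ[K] Matrix (Fin m) (Fin m) T :=
  lift α u (diagHom α χ m) (downShift T m d) (upShift T m)
    (fun a => by
      ext i j
      rw [diagHom_apply, diagHom_apply, Matrix.mul_diagonal, Matrix.diagonal_mul]
      simp only [upShift_apply, ite_mul, one_mul, zero_mul, mul_ite, mul_one, mul_zero]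
      refine ite_congr rfl (fun h => ?_) fun _ => rfl
      rw [h, pow_succ_apply])
    (fun a => by
      ext i j
      rw [diagHom_apply, diagHom_apply, Matrix.mul_diagonal, Matrix.diagonal_mul]
      simp only [downShift_apply, ite_mul, zero_mul, mul_ite, mul_zero]
      refine ite_congr rfl (fun h => ?_) fun _ => rfl
      rw [Algebra.commutes, ← pow_succ_apply, h])
    (by
      rw [upShift_mul_downShift hm, diagHom_apply]
      congr 1
      funext i
      rw [← pow_succ_apply, hd])
    (by
      rw [downShift_mul_upShift h0, diagHom_apply]
      simp only [hd])

theorem matrixHom_coef (a : A) : matrixHom α χ m hd h0 hm (coef α u a) = diagHom α χ m a :=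
  lift_coef ..

theorem matrixHom_X : matrixHom α χ m hd h0 hm (X α u) = downShift T m d := lift_X ..

theorem matrixHom_Y : matrixHom α χ m hd h0 hm (Y α u) = upShift T m := lift_Y ..

/-- The ideal `J(I)` is killed by the matrix representation if `I` is killed by `χ`. -/
theorem matrixHom_eq_zero_of_mem_J {I : TwoSidedIdeal A} (hI : ∀ a ∈ I, χ a = 0) {w : GWA α u}
    (hw : w ∈ J α u m I) : matrixHom α χ m hd h0 hm w = 0 := by
  have h : J α u m I ≤ TwoSidedIdeal.ker (matrixHom α χ m hd h0 hm) := by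
    refine TwoSidedIdeal.span_le.2 ?_
    rintro _ (⟨n, a, ha, rfl⟩ | ⟨n, a, ha, rfl⟩)
    · rw [SetLike.mem_coe, TwoSidedIdeal.mem_ker, map_mul, map_pow, matrixHom_coef, matrixHom_Y]
      ext i j
      rw [diagHom_apply, Matrix.diagonal_mul, upShift_pow_apply, Matrix.zero_apply]
      split_ifs with hj
      · rw [hI _ (ha i (by omega)), zero_mul]
      · rw [mul_zero]
    · rw [SetLike.mem_coe, TwoSidedIdeal.mem_ker, map_mul, map_pow, matrixHom_coef, matrixHom_X]
      ext i j
      rw [diagHom_apply, Matrix.diagonal_mul, downShift_pow_apply, Matrix.zero_apply]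
      split_ifs with hj
      · rw [hI _ (ha i (by omega) i.2), zero_mul]
      · rw [mul_zero]
  exact (TwoSidedIdeal.mem_ker _).1 (h hw)

variable {ρ : ℕ → K} {z : A} (hz : ∀ ℓ : ℕ, χ ((α ^ ℓ) z) = algebraMap K T (ρ ℓ))

include hz in
theorem diagHom_aeval (f : K[X]) :
    diagHom α χ m (aeval z f) = Matrix.diagonal fun ℓ : Fin m => algebraMap K T (f.eval (ρ ℓ)) := by
  rw [diagHom_apply]
  congr 1
  funext ℓ
  have h := aeval_algHom_apply (χ.comp ((α ^ (ℓ : ℕ) : A ≃ₐ[K] A) : A →ₐ[K] A)) z f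
  refine h.symm.trans ?_
  refine (congrArg (fun s => aeval s f) (hz ℓ)).trans ?_
  rw [aeval_algebraMap_apply, coe_aeval_eq_eval]

include hz in
/-- The matrix representation is surjective if `χ` is surjective, `z` separates the weights and the
weights of `u` do not vanish. -/
theorem matrixHom_surjective (hχ : Function.Surjective χ) (hρ : Function.Injective ρ)
    (hd0 : ∀ ℓ, 0 < ℓ → ℓ < m → d ℓ ≠ 0) :
    Function.Surjective (matrixHom α χ m hd h0 hm) := by
  set N := (matrixHom α χ m hd h0 hm).range with hN
  have hD : ∀ a, diagHom α χ m a ∈ N := fun a => ⟨_, matrixHom_coef α χ m hd h0 hm a⟩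
  have hX : downShift T m d ∈ N := ⟨_, matrixHom_X α χ m hd h0 hm⟩
  have hY : upShift T m ∈ N := ⟨_, matrixHom_Y α χ m hd h0 hm⟩
  -- The z-weights are distinct, so a Lagrange polynomial in z is the i-th diagonal idempotent;
  -- multiplying by the image of an α^i-translated preimage of t puts t in that place.
  have h1 : ∀ (i : Fin m) (t : T), Matrix.single i i t ∈ N := by
    intro i t
    obtain ⟨a, ha⟩ := hχ t
    have h2 := N.mul_mem (hD (aeval z (Lagrange.basis Finset.univ (fun j : Fin m => ρ j) i)))
      (hD ((α ^ (i : ℕ)).symm a))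
    convert h2 using 1
    have hinj : Set.InjOn (fun j : Fin m => ρ j) (Finset.univ : Finset (Fin m)) :=
      fun j _ k _ h => Fin.ext (hρ h)
    rw [diagHom_aeval α χ m hz, diagHom_apply, Matrix.diagonal_mul_diagonal,
      ← Matrix.diagonal_single]
    congr 1
    funext j
    by_cases hj : j = i
    · subst hj
      have h3 : eval (ρ j) (Lagrange.basis Finset.univ (fun j : Fin m => ρ j) j) = 1 :=
        Lagrange.eval_basis_self hinj (Finset.mem_univ j)
      rw [h3, map_one, one_mul, Pi.single_eq_same,
        AlgEquiv.apply_symm_apply, ha]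
    · have h3 : eval (ρ j) (Lagrange.basis Finset.univ (fun j : Fin m => ρ j) i) = 0 :=
        Lagrange.eval_basis_of_ne (v := fun j : Fin m => ρ j) (Ne.symm hj) (Finset.mem_univ j)
      rw [h3, map_zero, zero_mul,
        Pi.single_eq_of_ne hj]
  have h2 : ∀ (i j : Fin m) (t : T), Matrix.single i j t ∈ N := by
    intro i j t
    rcases le_total (i : ℕ) j with hij | hij
    · have h3 := N.mul_mem (h1 i t) (N.mul_mem (N.pow_mem hY (j - i)) (h1 j 1))
      rwa [← mul_assoc, Matrix.single_mul_mul_single, upShift_pow_apply,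
        if_pos (Nat.add_sub_cancel' hij).symm, mul_one, mul_one] at h3
    -- Below the diagonal, the power of X has this product of weights as its entry. The indices lie
    -- strictly between 0 and m, so it is nonzero and can be divided out.
    · set c := ∏ l ∈ Finset.Ico ((j : ℕ) + 1) (i + 1), d l with hc
      have hc0 : c ≠ 0 := Finset.prod_ne_zero_iff.2 fun l hl => by
        rw [Finset.mem_Ico] at hl
        exact hd0 l (by omega) (by omega)
      have h3 := N.mul_mem (h1 i (c⁻¹ • t)) (N.mul_mem (N.pow_mem hX (i - j)) (h1 j 1))
      rwa [← mul_assoc, Matrix.single_mul_mul_single, downShift_pow_apply,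
        if_pos (Nat.add_sub_cancel' hij).symm, mul_one, ← hc, ← Algebra.commutes,
        ← Algebra.smul_def, smul_inv_smul₀ hc0] at h3
  intro M
  have h3 : M ∈ N := by
    rw [Matrix.matrix_eq_sum_single M]
    exact N.sum_mem fun i _ => N.sum_mem fun j _ => h2 i j _
  exact h3

end GWA

/-! ### The matrix representation of R and its kernel. -/

namespace TorusExample

open TwistedAlgebra

variable {K : Type*} [Field K] {r : ℕ} (hp : Odd (2 * r + 1)) (q : Kˣ) (μ : Kˣ)

/-- The homomorphism from the quantum torus specializing the last generator to `μ`. -/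
noncomputable def specialize (r : ℕ) (q μ : Kˣ) : A (2 * r + 1) q →ₐ[K] Torus K q r :=
  torusHom q le_rfl fun i => if (i : ℕ) = 2 * r then μ else 1

theorem specialize_z_last :
    specialize r q μ (QuantumTorus.z _ (lastIdx r)) = algebraMap K _ (μ : K) := by
  have h : torusExponent r (2 * r) = 0 := by
    have : ∀ k : Fin r, r ≠ k := fun k => by omega
    ext k <;> simp [torusExponent, this]
  rw [specialize, torusHom_z, Algebra.algebraMap_eq_smul_one, one_def, TwistedAlgebra.smul_single,
    show (lastIdx r : ℕ) = 2 * r from rfl, h, if_pos rfl, smul_eq_mul, mul_one]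

theorem specialize_surjective : Function.Surjective (specialize r q μ) := by
  set N := (specialize r q μ).range with hN
  -- Surjectivity becomes a statement about exponents. They form a subgroup because basis elements
  -- multiply up to a nonzero scalar.
  let H : AddSubgroup ((Fin r → ℤ) × (Fin r → ℤ)) :=
    { carrier := {g | (single g 1 : Torus K q r) ∈ N ∧ (single (-g) 1 : Torus K q r) ∈ N}
      zero_mem' := by
        rw [Set.mem_ofPred_eq, neg_zero, and_self]
        exact N.one_mem
      neg_mem' := fun {g} hg => by
        rw [Set.mem_ofPred_eq] at *
        rw [neg_neg]
        exact hg.symm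
      add_mem' := fun {g h} hg hh => by
        rw [Set.mem_ofPred_eq] at *
        have key : ∀ g h, (single g 1 : Torus K q r) ∈ N → (single h 1 : Torus K q r) ∈ N →
            (single (g + h) 1 : Torus K q r) ∈ N := by
          intro g h hg hh
          obtain ⟨c, hc⟩ : ∃ c : Kˣ, (single g 1 : Torus K q r) * single h 1 =
              (c : K) • single (g + h) 1 :=
            ⟨_, by rw [single_mul_single, mul_one, one_mul, ← map_smul, smul_eq_mul, mul_one]⟩
          have h2 := N.smul_mem (hc ▸ N.mul_mem hg hh) (c : K)⁻¹
          rwa [smul_smul, inv_mul_cancel₀ c.ne_zero, one_smul] at h2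
        rw [neg_add]
        exact ⟨key _ _ hg.1 hh.1, key _ _ hg.2 hh.2⟩ }
  have hgen : ∀ i : Fin (2 * r + 1), (i : ℕ) ≠ 2 * r → torusExponent r i ∈ H := by
    intro i hi
    refine ⟨⟨QuantumTorus.z _ i, ?_⟩, ?_⟩
    · refine (torusHom_z q le_rfl _ i).trans ?_
      rw [if_neg hi, Units.val_one]
    · have h1 : (↑(unit (torusExponent r i) 1 : (Torus K q r)ˣ)⁻¹ : Torus K q r) ∈ N := by
        refine ⟨QuantumTorus.zInv _ i, ?_⟩
        refine (torusHom_zInv q le_rfl _ i).trans ?_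
        rw [if_neg hi]
      have h2 : (↑(unit (torusExponent r i) 1 : (Torus K q r)ˣ)⁻¹ : Torus K q r) =
          single (-torusExponent r i) 1 := by
        rw [← zpow_neg_one, unit_zpow _ (torusPairing_torusExponent_self _ _), neg_one_smul]
        rfl
      rwa [h2] at h1
  have hfst : ∀ a : Fin r → ℤ, (a, 0) ∈ H := by
    intro a
    induction a using pi_int_induction with
    | h0 => exact H.zero_mem
    | hadd a b ha hb => simpa using H.add_mem ha hb
    | hneg a ha => simpa using H.neg_mem ha
    | hs i =>
      convert hgen (oddIdx r i) (by simp only [oddIdx]; omega) using 1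
      ext k <;> simp [torusExponent, oddIdx, Pi.single_apply, Fin.ext_iff, eq_comm]
  have hsum : ∀ n (hn : n < r), ((0, fun k => if (k : ℕ) ≤ n then 1 else 0) :
      (Fin r → ℤ) × (Fin r → ℤ)) ∈ H := by
    intro n hn
    convert hgen (evenIdx r ⟨n, hn⟩) (by simp only [evenIdx]; omega) using 1
    have h1 : ∀ k : Fin r, ¬ 2 * n + 1 = 2 * k := fun k => by omega
    have h2 : ∀ k : Fin r, 2 * (k : ℕ) ≤ 2 * n + 1 ↔ (k : ℕ) ≤ n := fun k => by omega
    ext k <;> simp [torusExponent, evenIdx, h1, h2]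
  have hsnd : ∀ b : Fin r → ℤ, (0, b) ∈ H := by
    intro b
    induction b using pi_int_induction with
    | h0 => exact H.zero_mem
    | hadd a b ha hb => simpa using H.add_mem ha hb
    | hneg a ha => simpa using H.neg_mem ha
    | hs i =>
      obtain ⟨n, hn⟩ := i
      cases n with
      | zero =>
        convert hsum 0 hn using 2
        funext k
        simp [Pi.single_apply, Fin.ext_iff]
      | succ n =>
        -- The exponents of the even-numbered generators are partial sums of basis vectors;
        -- consecutive differences recover the basis.
        convert H.sub_mem (hsum (n + 1) hn) (hsum n (by omega)) using 1
        ext k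
        · simp
        · simp only [Pi.single_apply, Fin.ext_iff, Prod.snd_sub, Pi.sub_apply]
          split_ifs <;> first | rfl | omega
  intro s
  change s ∈ N
  induction s using induction_single with
  | zero => exact N.zero_mem
  | add f g hf hg => exact N.add_mem hf hg
  | single g c =>
    have h1 : g ∈ H := by
      have := H.add_mem (hfst g.1) (hsnd g.2)
      simpa using this
    rw [← mul_one c, ← smul_eq_mul, map_smul]
    exact N.smul_mem h1.1 c

theorem alpha_pow_z_last (ℓ : ℕ) : (alpha (2 * r + 1) q ^ ℓ) (QuantumTorus.z _ (lastIdx r)) =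
    ((q ^ (-ℓ : ℤ) : Kˣ) : K) • QuantumTorus.z _ (lastIdx r) := by
  induction ℓ with
  | zero => simp
  | succ ℓ ih =>
    rw [pow_succ, AlgEquiv.mul_apply, alpha_z, if_pos (by simp [lastIdx]), map_smul, ih, smul_smul,
      ← Units.val_mul, ← zpow_add]
    congr 3
    push_cast
    ring

theorem specialize_alpha_pow_z_last (ℓ : ℕ) :
    specialize r q μ ((alpha (2 * r + 1) q ^ ℓ) (QuantumTorus.z _ (lastIdx r))) =
      algebraMap K _ (qRoot q (μ : K) ℓ) := by
  rw [alpha_pow_z_last, map_smul, specialize_z_last, qRoot, map_mul, Algebra.smul_def]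

variable {q μ} {m : ℕ} {lam : K}

/-- The weights of `u + lam`. -/
noncomputable def weight (q μ : Kˣ) (m ℓ : ℕ) : K :=
  q * (qRoot q (μ : K) ℓ)⁻¹ * ((qRoot q (μ : K) ℓ - qRoot q (μ : K) 0) *
    (qRoot q (μ : K) ℓ - qRoot q (μ : K) m))

theorem qRoot_ne_zero (ℓ : ℤ) : qRoot q (μ : K) ℓ ≠ 0 := mul_ne_zero (Units.ne_zero _) μ.ne_zero

theorem weight_zero : weight q μ m 0 = 0 := by simp [weight]

theorem weight_self : weight q μ m m = 0 := by simp [weight]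

theorem weight_ne_zero (hq : ∀ n : ℕ, 0 < n → q ^ n ≠ 1) (ℓ : ℕ) (h0 : 0 < ℓ) (hm : ℓ < m) :
    weight q μ m ℓ ≠ 0 := by
  have hinj := qRoot_injective hq (μ.ne_zero)
  refine mul_ne_zero (mul_ne_zero q.ne_zero (inv_ne_zero (qRoot_ne_zero _)))
    (mul_ne_zero (sub_ne_zero.2 (hinj.ne ?_)) (sub_ne_zero.2 (hinj.ne ?_)))
  · exact_mod_cast h0.ne'
  · exact_mod_cast hm.ne

section

variable (hc : (q : K) ^ r = q * (qRoot q (μ : K) 0 * qRoot q (μ : K) m))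
  (hlam : lam = -((q : K) * (qRoot q (μ : K) 0 + qRoot q (μ : K) m)))

-- With these values of q^r and λ, u + λ factors as q z⁻¹ (z - ρ_0)(z - ρ_m), and α^ℓ followed by
-- the specialization evaluates it at z = ρ_ℓ.
include hc hlam in
theorem specialize_alpha_pow_u (ℓ : ℕ) :
    specialize r q μ ((alpha (2 * r + 1) q ^ ℓ) (u (2 * r + 1) hp q + algebraMap K _ lam)) =
      algebraMap K _ (weight q μ m ℓ) := by
  have h1 := specialize_alpha_pow_z_last q μ (r := r) ℓ
  have h2 : specialize r q μ ((alpha (2 * r + 1) q ^ ℓ) (QuantumTorus.zInv _ (lastIdx r))) =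
      algebraMap K _ (qRoot q (μ : K) ℓ)⁻¹ := by
    have h3 : specialize r q μ ((alpha (2 * r + 1) q ^ ℓ) (QuantumTorus.zInv _ (lastIdx r))) *
        specialize r q μ ((alpha (2 * r + 1) q ^ ℓ) (QuantumTorus.z _ (lastIdx r))) = 1 := by
      rw [← map_mul, ← map_mul, QuantumTorus.zInv_mul_z, map_one, map_one]
    rw [h1] at h3
    have h4 : algebraMap K (Torus K q r) (qRoot q (μ : K) ℓ) *
        algebraMap K _ (qRoot q (μ : K) ℓ)⁻¹ = 1 := by
      rw [← map_mul, mul_inv_cancel₀ (qRoot_ne_zero _), map_one]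
    exact left_inv_eq_right_inv h3 h4
  rw [u_eq, map_add, map_add, map_add, map_add, map_smul, map_smul, map_smul, map_smul, h1, h2,
    AlgEquiv.commutes, AlgHom.commutes, Algebra.smul_def, Algebra.smul_def, ← map_mul, ← map_mul,
    ← map_add, ← map_add, hc, hlam, weight]
  congr 1
  field_simp [qRoot_ne_zero (q := q) (μ := μ) ℓ]
  ring

/-- The ideal attached to a value of the last generator and of the Casimir element. -/
noncomputable def jIdeal (q μ : Kˣ) (lam : K) (m : ℕ) : TwoSidedIdeal (R (2 * r + 1) hp q) :=
  TwoSidedIdeal.comap (Ambiskew.toGWA (alpha (2 * r + 1) q) (u (2 * r + 1) hp q)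
      (v (2 * r + 1) hp q) (v_eq (2 * r + 1) hp q) lam)
    (GWA.J (alpha (2 * r + 1) q) (u (2 * r + 1) hp q + algebraMap K (A (2 * r + 1) q) lam) m
      (TwoSidedIdeal.span {zp (2 * r + 1) hp q - algebraMap K (A (2 * r + 1) q) μ}))

/-- The representation of `R` by matrices over a torus. -/
noncomputable def matrixHom : R (2 * r + 1) hp q →ₐ[K] Matrix (Fin m) (Fin m) (Torus K q r) :=
  (GWA.matrixHom (alpha (2 * r + 1) q) (specialize r q μ) m (specialize_alpha_pow_u hp hc hlam)
    weight_zero weight_self).comp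
      (Ambiskew.toGWA (alpha (2 * r + 1) q) (u (2 * r + 1) hp q) (v (2 * r + 1) hp q)
        (v_eq (2 * r + 1) hp q) lam)

theorem matrixHom_coef (a : A (2 * r + 1) q) : matrixHom hp hc hlam (coef hp q a) =
    GWA.diagHom (alpha (2 * r + 1) q) (specialize r q μ) m a := by
  rw [matrixHom, AlgHom.comp_apply, Ambiskew.toGWA_coef, GWA.matrixHom_coef]

theorem matrixHom_x : matrixHom hp hc hlam (system hp q).x = downShift _ m (weight q μ m) := by
  refine (congrArg _ (Ambiskew.toGWA_x ..)).trans ?_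
  exact GWA.matrixHom_X ..

theorem matrixHom_y : matrixHom hp hc hlam (system hp q).y = upShift _ m := by
  refine (congrArg _ (Ambiskew.toGWA_y ..)).trans ?_
  exact GWA.matrixHom_Y ..

theorem toGWA_w : Ambiskew.toGWA (alpha (2 * r + 1) q) (u (2 * r + 1) hp q) (v (2 * r + 1) hp q)
    (v_eq (2 * r + 1) hp q) lam (system hp q).w = algebraMap K _ lam := by
  have h : (system hp q).w =
      (system hp q).x * (system hp q).y - coef hp q (u (2 * r + 1) hp q) := rfl
  have hx := Ambiskew.toGWA_x (alpha (2 * r + 1) q) _ (v_eq (2 * r + 1) hp q) lam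
  have hy := Ambiskew.toGWA_y (alpha (2 * r + 1) q) _ (v_eq (2 * r + 1) hp q) lam
  rw [h, map_sub, map_mul, Ambiskew.toGWA_coef]
  refine (congrArg₂ (fun a b => a * b - _) hx hy).trans ?_
  rw [GWA.X_mul_Y, GWA.coef_add, GWA.coef_algebraMap, add_sub_cancel_left]

theorem matrixHom_w : matrixHom hp hc hlam (system hp q).w = algebraMap K _ lam := by
  rw [matrixHom, AlgHom.comp_apply, toGWA_w, AlgHom.commutes]

theorem matrixHom_surjective (hq : ∀ n : ℕ, 0 < n → q ^ n ≠ 1) :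
    Function.Surjective (matrixHom hp hc hlam) := by
  rw [matrixHom, AlgHom.coe_comp]
  refine Function.Surjective.comp (GWA.matrixHom_surjective _ _ _ _ _ _
    (specialize_alpha_pow_z_last q μ) (specialize_surjective q μ)
    (fun i j h => ?_) (weight_ne_zero hq)) (Ambiskew.toGWA_surjective _ _ _ _)
  exact_mod_cast qRoot_injective hq μ.ne_zero h

theorem matrixHom_eq_zero_of_mem {s : R (2 * r + 1) hp q} (hs : s ∈ jIdeal hp q μ lam m) :
    matrixHom hp hc hlam s = 0 := by
  rw [jIdeal, TwoSidedIdeal.mem_comap] at hs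
  refine GWA.matrixHom_eq_zero_of_mem_J _ _ _ (specialize_alpha_pow_u hp hc hlam)
    weight_zero weight_self (fun a ha => ?_) hs
  have h : TwoSidedIdeal.span {zp (2 * r + 1) hp q - algebraMap K (A (2 * r + 1) q) μ} ≤
      TwoSidedIdeal.ker (specialize r q μ) := by
    refine TwoSidedIdeal.span_le.2 ?_
    rintro _ rfl
    rw [SetLike.mem_coe, TwoSidedIdeal.mem_ker, map_sub, AlgHom.commutes, sub_eq_zero]
    exact specialize_z_last q μ
  exact (TwoSidedIdeal.mem_ker _).1 (h ha)

theorem sub_algebraMap_mem_jIdeal : (system hp q).w - algebraMap K _ lam ∈ jIdeal hp q μ lam m := by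
  rw [jIdeal, TwoSidedIdeal.mem_comap, map_sub, toGWA_w, AlgHom.commutes, sub_self]
  exact TwoSidedIdeal.zero_mem _

/-- For i = m the defining intersection is empty, so the coefficient 1 is allowed. -/
theorem y_pow_mem_jIdeal : (system hp q).y ^ m ∈ jIdeal hp q μ lam m := by
  rw [jIdeal, TwoSidedIdeal.mem_comap, map_pow]
  refine TwoSidedIdeal.subset_span (Or.inl ⟨m, 1, fun ℓ h => by omega, ?_⟩)
  have hy := Ambiskew.toGWA_y (alpha (2 * r + 1) q) _ (v_eq (2 * r + 1) hp q) lam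
  have h1 : GWA.coef (alpha (2 * r + 1) q) (u (2 * r + 1) hp q + algebraMap K _ lam) 1 = 1 := by
    refine (congrArg _ (map_one (algebraMap K _)).symm).trans ?_
    rw [GWA.coef_algebraMap, map_one]
  rw [h1, one_mul]
  exact congrArg (· ^ m) hy

theorem aeval_matrixHom_z (f : K[X]) :
    aeval (((system hp q).map (matrixHom hp hc hlam)).z : Matrix (Fin m) (Fin m) (Torus K q r)) f =
      Matrix.diagonal fun ℓ : Fin m => algebraMap K _ (f.eval (qRoot q (μ : K) (ℓ : ℕ))) := by
  have h : (((system hp q).map (matrixHom hp hc hlam)).z : Matrix (Fin m) (Fin m) (Torus K q r)) =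
      GWA.diagHom (alpha (2 * r + 1) q) (specialize r q μ) m (QuantumTorus.z _ (lastIdx r)) :=
    matrixHom_coef hp hc hlam (QuantumTorus.z _ (lastIdx r))
  rw [h, aeval_algHom_apply]
  exact GWA.diagHom_aeval _ _ _ (specialize_alpha_pow_z_last q μ) f

/-- For n ≤ m, the entries (i, i + n) of the matrix f(z) y^n are the values f(ρ_i) with i < m - n.
If they vanish, f is divisible by the product of the corresponding linear factors, which annihilates
π(y)^n. -/
theorem annIdeal_matrixHom_y_le (hq : ∀ n : ℕ, 0 < n → q ^ n ≠ 1) {B : Type*} [Ring B]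
    [Algebra K B] (π : R (2 * r + 1) hp q →ₐ[K] B) (hw : π (system hp q).w = algebraMap K B lam)
    (hy : π (system hp q).y ^ m = 0) (n : ℕ) :
    ((system hp q).map (matrixHom hp hc hlam)).annIdeal
        (((system hp q).map (matrixHom hp hc hlam)).y ^ n) ≤
      ((system hp q).map π).annIdeal (((system hp q).map π).y ^ n) := by
  intro f hf
  obtain hn | hn := le_total m n
  · rw [AmbiskewSystem.mem_annIdeal]
    change _ * π (system hp q).y ^ n = 0
    rw [← Nat.add_sub_cancel' hn, pow_add, hy, zero_mul, mul_zero]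
  · have h1 := AmbiskewSystem.qRootProd_mem_annIdeal_y (S := (system hp q).map π) (m := m)
      (hw.trans (congrArg _ hlam)) hc hq μ.ne_zero hy n (m - n) (Nat.add_sub_cancel' hn)
    refine Ideal.mem_of_dvd _ (qRootProd_dvd hq μ.ne_zero fun i hi => ?_) h1
    rw [AmbiskewSystem.mem_annIdeal, aeval_matrixHom_z] at hf
    change _ * matrixHom hp hc hlam (system hp q).y ^ n = 0 at hf
    rw [matrixHom_y] at hf
    have h2 := congrFun (congrFun hf ⟨i, by omega⟩) ⟨i + n, by omega⟩
    rw [Matrix.diagonal_mul, upShift_pow_apply, if_pos rfl, mul_one, Matrix.zero_apply,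
      FaithfulSMul.algebraMap_eq_zero_iff] at h2
    rwa [zero_add]

/-- Here the entries (i + n, i) are f(ρ_(i+n)) times products of weights with index strictly between
0 and m. These are nonzero, so f vanishes at ρ_n, …, ρ_(m-1), and the product of these factors
annihilates π(x)^n. -/
theorem annIdeal_matrixHom_x_le (hq : ∀ n : ℕ, 0 < n → q ^ n ≠ 1) {B : Type*} [Ring B]
    [Algebra K B] (π : R (2 * r + 1) hp q →ₐ[K] B) (hw : π (system hp q).w = algebraMap K B lam)
    (hy : π (system hp q).y ^ m = 0) (n : ℕ) :
    ((system hp q).map (matrixHom hp hc hlam)).annIdeal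
        (((system hp q).map (matrixHom hp hc hlam)).x ^ n) ≤
      ((system hp q).map π).annIdeal (((system hp q).map π).x ^ n) := by
  intro f hf
  have hx : ∀ n ≤ m, qRootProd q (μ : K) n (m - n) ∈
      ((system hp q).map π).annIdeal (((system hp q).map π).x ^ n) := fun n hn =>
    AmbiskewSystem.qRootProd_mem_annIdeal_x (S := (system hp q).map π) (m := m)
      (hw.trans (congrArg _ hlam)) hc hq μ.ne_zero hy n (m - n) (Nat.add_sub_cancel' hn)
  obtain hn | hn := le_total m n
  · have h1 := hx m le_rfl
    rw [AmbiskewSystem.mem_annIdeal, Nat.sub_self, qRootProd_zero, map_one, one_mul] at h1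
    rw [AmbiskewSystem.mem_annIdeal, ← Nat.add_sub_cancel' hn, pow_add, h1, zero_mul, mul_zero]
  · refine Ideal.mem_of_dvd _ (qRootProd_dvd hq μ.ne_zero fun i hi => ?_) (hx n hn)
    rw [AmbiskewSystem.mem_annIdeal, aeval_matrixHom_z] at hf
    change _ * matrixHom hp hc hlam (system hp q).x ^ n = 0 at hf
    rw [matrixHom_x] at hf
    have h2 := congrFun (congrFun hf ⟨i + n, by omega⟩) ⟨i, by omega⟩
    rw [Matrix.diagonal_mul, downShift_pow_apply, if_pos rfl, ← map_mul, Matrix.zero_apply,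
      FaithfulSMul.algebraMap_eq_zero_iff] at h2
    have h3 := (mul_eq_zero.1 h2).resolve_right (Finset.prod_ne_zero_iff.2 fun l hl => by
      simp only [Finset.mem_Ico] at hl
      exact weight_ne_zero hq l (by omega) (by omega))
    rw [add_comm]
    exact_mod_cast h3

/-- The kernel of the matrix representation is contained in every ideal containing `w - lam` and
`y ^ m`. -/
theorem eq_zero_of_matrixHom_eq_zero (hq : ∀ n : ℕ, 0 < n → q ^ n ≠ 1) {B : Type*} [Ring B]
    [Algebra K B] (π : R (2 * r + 1) hp q →ₐ[K] B) (hw : π (system hp q).w = algebraMap K B lam)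
    (hy : π (system hp q).y ^ m = 0) {s : R (2 * r + 1) hp q}
    (hs : matrixHom hp hc hlam s = 0) : π s = 0 :=
  AmbiskewSystem.eq_zero_of_map_eq_zero_of_annIdeal_le (S := system hp q) hq
    (AmbiskewSystem.normalForm_surjective _ (system_generates hp q)) (matrixHom hp hc hlam) π
    (matrixHom_w hp hc hlam) hw (annIdeal_matrixHom_y_le hp hc hlam hq π hw hy)
    (annIdeal_matrixHom_x_le hp hc hlam hq π hw hy) hs

end

end TorusExample

/-! ### Prime ideals -/

theorem isPrimeTwoSided_of_domain {S D : Type*} [Ring S] [Ring D] [NoZeroDivisors D] [Nontrivial D]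
    (f : S →+* D) {P : TwoSidedIdeal S} (hP : ∀ s, s ∈ P ↔ f s = 0) : IsPrimeTwoSided P := by
  refine ⟨fun h => ?_, fun a b h => ?_⟩
  · have h1 := (hP 1).1 (h ▸ trivial)
    rw [map_one] at h1
    exact one_ne_zero h1
  · have h1 := h 1
    rw [mul_one, hP, map_mul, mul_eq_zero] at h1
    rwa [hP, hP]

theorem isPrimeTwoSided_of_matrix {S T : Type*} [Ring S] [Ring T] [NoZeroDivisors T] [Nontrivial T]
    {m : ℕ} (hm : 0 < m) {f : S →+* Matrix (Fin m) (Fin m) T} (hf : Function.Surjective f)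
    {P : TwoSidedIdeal S} (hP : ∀ s, s ∈ P ↔ f s = 0) : IsPrimeTwoSided P := by
  have : Nonempty (Fin m) := ⟨⟨0, hm⟩⟩
  refine ⟨fun h => ?_, fun a b h => ?_⟩
  · have h1 := (hP 1).1 (h ▸ trivial)
    rw [map_one] at h1
    exact one_ne_zero h1
  · by_contra! hab
    rw [hP, hP] at hab
    have key : ∀ M : Matrix (Fin m) (Fin m) T, M ≠ 0 → ∃ i j, M i j ≠ 0 := fun M hM => by
      by_contra! h
      exact hM (Matrix.ext h)
    obtain ⟨i, j, hij⟩ := key _ hab.1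
    obtain ⟨k, l, hkl⟩ := key _ hab.2
    -- The matrix unit links a nonzero entry of the first matrix to one of the second: entry (i, l)
    -- of the triple product is the product of the two, nonzero in a domain.
    obtain ⟨s, hs⟩ := hf (Matrix.single j k 1)
    have h1 := h s
    rw [hP, map_mul, map_mul, hs] at h1
    have h2 : Matrix.single i i 1 * (f a * Matrix.single j k 1 * f b) *
        Matrix.single l l 1 = 0 := by
      rw [h1, mul_zero, zero_mul]
    rw [← mul_assoc, ← mul_assoc, Matrix.single_mul_mul_single, mul_assoc,
      ← mul_assoc, Matrix.single_mul_mul_single] at h2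
    have h3 := congrFun (congrFun h2 i) l
    simp [hij, hkl] at h3

theorem height_eq_two {α : Type*} [PartialOrder α] {a b c : α} (hab : a < b) (hbc : b < c)
    (h : ∀ x ≤ c, x = a ∨ x = b ∨ x = c) : Order.height c = 2 := by
  refine le_antisymm ?_ ?_
  · have ha : Order.height a ≤ (0 : ℕ) := by
      rw [Order.height_le_coe_iff]
      intro y hy
      rcases h y (hy.le.trans (hab.trans hbc).le) with rfl | rfl | rfl
      · exact absurd hy (lt_irrefl _)
      · exact absurd hy hab.asymm
      · exact absurd hy (hab.trans hbc).asymm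
    have hb : Order.height b ≤ (1 : ℕ) := by
      rw [Order.height_le_coe_iff]
      intro y hy
      rcases h y (hy.le.trans hbc.le) with rfl | rfl | rfl
      · exact ha.trans_lt (by norm_num)
      · exact absurd hy (lt_irrefl _)
      · exact absurd hy hbc.asymm
    refine (Order.height_le_coe_iff (n := 2)).2 fun y hy => ?_
    rcases h y hy.le with rfl | rfl | rfl
    · exact ha.trans_lt (by norm_num)
    · exact hb.trans_lt (by norm_num)
    · exact absurd hy (lt_irrefl _)
  · have h1 := Order.height_add_one_le hab
    have h2 := Order.height_add_one_le hbc
    have h3 : (1 : ℕ∞) ≤ Order.height b := le_add_self.trans h1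
    calc (2 : ℕ∞) = 1 + 1 := one_add_one_eq_two.symm
      _ ≤ _ := (add_le_add_left h3 1).trans h2

/-- The projection to the quotient by a two-sided ideal. -/
def TwoSidedIdeal.mkAlgHom (K : Type*) [Field K] {S : Type*} [Ring S] [Algebra K S]
    (P : TwoSidedIdeal S) : S →ₐ[K] P.ringCon.Quotient :=
  P.ringCon.mkₐ (α := K)

theorem TwoSidedIdeal.mkAlgHom_eq_zero {K : Type*} [Field K] {S : Type*} [Ring S] [Algebra K S]
    {P : TwoSidedIdeal S} {s : S} : P.mkAlgHom K s = 0 ↔ s ∈ P := by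
  rw [TwoSidedIdeal.mem_iff]
  exact RingCon.eq P.ringCon

namespace TorusExample

open TwistedAlgebra

variable {K : Type*} [Field K] {r : ℕ} (hp : Odd (2 * r + 1)) {q μ : Kˣ} {m : ℕ} {lam : K}

theorem algebraMap_torus_eq_zero {k : Type*} [CommRing k] [Algebra K k] {n : ℕ} {c : k}
    (h : algebraMap k (Torus k q n) c = 0) : c = 0 := by
  rw [Algebra.algebraMap_eq_smul_one, one_def, TwistedAlgebra.smul_single, smul_eq_mul,
    mul_one] at h
  rw [← coeff_single_self (q := Units.map (algebraMap K k : K →* k) q) (β := torusPairing n) 0 c, h,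
    map_zero]

/-- The polynomials in `w` behave like elements of a commutative ring modulo a prime ideal. -/
theorem aeval_w_mem_or {P : TwoSidedIdeal (R (2 * r + 1) hp q)} (hP : IsPrimeTwoSided P) (g : K[X])
    {b : R (2 * r + 1) hp q} (h : aeval (system hp q).w g * b ∈ P) :
    aeval (system hp q).w g ∈ P ∨ b ∈ P := by
  refine hP.2 _ _ fun s => ?_
  rw [((system_generates hp q).commute_aeval_w g s).eq, mul_assoc]
  exact P.mul_mem_left _ _ h

/-- Over an algebraically closed field g splits into linear factors. As w is central, the prime
contains one of them. -/
theorem exists_sub_mem [IsAlgClosed K] {P : TwoSidedIdeal (R (2 * r + 1) hp q)}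
    (hP : IsPrimeTwoSided P) {g : K[X]} (hg : g ≠ 0) (h : aeval (system hp q).w g ∈ P) :
    ∃ a : K, (system hp q).w - algebraMap K _ a ∈ P := by
  induction hn : g.natDegree generalizing g with
  | zero =>
    obtain ⟨c, rfl⟩ := natDegree_eq_zero.1 hn
    rw [aeval_C] at h
    have hc : c ≠ 0 := fun h => hg (by rw [h, C_0])
    have h1 := P.mul_mem_left (algebraMap K _ c⁻¹) _ h
    rw [← map_mul, inv_mul_cancel₀ hc, map_one, TwoSidedIdeal.one_mem_iff] at h1
    exact absurd h1 hP.1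
  | succ n ih =>
    obtain ⟨a, ha⟩ := IsAlgClosed.exists_root g
      (fun h => by have := natDegree_eq_of_degree_eq_some (n := 0) h; omega)
    obtain ⟨g', rfl⟩ := dvd_iff_isRoot.2 ha
    rw [map_mul] at h
    have hg' : g' ≠ 0 := right_ne_zero_of_mul hg
    rcases aeval_w_mem_or hp hP _ h with h1 | h1
    · exact ⟨a, by simpa using h1⟩
    · refine ih hg' h1 ?_
      rw [natDegree_mul (X_sub_C_ne_zero a) hg', natDegree_X_sub_C] at hn
      omega

section PrimeIdeals

variable (hq : ∀ n : ℕ, 0 < n → q ^ n ≠ 1)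

include hq

/-- With an indeterminate as Casimir value, w satisfies no polynomial relation in the image, so the
kernel comparison applies with the identity of R as second map. -/
theorem domainHom_X_injective {s : R (2 * r + 1) hp q} (hs : domainHom hp q (X : K[X]) s = 0) :
    s = 0 := by
  refine AmbiskewSystem.eq_zero_of_map_eq_zero (S := system hp q) hq
    (AmbiskewSystem.normalForm_surjective _ (system_generates hp q)) (domainHom hp q (X : K[X]))
    (AlgHom.id K _) (domainHom_x_ne_zero hp q _) (domainHom_y_ne_zero hp q _)
    (zIndependent_domainHom hp q _) (fun g hg => ?_) hs
  rw [aeval_domainHom_w, aeval_X_left_apply] at hg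
  rw [algebraMap_torus_eq_zero hg, map_zero]

theorem eq_zero_of_domainHom_eq_zero {B : Type*} [Ring B] [Algebra K B]
    (π : R (2 * r + 1) hp q →ₐ[K] B) (hw : π (system hp q).w = algebraMap K B lam)
    {s : R (2 * r + 1) hp q} (hs : domainHom hp q lam s = 0) : π s = 0 := by
  refine AmbiskewSystem.eq_zero_of_map_eq_zero (S := system hp q) hq
    (AmbiskewSystem.normalForm_surjective _ (system_generates hp q)) (domainHom hp q lam)
    π (domainHom_x_ne_zero hp q _) (domainHom_y_ne_zero hp q _)
    (zIndependent_domainHom hp q _) (fun g hg => ?_) hs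
  rw [aeval_domainHom_w] at hg
  rw [hw, aeval_algebraMap_apply, algebraMap_torus_eq_zero hg, map_zero]

/-- Centrality of g(w) gives g(w) ∈ P or y^N ∈ P. In the second case a nonzero quadratic in w times
y^(N-1) lies in P, and the exponent descends. -/
theorem exists_aeval_w_mem {P : TwoSidedIdeal (R (2 * r + 1) hp q)} (hP : IsPrimeTwoSided P) (N : ℕ)
    {g : K[X]} (hg : g ≠ 0) (h : aeval (system hp q).w g * (system hp q).y ^ N ∈ P) :
    ∃ g : K[X], g ≠ 0 ∧ aeval (system hp q).w g ∈ P := by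
  induction N generalizing g with
  | zero =>
    rw [pow_zero, mul_one] at h
    exact ⟨g, hg, h⟩
  | succ N ih =>
    rcases aeval_w_mem_or hp hP g h with h1 | h1
    · exact ⟨g, hg, h1⟩
    · obtain ⟨κ, hκ⟩ := AmbiskewSystem.exists_sq_sub_mul_pow_eq_zero
        (c := (q : K) ^ r) (r := r) hq N
      refine ih (g := X ^ 2 - C κ) (X_pow_sub_C_ne_zero two_pos κ) ?_
      rw [← TwoSidedIdeal.mkAlgHom_eq_zero (K := K), map_pow] at h1
      rw [← TwoSidedIdeal.mkAlgHom_eq_zero (K := K), map_mul, map_pow, ← aeval_algHom_apply]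
      exact hκ ((system hp q).map (P.mkAlgHom K)) h1

/-- Nonzero prime ideals contain `w - a` for some scalar `a`. -/
theorem exists_sub_mem_of_ne_bot [IsAlgClosed K] {P : TwoSidedIdeal (R (2 * r + 1) hp q)}
    (hP : IsPrimeTwoSided P) (h0 : P ≠ ⊥) :
    ∃ a : K, (system hp q).w - algebraMap K _ a ∈ P := by
  obtain ⟨s, hs, hs0⟩ : ∃ s ∈ P, s ≠ 0 := by
    by_contra! h
    refine h0 (le_antisymm (fun s hs => ?_) bot_le)
    rw [h s hs]
    exact TwoSidedIdeal.zero_mem _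
  obtain ⟨g, N, hg, hgN⟩ := AmbiskewSystem.exists_aeval_mul_pow_of_map_ne_zero (S := system hp q) hq
    (AmbiskewSystem.normalForm_surjective _ (system_generates hp q)) (domainHom hp q (X : K[X]))
    (P.mkAlgHom K) (domainHom_x_ne_zero hp q _) (domainHom_y_ne_zero hp q _)
    (fun h => hs0 (domainHom_X_injective hp hq h)) (TwoSidedIdeal.mkAlgHom_eq_zero.2 hs)
  rw [aeval_algHom_apply, ← map_pow, ← map_mul, TwoSidedIdeal.mkAlgHom_eq_zero] at hgN
  obtain ⟨g', hg', h⟩ := exists_aeval_w_mem hp hq hP N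
    (fun h => hg (by rw [h, map_zero])) hgN
  exact exists_sub_mem hp hP hg' h

end PrimeIdeals

variable (hc : (q : K) ^ r = q * (qRoot q (μ : K) 0 * qRoot q (μ : K) m))
  (hlam : lam = -((q : K) * (qRoot q (μ : K) 0 + qRoot q (μ : K) m)))
  (hq : ∀ n : ℕ, 0 < n → q ^ n ≠ 1) (hm : 0 < m)

theorem mkAlgHom_w {P : TwoSidedIdeal (R (2 * r + 1) hp q)}
    (h : (system hp q).w - algebraMap K _ lam ∈ P) :
    P.mkAlgHom K (system hp q).w = algebraMap K _ lam := by
  rw [← TwoSidedIdeal.mkAlgHom_eq_zero (K := K), map_sub, AlgHom.commutes, sub_eq_zero] at h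
  exact h

-- One inclusion is checked on the generators of J. For the other, the ideal contains w - λ and y^m,
-- and the kernel of the matrix representation lies in every such ideal.
include hq in
theorem mem_jIdeal_iff {s : R (2 * r + 1) hp q} :
    s ∈ jIdeal hp q μ lam m ↔ matrixHom hp hc hlam s = 0 := by
  refine ⟨matrixHom_eq_zero_of_mem hp hc hlam, fun h => ?_⟩
  rw [← TwoSidedIdeal.mkAlgHom_eq_zero (K := K)]
  refine eq_zero_of_matrixHom_eq_zero hp hc hlam hq _
    (mkAlgHom_w hp (sub_algebraMap_mem_jIdeal hp)) ?_ h
  rw [← map_pow, TwoSidedIdeal.mkAlgHom_eq_zero]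
  exact y_pow_mem_jIdeal hp

include hc hlam hq hm

theorem isPrimeTwoSided_jIdeal : IsPrimeTwoSided (jIdeal hp q μ lam m) :=
  isPrimeTwoSided_of_matrix hm (f := (matrixHom hp hc hlam).toRingHom)
    (matrixHom_surjective hp hc hlam hq) fun _ => mem_jIdeal_iff hp hc hlam hq

theorem rightGoldieRank_jIdeal :
    rightGoldieRank (jIdeal hp q μ lam m).ringCon.Quotient = m := by
  rw [← rightGoldieRank_matrix (K := K) (q := Units.map (algebraMap K K : K →* K) q)
    (β := torusPairing r) hm]
  refine rightGoldieRank_eq_of_surjective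
    (f := ((jIdeal hp q μ lam m).mkAlgHom K).toRingHom)
    (f' := (matrixHom hp hc hlam).toRingHom) (RingCon.mkₐ_surjective _)
    (matrixHom_surjective hp hc hlam hq) fun s => ?_
  exact TwoSidedIdeal.mkAlgHom_eq_zero.trans (mem_jIdeal_iff hp hc hlam hq)

theorem eq_of_sub_mem_jIdeal {a : K}
    (h : (system hp q).w - algebraMap K _ a ∈ jIdeal hp q μ lam m) :
    a = lam := by
  by_contra hne
  have h1 := (jIdeal hp q μ lam m).sub_mem h (sub_algebraMap_mem_jIdeal hp)
  rw [sub_sub_sub_cancel_left, ← map_sub] at h1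
  have h2 := (jIdeal hp q μ lam m).mul_mem_left (algebraMap K _ (lam - a)⁻¹) _ h1
  rw [← map_mul, inv_mul_cancel₀ (sub_ne_zero.2 (Ne.symm hne)), map_one,
    TwoSidedIdeal.one_mem_iff] at h2
  exact (isPrimeTwoSided_jIdeal hp hc hlam hq hm).1 h2

theorem height_jIdeal [IsAlgClosed K] :
    Order.height (⟨jIdeal hp q μ lam m, isPrimeTwoSided_jIdeal hp hc hlam hq hm⟩ :
      PrimeSpec (R (2 * r + 1) hp q)) = 2 := by
  have hker : ∀ s, s ∈ TwoSidedIdeal.ker (domainHom hp q lam) ↔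
      domainHom hp q lam s = 0 := fun s => TwoSidedIdeal.mem_ker _
  have hbot : IsPrimeTwoSided (⊥ : TwoSidedIdeal (R (2 * r + 1) hp q)) :=
    isPrimeTwoSided_of_domain (domainHom hp q (X : K[X])).toRingHom fun s => by
      rw [TwoSidedIdeal.mem_bot]
      exact ⟨fun h => by rw [h, map_zero], domainHom_X_injective hp hq⟩
  have hprime : IsPrimeTwoSided (TwoSidedIdeal.ker (domainHom hp q lam)) :=
    isPrimeTwoSided_of_domain (domainHom hp q lam).toRingHom hker
  have hwker : (system hp q).w - algebraMap K _ lam ∈ TwoSidedIdeal.ker (domainHom hp q lam) := by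
    rw [hker, map_sub, domainHom_w, AlgHom.commutes, sub_self]
  have hker_le : ∀ P : TwoSidedIdeal (R (2 * r + 1) hp q),
      (system hp q).w - algebraMap K _ lam ∈ P → TwoSidedIdeal.ker (domainHom hp q lam) ≤ P := by
    intro P hP s hs
    rw [← TwoSidedIdeal.mkAlgHom_eq_zero (K := K)]
    exact eq_zero_of_domainHom_eq_zero hp hq _ (mkAlgHom_w hp hP) ((hker s).1 hs)
  refine height_eq_two (a := ⟨⊥, hbot⟩) (b := ⟨_, hprime⟩) ?_ ?_ ?_
  · refine Subtype.mk_lt_mk.2 (bot_lt_iff_ne_bot.2 fun h => ?_)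
    rw [h, TwoSidedIdeal.mem_bot] at hwker
    have h1 := congrArg (domainHom hp q (X : K[X])) hwker
    rw [map_sub, domainHom_w, AlgHom.commutes, map_zero,
      IsScalarTower.algebraMap_apply K K[X] (Torus K[X] q (r + 1)), ← map_sub] at h1
    exact X_sub_C_ne_zero lam (algebraMap_torus_eq_zero h1)
  · refine Subtype.mk_lt_mk.2 (lt_of_le_of_ne
      (hker_le _ (sub_algebraMap_mem_jIdeal hp)) fun h => ?_)
    -- The inclusion is strict: y^m lies in the larger ideal, but y is nonzero in the domain.
    have h1 := y_pow_mem_jIdeal hp (q := q) (μ := μ) (lam := lam) (m := m)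
    rw [← h, hker, map_pow] at h1
    exact pow_ne_zero m (domainHom_y_ne_zero hp q lam) h1
  · rintro ⟨P, hP⟩ hle
    rw [Subtype.mk_le_mk] at hle
    simp only [Subtype.mk.injEq]
    by_cases h0 : P = ⊥
    · exact Or.inl h0
    · obtain ⟨a, ha⟩ := exists_sub_mem_of_ne_bot hp hq hP h0
      obtain rfl := eq_of_sub_mem_jIdeal hp hc hlam hq hm (hle ha)
      have hw := mkAlgHom_w hp ha
      by_cases h1 : P ≤ TwoSidedIdeal.ker (domainHom hp q a)
      · exact Or.inr (Or.inl (le_antisymm h1 (hker_le P ha)))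
      -- An element of P outside the kernel gives g(w) y^N ∈ P with g(a) ≠ 0. Modulo P the factor
      -- g(w) is the nonzero scalar g(a), so y^N ∈ P; hence y^m ∈ P, and P is the whole ideal.
      · obtain ⟨s, hs, hs0⟩ := SetLike.not_le_iff_exists.1 h1
        obtain ⟨g, N, hg, hgN⟩ := AmbiskewSystem.exists_aeval_mul_pow_of_map_ne_zero
          (S := system hp q) hq (AmbiskewSystem.normalForm_surjective _ (system_generates hp q))
          (domainHom hp q a) (P.mkAlgHom K) (domainHom_x_ne_zero hp q _)
          (domainHom_y_ne_zero hp q _) (fun h => hs0 ((hker s).2 h))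
          (TwoSidedIdeal.mkAlgHom_eq_zero.2 hs)
        have hga : aeval a g ≠ 0 := fun h => hg (by rw [aeval_domainHom_w, h, map_zero])
        rw [hw, aeval_algebraMap_apply, ← Algebra.smul_def, smul_eq_zero_iff_right hga] at hgN
        have hy := AmbiskewSystem.pow_y_eq_zero_of_pow_y_eq_zero
          (S := (system hp q).map (P.mkAlgHom K)) (hw.trans (congrArg _ hlam)) hc hq
          μ.ne_zero hm hgN
        refine Or.inr (Or.inr (le_antisymm hle fun s hs => ?_))
        rw [← TwoSidedIdeal.mkAlgHom_eq_zero (K := K)]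
        exact eq_zero_of_matrixHom_eq_zero hp hc hlam hq _ hw hy
          (matrixHom_eq_zero_of_mem hp hc hlam hs)

end TorusExample

/-! ### The numerical data of the ideals F_{m,ε}. -/

namespace TorusExample

variable {K : Type*} [Field K] {r : ℕ} (hp : Odd (2 * r + 1)) {q t : Kˣ}

/-- The value of the last generator on the ideal `F_{m,ε}`. -/
def rootUnit (r : ℕ) (t : Kˣ) (m : ℕ) (ε : ℤˣ) : Kˣ :=
  Units.map (Int.castRingHom K) ε * t ^ (((2 * r + 1 : ℕ) : ℤ) + 2 * m - 3)

/-- The value of the Casimir element on the ideal `F_{m,ε}`. -/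
def casimirValue (r : ℕ) (q t : Kˣ) (m : ℕ) (ε : ℤˣ) : K :=
  -(((ε : ℤ) : K) * ((t ^ (((2 * r + 1 : ℕ) : ℤ) - 2 * m + 1) : Kˣ) : K) * ((q : K) ^ m + 1))

theorem F_eq_jIdeal (m : ℕ) (ε : ℤˣ) : F (2 * r + 1) hp q t m ε =
    jIdeal hp q (rootUnit r t m ε) (casimirValue r q t m ε) m := rfl

/-- The sign squares away, and in powers of t the exponent is 4 - 4m + 2(p + 2m - 3) = 2(p - 1) =
4r. -/
theorem pow_eq_mul_qRoot (ht : t ^ 4 = q) (m : ℕ) (ε : ℤˣ) : (q : K) ^ r =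
    q * (qRoot q (rootUnit r t m ε : K) 0 * qRoot q (rootUnit r t m ε : K) m) := by
  have hε : Units.map (Int.castRingHom K : ℤ →* K) ε *
      Units.map (Int.castRingHom K : ℤ →* K) ε = 1 := by
    rw [← map_mul, Int.units_mul_self, map_one]
  have h : q ^ r =
      q * (q ^ (-(0 : ℤ)) * rootUnit r t m ε * (q ^ (-(m : ℤ)) * rootUnit r t m ε)) := by
    calc q ^ r = q * (q ^ (-(m : ℤ)) * (t ^ (((2 * r + 1 : ℕ) : ℤ) + 2 * m - 3) *
          t ^ (((2 * r + 1 : ℕ) : ℤ) + 2 * m - 3))) := by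
            rw [← ht, ← zpow_natCast t 4, ← zpow_mul, ← zpow_natCast, ← zpow_mul, ← zpow_add,
              ← zpow_add, ← zpow_add]
            congr 1
            push_cast
            ring
      _ = q * (q ^ (-(m : ℤ)) * ((Units.map (Int.castRingHom K : ℤ →* K) ε *
          Units.map (Int.castRingHom K : ℤ →* K) ε) * (t ^ (((2 * r + 1 : ℕ) : ℤ) + 2 * m - 3) *
          t ^ (((2 * r + 1 : ℕ) : ℤ) + 2 * m - 3)))) := by rw [hε, one_mul]
      _ = _ := by
        rw [neg_zero, zpow_zero, one_mul, rootUnit]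
        simp only [mul_assoc, mul_left_comm, mul_comm]
  simpa [qRoot] using congrArg (Units.val : Kˣ → K) h

/-- The two summands of q^m + 1 correspond to the two roots: q ρ_0 = ε q^m t^(p-2m+1) and q ρ_m = ε
t^(p-2m+1). -/
theorem casimirValue_eq (ht : t ^ 4 = q) (m : ℕ) (ε : ℤˣ) : casimirValue r q t m ε =
    -((q : K) * (qRoot q (rootUnit r t m ε : K) 0 + qRoot q (rootUnit r t m ε : K) m)) := by
  have h1 : q * t ^ (((2 * r + 1 : ℕ) : ℤ) + 2 * m - 3) =
      q ^ m * t ^ (((2 * r + 1 : ℕ) : ℤ) - 2 * m + 1) := by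
    rw [← ht, ← zpow_natCast t 4, ← zpow_natCast, ← zpow_mul, ← zpow_add, ← zpow_add]
    congr 1
    push_cast
    ring
  have h2 : q * q ^ (-(m : ℤ)) * t ^ (((2 * r + 1 : ℕ) : ℤ) + 2 * m - 3) =
      t ^ (((2 * r + 1 : ℕ) : ℤ) - 2 * m + 1) := by
    rw [mul_right_comm, h1, zpow_neg, zpow_natCast, mul_right_comm, mul_inv_cancel, one_mul]
  replace h1 := congrArg (Units.val : Kˣ → K) h1
  replace h2 := congrArg (Units.val : Kˣ → K) h2
  rw [Units.val_mul, Units.val_mul, Units.val_pow_eq_pow_val] at h1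
  rw [Units.val_mul, Units.val_mul] at h2
  have h3 : (rootUnit r t m ε : K) =
    ((ε : ℤ) : K) * ((t ^ (((2 * r + 1 : ℕ) : ℤ) + 2 * m - 3) : Kˣ) : K) := rfl
  rw [casimirValue, qRoot, qRoot, h3, neg_zero, zpow_zero, Units.val_one]
  linear_combination (((ε : ℤ) : K)) * h1 + (((ε : ℤ) : K)) * h2

/-- The values are negatives of each other, so equality forces q^m = -1 when 2 ≠ 0, and then q^(2m)
= 1. -/
theorem casimirValue_injective (hq : ∀ n : ℕ, 0 < n → q ^ n ≠ 1) {m : ℕ} (hm : 0 < m)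
    (h2 : (2 : K) ≠ 0) : casimirValue r q t m 1 ≠ casimirValue r q t m (-1) := by
  intro h
  have h3 : (2 : K) * (((t ^ (((2 * r + 1 : ℕ) : ℤ) - 2 * m + 1) : Kˣ) : K) *
      ((q : K) ^ m + 1)) = 0 := by
    simp only [casimirValue, Units.val_one, Units.val_neg, Int.cast_one, Int.cast_neg] at h
    linear_combination -h
  have h4 := ((mul_eq_zero.1 h3).resolve_left h2)
  have h5 := (mul_eq_zero.1 h4).resolve_left (Units.ne_zero _)
  refine hq (m * 2) (by omega) (Units.ext ?_)
  rw [Units.val_pow_eq_pow_val, Units.val_one, pow_mul]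
  linear_combination ((q : K) ^ m - 1) * h5

end TorusExample

theorem corollary4p10 {K : Type*} [Field K] [IsAlgClosed K]
    (p : ℕ) (hp : Odd p)
    (q : Kˣ) (hq : ∀ n : ℕ, 0 < n → q ^ n ≠ 1)
    (t : Kˣ) (ht : t ^ 4 = q)
    (m : ℕ) (hm : 0 < m) :
    (∀ ε : ℤˣ,
      (∃ hF : IsPrimeTwoSided (TorusExample.F p hp q t m ε),
        Order.height (⟨TorusExample.F p hp q t m ε, hF⟩ : PrimeSpec (TorusExample.R p hp q)) = 2) ∧
      rightGoldieRank (TorusExample.F p hp q t m ε).ringCon.Quotient = (m : ℕ∞)) ∧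
    ((2 : K) ≠ 0 → TorusExample.F p hp q t m 1 ≠ TorusExample.F p hp q t m (-1)) := by
  obtain ⟨r, rfl⟩ := id hp
  refine ⟨fun ε => ?_, fun h2 h => ?_⟩
  · have hc := TorusExample.pow_eq_mul_qRoot (r := r) ht m ε
    have hlam := TorusExample.casimirValue_eq (r := r) ht m ε
    -- The ideal occurs inside the types of the goal; naming it allows it to be replaced everywhere
    -- at once.
    generalize hF : TorusExample.F (2 * r + 1) hp q t m ε = F
    rw [TorusExample.F_eq_jIdeal] at hF
    subst hF
    exact ⟨⟨_, TorusExample.height_jIdeal hp hc hlam hq hm⟩,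
      TorusExample.rightGoldieRank_jIdeal hp hc hlam hq hm⟩
  -- If the two ideals agreed, one proper ideal would contain w - λ for both Casimir values.
  · have hmem : (TorusExample.system hp q).w -
        algebraMap K _ (TorusExample.casimirValue r q t m 1) ∈
          TorusExample.F (2 * r + 1) hp q t m 1 := by
      rw [TorusExample.F_eq_jIdeal]
      exact TorusExample.sub_algebraMap_mem_jIdeal hp
    rw [h, TorusExample.F_eq_jIdeal] at hmem
    exact TorusExample.casimirValue_injective hq hm h2 (TorusExample.eq_of_sub_mem_jIdeal hp
      (TorusExample.pow_eq_mul_qRoot (r := r) ht m (-1))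
      (TorusExample.casimirValue_eq (r := r) ht m (-1)) hq hm hmem)
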